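/- **Wavelets.** Let $\phi=1_{[0,1]}$, let $r>0$, and let $\Phi=(\phi,\psi,\tilde\phi,\tilde\psi)$ generate a biorthogonal wavelet basis with parameter $r$: $\tilde\phi,\tilde\psi$ are compactly supported and belong to the Hölder space $C^{r+1}$; $\psi$ is compactly supported, piecewise constant and orthogonal to all polynomials of degree at most $r$; and, with $\Lambda=\{(j,k):j\ge-1,\ k\in\mathbb Z\}$, $\varphi_{(-1,k)}(x)=\phi(x-k)$, $\varphi_{(j,k)}(x)=2^{j/2}\psi(2^jx-k)$ for $j\ge0$, and $\tilde\varphi_\lambda$ defined in the same way from $\tilde\phi,\tilde\psi$, one has $\int\varphi_\lambda\tilde\varphi_{\lambda'}=1_{\lambda=\lambda'}$ for all $\lambda,\lambda'\in\Lambda$ and $f=\sum_{\lambda\in\Lambda}\beta_\lambda\tilde\varphi_\lambda$ (unconditionally in $\mathbb L_2(\mathbb R)$), $\beta_\lambda=\int\varphi_\lambda f$, for all $f\in\mathbb L_2(\mathbb R)$. The Haar basis ($\tilde\phi=\phi$, $\tilde\psi=\psi=1_{[0,1/2]}-1_{[1/2,1]}$) is also admitted, with $r=0$. **Classes.** For $\alpha>0$,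 $1\le p<\infty$, $1\le q\le\infty$ let $\mathcal B^\alpha_{p,q}(R)$ be the set of $f$ with $\|f\|_{\alpha,p,q}\le R$, where $$\|f\|_{\alpha,p,q}=\|(\beta_{-1,k})_k\|_{\ell_p}+\Big\|\Big(2^{j(\alpha+\frac12-\frac1p)}\|(\beta_{j,k})_k\|_{\ell_p}\Big)_{j\ge0}\Big\|_{\ell_q},$$ and let $\mathcal L_{1,2,\infty}(R')=\{f:\|f\|_1\le R',\ \|f\|_2\le R',\ \|f\|_\infty\le R'\}$. **Estimator.** For an integer $n\ge2$ let $N$ be a Poisson process on $\mathbb R$ with mean measure $nf(x)\,dx$, where $f\ge0$. For $\gamma>0$ and $\lambda\in\Lambda$ put $\hat\beta_\lambda=\frac1n\sum_{T\in N}\varphi_\lambda(T)$, $\hat V_{\lambda,n}=\frac1{n^2}\sum_{T\in N}\varphi_\lambda^2(T)$, $$\tilde V_{\lambda,n}=\hat V_{\lambda,n}+\sqrt{2\gamma\log n\,\hat V_{\lambda,n}\frac{\|\varphi_\lambda\|_\infty^2}{n^2}}+3\gamma\log n\frac{\|\varphi_\lambda\|_\infty^2}{n^2},\qquad \eta_{\lambda,\gamma}=\sqrt{2\gamma\tilde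 V_{\lambda,n}\log n}+\frac{\gamma\log n}{3n}\|\varphi_\lambda\|_\infty .$$ Given $c\ge1$, let $j_0=j_0(n)$ be the integer with $2^{j_0}\le n^c(\log n)^{-c}<2^{j_0+1}$, and set $$\tilde f_{n,\gamma}=\sum_{\lambda=(j,k)\in\Lambda,\ j\le j_0}\hat\beta_\lambda\,1_{\{|\hat\beta_\lambda|\ge\eta_{\lambda,\gamma}\}}\,\tilde\varphi_\lambda .$$ **Theorem 3.** Let $R,R'>0$, $1\le p\le2$, and let $\alpha\in\mathbb R$ satisfy $\max\left(0,\frac1p-\frac12\right)<\alpha<r+1$. Let $c\ge1$ be large enough that $\alpha\left(1-\frac1{c(1+2\alpha)}\right)\ge\frac1p-\frac12$, and let $\gamma>c$. Then there is a constant $C=C(\gamma,c,R,R',\alpha,p,\Phi)$ such that for all $1\le q\le\infty$ and all integers $n\ge2$, $$\sup_{f}\ \mathbb E\left(\|\tilde f_{n,\gamma}-f\|_2^2\right)\le C\left(\frac{\log n}{n}\right)^{\frac{2\alpha}{2\alpha+1}},$$ where the supremum runs over all $f\ge0$ in $\mathcal B^\alpha_{p,q}(R)\cap\mathcal L_{1,2,\infty}(R')$.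 -/

import Mathlib

open MeasureTheory ProbabilityTheory Filter Topology
open scoped ENNReal NNReal

noncomputable section

namespace PoissonWavelet

/-! ## Poisson processes -/

/-- The number `N_A` of points of the random set `N` that lie in `A`. -/
def numPoints {Ω X : Type*} (N : Ω → Set X) (A : Set X) (ω : Ω) : ℕ∞ :=
  (N ω ∩ A).encard

/-- `N` is a Poisson process with mean measure `μ`: a random countable set of points such that
`N_A` is a Poisson random variable with parameter `μ A` for all measurable `A` (almost surely
infinite if `μ A = ∞`), and such that the variables `N_{A_1}, …, N_{A_m}` are independent for all
finite families of pairwise disjoint measurable sets. -/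
structure IsPoissonProcess {Ω X : Type*} [MeasurableSpace Ω] [MeasurableSpace X]
    (N : Ω → Set X) (P : Measure Ω) (μ : Measure X) : Prop where
  countable : ∀ ω, (N ω).Countable
  measurable : ∀ A, MeasurableSet A → Measurable (numPoints N A)
  law : ∀ A, MeasurableSet A → μ A ≠ ∞ →
    P.map (numPoints N A) = (poissonMeasure (μ A).toNNReal).map ((↑) : ℕ → ℕ∞)
  law_top : ∀ A, MeasurableSet A → μ A = ∞ → ∀ᵐ ω ∂P, numPoints N A ω = ⊤
  indep : ∀ (m : ℕ) (A : Fin m → Set X), (∀ i, MeasurableSet (A i)) →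
    Pairwise (fun i j => Disjoint (A i) (A j)) → iIndepFun (fun i => numPoints N (A i)) P

/-- The integral `∫ g dN = ∑_{T ∈ N} g(T)` with respect to the point set `S`. -/
def pointSum (S : Set ℝ) (g : ℝ → ℝ) : ℝ := ∑' T : S, g T

/-! ## Biorthogonal wavelet bases -/

/-- The analysis father wavelet `φ = 1_[0,1]`. -/
def father : ℝ → ℝ := (Set.Icc 0 1).indicator 1

/-- The remaining three functions that generate a biorthogonal wavelet system. -/
structure WaveletSystem where
  /-- the analysis mother wavelet `ψ` -/
  psi : ℝ → ℝ
  /-- the reconstruction father wavelet -/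
  dualPhi : ℝ → ℝ
  /-- the reconstruction mother wavelet -/
  dualPsi : ℝ → ℝ

/-- The index set `Λ = {(j, k) : j ≥ -1, k ∈ ℤ}`: `Sum.inl k` is the index `(-1, k)` and
`Sum.inr (j, k)` is the index `(j, k)` with `j ≥ 0`. -/
abbrev WaveletIndex : Type := ℤ ⊕ (ℕ × ℤ)

/-- The resolution level `j` of the index `(j, k)`. -/
def WaveletIndex.level : WaveletIndex → ℤ
  | Sum.inl _ => -1
  | Sum.inr (j, _) => (j : ℤ)

/-- The functions `x ↦ g(x - k)` and `x ↦ 2^(j/2) h(2^j x - k)`, for all indices. -/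
def dilate (g h : ℝ → ℝ) : WaveletIndex → ℝ → ℝ
  | Sum.inl k => fun x => g (x - (k : ℝ))
  | Sum.inr (j, k) => fun x => (2 : ℝ) ^ ((j : ℝ) / 2) * h ((2 : ℝ) ^ j * x - (k : ℝ))

namespace WaveletSystem

/-- The analysis functions `φ_λ`. -/
def analysis (Φ : WaveletSystem) : WaveletIndex → ℝ → ℝ := dilate father Φ.psi

/-- The reconstruction functions `φ̃_λ`. -/
def synthesis (Φ : WaveletSystem) : WaveletIndex → ℝ → ℝ := dilate Φ.dualPhi Φ.dualPsi

/-- The coefficients `β_λ = ∫ φ_λ f`. -/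
def coeff (Φ : WaveletSystem) (f : ℝ → ℝ) (l : WaveletIndex) : ℝ :=
  ∫ x, Φ.analysis l x * f x

end WaveletSystem

/-- Piecewise constant functions: there are finitely many breakpoints such that the function is
constant on every interval that contains none of them. -/
def IsPiecewiseConstant (g : ℝ → ℝ) : Prop :=
  ∃ S : Finset ℝ, ∀ x y : ℝ, x ≤ y → (∀ t ∈ S, t ∉ Set.Icc x y) → g x = g y

/-- The Hölder space `C^s` for real `s > 0`: with `m` the largest integer smaller than `s`, the
function is `m` times continuously differentiable, its derivatives up to order `m` are bounded,
and the `m`-th one is Hölder continuous with exponent `s - m ∈ (0, 1]`. -/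
def MemHolder (s : ℝ) (g : ℝ → ℝ) : Prop :=
  ∃ m : ℕ, (m : ℝ) < s ∧ s ≤ m + 1 ∧ ContDiff ℝ m g ∧
    (∀ i ≤ m, ∃ B : ℝ, ∀ x, |iteratedDeriv i g x| ≤ B) ∧
    ∃ L : ℝ, ∀ x y, |iteratedDeriv m g x - iteratedDeriv m g y| ≤ L * |x - y| ^ (s - m)

/-- Biorthogonal wavelet bases of `L²(ℝ)` with `φ = 1_[0,1]`, a piecewise constant analysis
wavelet and regular reconstruction wavelets, with parameter `r > 0`. -/
structure WaveletSystem.IsBiorthogonalBasis (Φ : WaveletSystem) (r : ℝ) : Prop where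
  r_pos : 0 < r
  compact_dualPhi : HasCompactSupport Φ.dualPhi
  compact_dualPsi : HasCompactSupport Φ.dualPsi
  holder_dualPhi : MemHolder (r + 1) Φ.dualPhi
  holder_dualPsi : MemHolder (r + 1) Φ.dualPsi
  compact_psi : HasCompactSupport Φ.psi
  piecewise_psi : IsPiecewiseConstant Φ.psi
  vanishing : ∀ Q : Polynomial ℝ, (Q.natDegree : ℝ) ≤ r → ∫ x, Q.eval x * Φ.psi x = 0
  biorthogonal : ∀ l l' : WaveletIndex,
    ∫ x, Φ.analysis l x * Φ.synthesis l' x = if l = l' then 1 else 0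
  /-- the two families are bases: `f = ∑_λ β_λ φ̃_λ`, unconditionally in `L²`, for `f ∈ L²` -/
  decomposition : ∀ f : ℝ → ℝ, MemLp f 2 volume →
    Tendsto (fun F : Finset WaveletIndex =>
      eLpNorm (fun x => f x - ∑ l ∈ F, Φ.coeff f l * Φ.synthesis l x) 2 volume) atTop (𝓝 0)

/-- The Haar system: `ψ = 1_[0,1/2] - 1_[1/2,1]`, with reconstruction functions `φ` and `ψ`. -/
def haar : WaveletSystem where
  psi := (Set.Icc 0 (1 / 2)).indicator 1 - (Set.Icc (1 / 2) 1).indicator 1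
  dualPhi := father
  dualPsi := (Set.Icc 0 (1 / 2)).indicator 1 - (Set.Icc (1 / 2) 1).indicator 1

/-- The wavelet bases under consideration: the biorthogonal bases with parameter `r > 0`, and the
Haar basis, which has the parameter `r = 0`. -/
def WaveletSystem.IsAdmissible (Φ : WaveletSystem) (r : ℝ) : Prop :=
  Φ.IsBiorthogonalBasis r ∨ (r = 0 ∧ Φ = haar)

/-! ## Function classes -/

/-- The `ℓ_p`-norm of a family of extended nonnegative numbers, `1 ≤ p ≤ ∞`. -/
def ellNorm {ι : Type*} (p : ℝ≥0∞) (a : ι → ℝ≥0∞) : ℝ≥0∞ :=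
  if p = ∞ then ⨆ i, a i else (∑' i, a i ^ p.toReal) ^ (1 / p.toReal)

/-- The sequential Besov norm `‖f‖_{α,p,q}` in the basis `Φ`. (For `p = ∞` the number
`1 / p.toReal` is `0`.) -/
def besovNorm (Φ : WaveletSystem) (α : ℝ) (p q : ℝ≥0∞) (f : ℝ → ℝ) : ℝ≥0∞ :=
  ellNorm p (fun k : ℤ => ENNReal.ofReal |Φ.coeff f (Sum.inl k)|) +
    ellNorm q (fun j : ℕ =>
      ENNReal.ofReal ((2 : ℝ) ^ ((j : ℝ) * (α + 1 / 2 - 1 / p.toReal))) *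
        ellNorm p (fun k : ℤ => ENNReal.ofReal |Φ.coeff f (Sum.inr (j, k))|))

/-- The Besov ball of radius `R`. -/
def besovBall (Φ : WaveletSystem) (α : ℝ) (p q : ℝ≥0∞) (R : ℝ) : Set (ℝ → ℝ) :=
  {f | besovNorm Φ α p q f ≤ ENNReal.ofReal R}

/-- The set of functions with `‖f‖_1 ≤ R`, `‖f‖_2 ≤ R` and `‖f‖_∞ ≤ R`. -/
def ballL12Inf (R : ℝ) : Set (ℝ → ℝ) :=
  {f | AEStronglyMeasurable f volume ∧ eLpNorm f 1 volume ≤ ENNReal.ofReal R ∧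
    eLpNorm f 2 volume ≤ ENNReal.ofReal R ∧ eLpNorm f ∞ volume ≤ ENNReal.ofReal R}

/-! ## The thresholding estimator, as a function of the observed point set `S` -/

/-- The norm `‖g‖_∞`. -/
def supNorm (g : ℝ → ℝ) : ℝ := (eLpNorm g ∞ volume).toReal

/-- The empirical coefficient `β̂_λ = (1/n) ∫ φ_λ dN`. -/
def empCoeff (Φ : WaveletSystem) (n : ℕ) (S : Set ℝ) (l : WaveletIndex) : ℝ :=
  1 / (n : ℝ) * pointSum S (Φ.analysis l)

/-- `V̂_{λ,n} = (1/n²) ∫ φ_λ² dN`. -/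
def empVar (Φ : WaveletSystem) (n : ℕ) (S : Set ℝ) (l : WaveletIndex) : ℝ :=
  1 / (n : ℝ) ^ 2 * pointSum S (fun x => Φ.analysis l x ^ 2)

/-- `Ṽ_{λ,n}`, the slight overestimate of `V̂_{λ,n}`. -/
def overVar (Φ : WaveletSystem) (γ : ℝ) (n : ℕ) (S : Set ℝ) (l : WaveletIndex) : ℝ :=
  empVar Φ n S l +
    √(2 * γ * Real.log n * empVar Φ n S l * (supNorm (Φ.analysis l) ^ 2 / (n : ℝ) ^ 2)) +
    3 * γ * Real.log n * (supNorm (Φ.analysis l) ^ 2 / (n : ℝ) ^ 2)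

/-- The threshold `η_{λ,γ}`. -/
def threshold (Φ : WaveletSystem) (γ : ℝ) (n : ℕ) (S : Set ℝ) (l : WaveletIndex) : ℝ :=
  √(2 * γ * overVar Φ γ n S l * Real.log n) +
    γ * Real.log n / (3 * n) * supNorm (Φ.analysis l)

open Classical in
/-- The thresholded coefficient: `β̂_λ` if `|β̂_λ| ≥ η_{λ,γ}` and the level of `λ` is at most `j₀`,
and `0` otherwise. -/
def thrCoeff (Φ : WaveletSystem) (γ : ℝ) (n : ℕ) (j₀ : ℤ) (S : Set ℝ) (l : WaveletIndex) : ℝ :=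
  if threshold Φ γ n S l ≤ |empCoeff Φ n S l| ∧ l.level ≤ j₀ then empCoeff Φ n S l else 0

/-- The estimator `f̃_{n,γ} = ∑_λ β̃_λ φ̃_λ`. (For fixed `x` only finitely many terms do not
vanish, because of the compact supports and the bound on the levels.) -/
def estimator (Φ : WaveletSystem) (γ : ℝ) (n : ℕ) (j₀ : ℤ) (S : Set ℝ) (x : ℝ) : ℝ :=
  ∑' l : WaveletIndex, thrCoeff Φ γ n j₀ S l * Φ.synthesis l x

end PoissonWavelet

end

noncomputable section

open MeasureTheory ProbabilityTheory Filter Topology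
open scoped ENNReal NNReal

namespace PoissonWavelet

/-! ## Exponential moments of Poisson sums -/

/-! Reduction to coefficients. The reconstruction functions form an unconditional biorthogonal basis
with bounded norms, hence satisfy an upper Riesz inequality
(`exists_norm_sq_sum_le_of_biorthogonal`). The squared loss is therefore at most a constant times
the sum over λ of the squared coefficient errors (`exists_loss_le`). For the Haar system the basis
property is not part of admissibility and is proved, by Lebesgue differentiation along dyadic
intervals.

One coefficient. Divided by its supremum norm, φ_λ becomes a function g with finitely many values
and |g| ≤ 1 almost everywhere. Put u = γ log n, X = ∑ g(T), U = ∑ g(T)², x = ∫ g dμ and m = μ(g ≠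
0), μ being the mean measure; the coefficient is kept when |X| reaches T = `unitThreshold u U`. The
exponential formula, a finite product over independent Poisson counts, yields Bernstein bounds for X
and a lower tail bound for U. Together they show that |X - x| > κT has probability at most 3
exp(-κ²u). Off this event the error is O(min(x², T²)); on it, an exponential moment of (X - x)/√m
controls the square. This settles m ≥ 1. If m ≤ 1, then by Cauchy–Schwarz reaching the threshold
requires at least 2u points where g ≠ 0, which costs only O(m exp(-2u)); the factor m is essential,
since infinitely many translates are summed. In both cases the risk is at most C(min(x², mu) + (m +
x²) exp(-θu)) for any θ < 1 (`exists_lintegral_thresholdedSum_le`). As γ > c, one may take θ = c/γ,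
and the exponential becomes n^(-c).

Summation. Let ε = log n / n, δ = α + 1/2 - 1/p > 0, and let v_λ be the variance bound `varBound`.
Boundedness of f gives v_λ = O(1/n), integrability gives ∑_k v_(j,k) = O(2^j/n), and the Besov ball
gives ‖β_j‖_p ≤ R 2^(-jδ). The main term of level j is thus O(min(2^j ε, 2^(-jpδ) ε^(1-p/2))). The
two branches cross near 2^j = ε^(-1/(2α+1)), where both have the order ε^(2α/(2α+1)), and the
minimum decays geometrically on either side. The variance remainder is O(2^(j₀) n^(-c)/n) = O(1/n),
by the choice of j₀. The levels above j₀ contribute O(ε^(2cδ)), and the lower bound on c says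
exactly that 2cδ ≥ 2α/(2α+1). -/

lemma pointSum_eq_finset_sum {S : Set ℝ} (hS : S.Finite) (g : ℝ → ℝ) :
    pointSum S g = ∑ x ∈ hS.toFinset, g x := by
  have h := Finset.tsum_subtype' hS.toFinset g
  rwa [hS.coe_toFinset] at h

lemma exists_fin_enumeration {g : ℝ → ℝ} (hfin : (Set.range g).Finite) :
    ∃ (m : ℕ) (v : Fin m → ℝ), Function.Injective v ∧ ∀ x, ∃ i, v i = g x := by
  refine ⟨hfin.toFinset.card, fun i => (hfin.toFinset.equivFin.symm i : ℝ),
    Subtype.val_injective.comp (Equiv.injective _), fun x => ?_⟩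
  refine ⟨hfin.toFinset.equivFin ⟨g x, by simp⟩, by simp⟩

/-- Grouping the points by the value of g turns the sum into a linear combination of counts on
disjoint sets, the only variables whose joint law the definition of a Poisson process provides. -/
lemma pointSum_eq_sum_card {S : Set ℝ} (hS : S.Finite) {g : ℝ → ℝ} {m : ℕ} {v : Fin m → ℝ}
    (hv : Function.Injective v) (hgv : ∀ x, ∃ i, v i = g x) :
    pointSum S g = ∑ i, v i * ((S ∩ g ⁻¹' {v i}).encard.toNat : ℝ) := by
  classical
  rw [pointSum_eq_finset_sum hS]
  have h1 : ∀ x, g x = ∑ i, if g x = v i then v i else 0 := by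
    intro x
    obtain ⟨i, hi⟩ := hgv x
    rw [Finset.sum_eq_single i]
    · simp [hi]
    · intro j _ hj
      rw [if_neg]
      rw [← hi]
      exact fun h => hj (hv h).symm
    · simp
  rw [Finset.sum_congr rfl (fun x _ => h1 x), Finset.sum_comm]
  refine Finset.sum_congr rfl fun i _ => ?_
  rw [← Finset.sum_filter, Finset.sum_const, nsmul_eq_mul, mul_comm]
  congr 2
  have : S ∩ g ⁻¹' {v i} = ((hS.toFinset.filter fun x => g x = v i : Finset ℝ) : Set ℝ) := by
    ext x; simp
  rw [this, Set.encard_coe_eq_coe_finsetCard]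
  simp

lemma lintegral_exp_mul_poissonMeasure (r : ℝ≥0) (t : ℝ) :
    ∫⁻ n, ENNReal.ofReal (Real.exp (t * (n : ℝ))) ∂(poissonMeasure r)
      = ENNReal.ofReal (Real.exp (r * (Real.exp t - 1))) := by
  have hs : HasSum (fun n : ℕ => Real.exp (-r) * r ^ n / n.factorial * Real.exp (t * n))
      (Real.exp (r * (Real.exp t - 1))) := by
    have := (NormedSpace.expSeries_div_hasSum_exp ((r : ℝ) * Real.exp t)).mul_left
      (Real.exp (-r))
    convert! this using 1
    · ext n
      rw [mul_pow, ← Real.exp_nat_mul]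
      ring_nf
    · rw [← Real.exp_eq_exp_ℝ, ← Real.exp_add]
      ring_nf
  rw [poissonMeasure, lintegral_sum_measure]
  simp_rw [lintegral_smul_measure, lintegral_dirac, smul_eq_mul]
  rw [← hs.tsum_eq, ENNReal.ofReal_tsum_of_nonneg (fun n => by positivity) hs.summable]
  refine tsum_congr fun n => ?_
  rw [← ENNReal.ofReal_mul (by positivity)]

section PointSums

variable {Ω : Type*} [MeasurableSpace Ω] {P : Measure Ω} {N : Ω → Set ℝ} {μ : Measure ℝ}

lemma IsPoissonProcess.map_toNat [IsFiniteMeasure μ] (hN : IsPoissonProcess N P μ) {A : Set ℝ}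
    (hA : MeasurableSet A) :
    P.map (fun ω => (numPoints N A ω).toNat) = poissonMeasure (μ A).toNNReal := by
  have h : P.map (fun ω => (numPoints N A ω).toNat) = (P.map (numPoints N A)).map ENat.toNat := by
    rw [Measure.map_map (measurable_of_countable _) (hN.measurable A hA)]
    rfl
  rw [h, hN.law A hA (measure_ne_top _ _),
    Measure.map_map (measurable_of_countable _) (measurable_of_countable _)]
  have : ENat.toNat ∘ ((↑) : ℕ → ℕ∞) = id := by ext n; simp
  rw [this, Measure.map_id]

lemma IsPoissonProcess.ae_finite [IsFiniteMeasure μ] (hN : IsPoissonProcess N P μ) :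
    ∀ᵐ ω ∂P, (N ω).Finite := by
  have h := hN.law Set.univ MeasurableSet.univ (measure_ne_top _ _)
  have h2 : P.map (numPoints N Set.univ) {⊤} = 0 := by
    rw [h, Measure.map_apply (measurable_of_countable _) (measurableSet_singleton _)]
    have : ((↑) : ℕ → ℕ∞) ⁻¹' {⊤} = ∅ := by ext n; simp
    rw [this, measure_empty]
  rw [Measure.map_apply (hN.measurable _ MeasurableSet.univ) (measurableSet_singleton _)] at h2
  have h3 : ∀ᵐ ω ∂P, ω ∉ numPoints N Set.univ ⁻¹' {⊤} := measure_eq_zero_iff_ae_notMem.1 h2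
  filter_upwards [h3] with ω hω
  simpa [numPoints] using hω

lemma IsPoissonProcess.aemeasurable_pointSum [IsFiniteMeasure μ] (hN : IsPoissonProcess N P μ)
    {g : ℝ → ℝ} (hg : Measurable g) (hfin : (Set.range g).Finite) :
    AEMeasurable (fun ω => pointSum (N ω) g) P := by
  obtain ⟨m, v, hv, hgv⟩ := exists_fin_enumeration hfin
  refine ⟨fun ω => ∑ i, v i * ((numPoints N (g ⁻¹' {v i}) ω).toNat : ℝ), ?_, ?_⟩
  · refine Finset.measurable_sum _ fun i _ => Measurable.const_mul ?_ _
    have : Measurable fun a : ℕ∞ => (a.toNat : ℝ) := measurable_of_countable _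
    exact this.comp (hN.measurable _ (hg (measurableSet_singleton _)))
  · filter_upwards [hN.ae_finite] with ω hω
    exact pointSum_eq_sum_card hω hv hgv

lemma integral_eq_sum_of_finite_range [IsFiniteMeasure μ] {g : ℝ → ℝ} (hg : Measurable g)
    {m : ℕ} {v : Fin m → ℝ} (hv : Function.Injective v) (hgv : ∀ x, ∃ i, v i = g x) (F : ℝ → ℝ) :
    ∫ x, F (g x) ∂μ = ∑ i, μ.real (g ⁻¹' {v i}) * F (v i) := by
  have h1 : ∀ x, F (g x) = ∑ i, (g ⁻¹' {v i}).indicator (fun _ => F (v i)) x := by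
    intro x
    obtain ⟨i, hi⟩ := hgv x
    rw [Finset.sum_eq_single i]
    · simp [Set.indicator, hi]
    · intro j _ hj
      rw [Set.indicator_of_notMem]
      simp only [Set.mem_preimage, Set.mem_singleton_iff, ← hi]
      exact fun h => hj (hv h).symm
    · simp
  simp_rw [h1]
  rw [integral_finsetSum]
  · refine Finset.sum_congr rfl fun i _ => ?_
    rw [integral_indicator_const _ (hg (measurableSet_singleton _)), smul_eq_mul]
  · intro i _
    exact (integrable_const _).indicator (hg (measurableSet_singleton _))

/-- The exponential formula for Poisson processes. -/
theorem IsPoissonProcess.lintegral_exp_pointSum [IsFiniteMeasure μ]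
    (hN : IsPoissonProcess N P μ) {g : ℝ → ℝ} (hg : Measurable g) (hfin : (Set.range g).Finite) :
    ∫⁻ ω, ENNReal.ofReal (Real.exp (pointSum (N ω) g)) ∂P
      = ENNReal.ofReal (Real.exp (∫ x, (Real.exp (g x) - 1) ∂μ)) := by
  obtain ⟨m, v, hv, hgv⟩ := exists_fin_enumeration hfin
  have hA : ∀ i, MeasurableSet (g ⁻¹' {v i}) := fun i => hg (measurableSet_singleton _)
  have hind : iIndepFun (fun i => numPoints N (g ⁻¹' {v i})) P := by
    refine hN.indep m _ hA fun i j hij => ?_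
    refine Set.disjoint_left.2 fun x hx hx' => hij (hv ?_)
    simp only [Set.mem_preimage, Set.mem_singleton_iff] at hx hx'
    rw [← hx, hx']
  have hmeas : ∀ i, Measurable fun a : ℕ∞ => ENNReal.ofReal (Real.exp (v i * (a.toNat : ℝ))) :=
    fun i => measurable_of_countable _
  have hind2 := hind.comp _ hmeas
  calc ∫⁻ ω, ENNReal.ofReal (Real.exp (pointSum (N ω) g)) ∂P
      = ∫⁻ ω, ∏ i, ENNReal.ofReal
          (Real.exp (v i * ((numPoints N (g ⁻¹' {v i}) ω).toNat : ℝ))) ∂P := by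
        refine lintegral_congr_ae ?_
        filter_upwards [hN.ae_finite] with ω hω
        rw [pointSum_eq_sum_card hω hv hgv, Real.exp_sum,
          ENNReal.ofReal_prod_of_nonneg fun i _ => (Real.exp_pos _).le]
        rfl
    _ = ∏ i, ∫⁻ ω, ENNReal.ofReal
          (Real.exp (v i * ((numPoints N (g ⁻¹' {v i}) ω).toNat : ℝ))) ∂P :=
        lintegral_prod_eq_prod_lintegral_of_indepFun _ _ hind2
          fun i => (hmeas i).comp (hN.measurable _ (hA i))
    _ = ∏ i, ENNReal.ofReal (Real.exp (μ.real (g ⁻¹' {v i}) * (Real.exp (v i) - 1))) := by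
        refine Finset.prod_congr rfl fun i _ => ?_
        have hm : Measurable fun ω => (numPoints N (g ⁻¹' {v i}) ω).toNat :=
          (measurable_of_countable ENat.toNat).comp (hN.measurable _ (hA i))
        have := lintegral_map (μ := P)
          (f := fun n : ℕ => ENNReal.ofReal (Real.exp (v i * (n : ℝ))))
          (measurable_of_countable _) hm
        rw [← this, hN.map_toNat (hA i), lintegral_exp_mul_poissonMeasure]
        rfl
    _ = ENNReal.ofReal (Real.exp (∫ x, (Real.exp (g x) - 1) ∂μ)) := by
        rw [integral_eq_sum_of_finite_range hg hv hgv (fun y => Real.exp y - 1), Real.exp_sum,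
          ENNReal.ofReal_prod_of_nonneg fun i _ => (Real.exp_pos _).le]

end PointSums

/-! ## Elementary inequalities -/

/-- Since exp(-y) ≥ 1 - y + y²/2 for y ≤ 0, it suffices that (1 + y + y²/2)(1 - y + y²/2) = 1 + y⁴/4
≥ 1. -/
lemma exp_le_quadratic_of_nonpos {y : ℝ} (hy : y ≤ 0) : Real.exp y ≤ 1 + y + y ^ 2 / 2 := by
  have h := Real.quadratic_le_exp_of_nonneg (neg_nonneg.2 hy)
  have h1 : Real.exp y * Real.exp (-y) = 1 := by rw [← Real.exp_add]; simp
  have h2 : 0 < 1 + y + y ^ 2 / 2 := by nlinarith [sq_nonneg (y + 1)]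
  have h3 : 1 ≤ (1 + y + y ^ 2 / 2) * Real.exp (-y) := by
    calc (1 : ℝ) ≤ (1 + y + y ^ 2 / 2) * (1 + -y + (-y) ^ 2 / 2) := by
          nlinarith [sq_nonneg (y ^ 2)]
      _ ≤ _ := by gcongr
  have h4 := Real.exp_pos (-y)
  nlinarith

/-- The tail of the exponential series is compared with a geometric series of ratio y/3, using
(k+2)! ≥ 2·3^k. -/
lemma exp_le_bernstein_of_nonneg {y : ℝ} (hy : 0 ≤ y) (hy3 : y < 3) :
    Real.exp y ≤ 1 + y + y ^ 2 / (2 * (1 - y / 3)) := by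
  have h1 := (NormedSpace.expSeries_div_hasSum_exp y)
  rw [← Real.exp_eq_exp_ℝ] at h1
  have h2 := (hasSum_nat_add_iff' 2).2 h1
  have h3 := (hasSum_geometric_of_lt_one (r := y / 3) (by positivity) (by linarith)).mul_left
    (y ^ 2 / 2)
  have h4 := hasSum_le (fun k => ?_) h2 h3
  · simp [Finset.sum_range_succ] at h4
    have : y ^ 2 / (2 * (1 - y / 3)) = y ^ 2 / 2 * (1 - y / 3)⁻¹ := by
      rw [div_mul_eq_div_div, div_eq_mul_inv (y ^ 2 / 2)]
    rw [this]; linarith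
  · have h5 : (2 * 3 ^ k : ℝ) ≤ (k + 2).factorial := by
      have := Nat.factorial_mul_pow_le_factorial (m := 2) (n := k)
      rw [add_comm k 2]
      exact_mod_cast (by simpa using this)
    calc y ^ (k + 2) / (k + 2).factorial ≤ y ^ (k + 2) / (2 * 3 ^ k) := by gcongr
      _ = y ^ 2 / 2 * (y / 3) ^ k := by rw [div_pow, pow_add]; field_simp

lemma exp_le_bernstein {y s : ℝ} (hys : |y| ≤ s) (hs : s < 3) :
    Real.exp y ≤ 1 + y + y ^ 2 / (2 * (1 - s / 3)) := by
  rcases le_total 0 y with hy | hy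
  · rw [abs_of_nonneg hy] at hys
    refine (exp_le_bernstein_of_nonneg hy (by linarith)).trans ?_
    gcongr
    linarith
  · refine (exp_le_quadratic_of_nonpos hy).trans ?_
    have hs0 : 0 ≤ s := (abs_nonneg _).trans hys
    have : y ^ 2 / 2 ≤ y ^ 2 / (2 * (1 - s / 3)) := by
      gcongr <;> linarith
    linarith

/-- With a = √(2u/v), the choice s = a/(1 + a/3) gives 1 - s/3 = 1/(1 + a/3), and the exponent of
the Chernoff bound becomes exactly -u. -/
lemma bernstein_exponent {v u : ℝ} (hv : 0 < v) (hu : 0 < u) :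
    ∃ s : ℝ, 0 ≤ s ∧ s < 3 ∧
      v * s ^ 2 / (2 * (1 - s / 3)) - s * (√(2 * v * u) + u / 3) = -u := by
  obtain ⟨a, ha, hau⟩ : ∃ a : ℝ, 0 < a ∧ a ^ 2 = 2 * u / v :=
    ⟨√(2 * u / v), by positivity, Real.sq_sqrt (by positivity)⟩
  have hu' : u = v * a ^ 2 / 2 := by rw [hau]; field_simp
  have hsq : √(2 * v * u) = v * a := by
    rw [hu', show 2 * v * (v * a ^ 2 / 2) = (v * a) ^ 2 by ring]
    exact Real.sqrt_sq (by positivity)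
  have h1 : a / (1 + a / 3) < 3 := by
    rw [div_lt_iff₀ (by positivity)]; linarith
  refine ⟨a / (1 + a / 3), by positivity, h1, ?_⟩
  have h2 : 1 - a / (1 + a / 3) / 3 = 1 / (1 + a / 3) := by field_simp; ring
  rw [hsq, h2, hu']
  field_simp
  ring

/-! ## Deviation inequalities -/

lemma measure_le_of_lintegral_exp_le {Ω : Type*} [MeasurableSpace Ω] {P : Measure Ω}
    {Y : Ω → ℝ} (hY : AEMeasurable Y P) {a : ℝ}
    (h : ∫⁻ ω, ENNReal.ofReal (Real.exp (Y ω)) ∂P ≤ ENNReal.ofReal (Real.exp a)) (b : ℝ) :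
    P {ω | b ≤ Y ω} ≤ ENNReal.ofReal (Real.exp (a - b)) := by
  have hm := mul_meas_ge_le_lintegral₀
    (f := fun ω => ENNReal.ofReal (Real.exp (Y ω))) (μ := P)
    (Real.measurable_exp.comp_aemeasurable hY).ennreal_ofReal (ENNReal.ofReal (Real.exp b))
  have hset : {ω | b ≤ Y ω} = {ω | ENNReal.ofReal (Real.exp b) ≤ ENNReal.ofReal (Real.exp (Y ω))} := by
    ext ω
    simp [ENNReal.ofReal_le_ofReal_iff (Real.exp_pos _).le]
  rw [hset, Real.exp_sub, ENNReal.ofReal_div_of_pos (Real.exp_pos _)]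
  rw [ENNReal.le_div_iff_mul_le (Or.inl (by simp [Real.exp_pos])) (Or.inl (by simp)), mul_comm]
  exact hm.trans h

lemma integrable_of_finite_range {μ : Measure ℝ} [IsFiniteMeasure μ] {g : ℝ → ℝ}
    (hg : Measurable g) (hfin : (Set.range g).Finite) : Integrable g μ := by
  obtain ⟨b, hb⟩ := (hfin.image abs).bddAbove
  refine Integrable.of_bound hg.aestronglyMeasurable b (ae_of_all _ fun x => ?_)
  exact hb ⟨g x, ⟨x, rfl⟩, rfl⟩

lemma finite_range_comp {g : ℝ → ℝ} (hfin : (Set.range g).Finite) (F : ℝ → ℝ) :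
    (Set.range fun x => F (g x)).Finite := by
  rw [show (fun x => F (g x)) = F ∘ g from rfl, Set.range_comp]
  exact hfin.image F

lemma pointSum_const_mul (S : Set ℝ) (a : ℝ) (g : ℝ → ℝ) :
    pointSum S (fun x => a * g x) = a * pointSum S g := tsum_mul_left

section PointSums

variable {Ω : Type*} [MeasurableSpace Ω] {P : Measure Ω} {N : Ω → Set ℝ} {μ : Measure ℝ}

/-- Any quadratic majorant of exp(t·) on the values of g bounds the Laplace transform by the first
two moments of g. The coefficients stay free because three majorants are needed: Bernstein's for the
deviations of the sum, the plain quadratic one for the lower tail of the sum of squares, and a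
linear one for its mean. -/
lemma IsPoissonProcess.lintegral_exp_mul_pointSum_le [IsFiniteMeasure μ]
    (hN : IsPoissonProcess N P μ) {g : ℝ → ℝ} (hg : Measurable g) (hfin : (Set.range g).Finite)
    (t : ℝ) {k₁ k₂ : ℝ} (h : ∀ᵐ x ∂μ, Real.exp (t * g x) ≤ 1 + k₁ * g x + k₂ * g x ^ 2) :
    ∫⁻ ω, ENNReal.ofReal (Real.exp (t * pointSum (N ω) g)) ∂P
      ≤ ENNReal.ofReal (Real.exp (k₁ * (∫ x, g x ∂μ) + k₂ * ∫ x, g x ^ 2 ∂μ)) := by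
  have hmg : Measurable fun x => t * g x := hg.const_mul t
  have := hN.lintegral_exp_pointSum hmg (finite_range_comp hfin (fun y => t * y))
  simp_rw [pointSum_const_mul] at this
  rw [this]
  apply ENNReal.ofReal_le_ofReal
  apply Real.exp_le_exp.2
  have hi1 : Integrable g μ := integrable_of_finite_range hg hfin
  have hi2 : Integrable (fun x => g x ^ 2) μ :=
    integrable_of_finite_range (hg.pow_const 2) (finite_range_comp hfin (fun y => y ^ 2))
  rw [← integral_const_mul, ← integral_const_mul,
    ← integral_add (hi1.const_mul _) (hi2.const_mul _)]
  refine integral_mono_ae ?_ ((hi1.const_mul _).add (hi2.const_mul _)) ?_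
  · exact integrable_of_finite_range ((Real.measurable_exp.comp hmg).sub_const 1)
      (finite_range_comp hfin (fun y => Real.exp (t * y) - 1))
  · filter_upwards [h] with x hx
    linarith

/-- Bernstein bound of the Laplace transform of a centred Poisson sum. -/
lemma IsPoissonProcess.lintegral_exp_centred_le [IsFiniteMeasure μ]
    (hN : IsPoissonProcess N P μ) {g : ℝ → ℝ} (hg : Measurable g) (hfin : (Set.range g).Finite)
    (hg1 : ∀ᵐ x ∂μ, |g x| ≤ 1) {s : ℝ} (hs : 0 ≤ s) (hs3 : s < 3) :
    ∫⁻ ω, ENNReal.ofReal (Real.exp (s * (pointSum (N ω) g - ∫ x, g x ∂μ))) ∂P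
      ≤ ENNReal.ofReal (Real.exp ((∫ x, g x ^ 2 ∂μ) * s ^ 2 / (2 * (1 - s / 3)))) := by
  have h := hN.lintegral_exp_mul_pointSum_le hg hfin s (k₁ := s) (k₂ := s ^ 2 / (2 * (1 - s / 3)))
    (by
      filter_upwards [hg1] with x hx
      have := exp_le_bernstein (y := s * g x) (s := s) (by
        rw [abs_mul, abs_of_nonneg hs]; nlinarith) hs3
      calc _ ≤ _ := this
        _ = _ := by ring)
  have heq : ∀ ω, ENNReal.ofReal (Real.exp (s * (pointSum (N ω) g - ∫ x, g x ∂μ)))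
      = ENNReal.ofReal (Real.exp (-(s * ∫ x, g x ∂μ)))
        * ENNReal.ofReal (Real.exp (s * pointSum (N ω) g)) := by
    intro ω
    rw [← ENNReal.ofReal_mul (Real.exp_pos _).le, ← Real.exp_add]
    ring_nf
  simp_rw [heq]
  rw [lintegral_const_mul' _ _ ENNReal.ofReal_ne_top]
  refine (mul_le_mul_right h _).trans ?_
  rw [← ENNReal.ofReal_mul (Real.exp_pos _).le, ← Real.exp_add]
  apply le_of_eq
  ring_nf

lemma IsPoissonProcess.measure_upper_deviation_le [IsFiniteMeasure μ]
    (hN : IsPoissonProcess N P μ) {g : ℝ → ℝ} (hg : Measurable g) (hfin : (Set.range g).Finite)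
    (hg1 : ∀ᵐ x ∂μ, |g x| ≤ 1) (hv : 0 < ∫ x, g x ^ 2 ∂μ) {u : ℝ} (hu : 0 < u) :
    P {ω | √(2 * (∫ x, g x ^ 2 ∂μ) * u) + u / 3 < pointSum (N ω) g - ∫ x, g x ∂μ}
      ≤ ENNReal.ofReal (Real.exp (-u)) := by
  obtain ⟨s, hs, hs3, hsu⟩ := bernstein_exponent hv hu
  have h := measure_le_of_lintegral_exp_le
    (((hN.aemeasurable_pointSum hg hfin).sub_const _).const_mul s)
    (hN.lintegral_exp_centred_le hg hfin hg1 hs hs3)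
    (s * (√(2 * (∫ x, g x ^ 2 ∂μ) * u) + u / 3))
  rw [hsu] at h
  refine (measure_mono fun ω hω => ?_).trans h
  exact mul_le_mul_of_nonneg_left (le_of_lt hω) hs

lemma IsPoissonProcess.measure_lower_deviation_le [IsFiniteMeasure μ]
    (hN : IsPoissonProcess N P μ) {g : ℝ → ℝ} (hg : Measurable g) (hfin : (Set.range g).Finite)
    (hg1 : ∀ᵐ x ∂μ, |g x| ≤ 1) (hv : 0 < ∫ x, g x ^ 2 ∂μ) {u : ℝ} (hu : 0 < u) :
    P {ω | √(2 * (∫ x, g x ^ 2 ∂μ) * u) + u / 3 < (∫ x, g x ∂μ) - pointSum (N ω) g}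
      ≤ ENNReal.ofReal (Real.exp (-u)) := by
  have h := hN.measure_upper_deviation_le (g := fun x => -1 * g x) (hg.const_mul (-1))
    (finite_range_comp hfin (fun y => -1 * y)) (by simpa using hg1) (by simpa using hv) hu
  simp_rw [pointSum_const_mul, integral_const_mul] at h
  convert! h using 4; ring_nf

/-- Lower tail of the sum of squares. -/
lemma IsPoissonProcess.measure_sum_sq_lower_le [IsFiniteMeasure μ]
    (hN : IsPoissonProcess N P μ) {g : ℝ → ℝ} (hg : Measurable g) (hfin : (Set.range g).Finite)
    (hg1 : ∀ᵐ x ∂μ, |g x| ≤ 1) (hv : 0 < ∫ x, g x ^ 2 ∂μ) {u : ℝ} (hu : 0 < u) :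
    P {ω | √(2 * (∫ x, g x ^ 2 ∂μ) * u) < (∫ x, g x ^ 2 ∂μ) - pointSum (N ω) fun x => g x ^ 2}
      ≤ ENNReal.ofReal (Real.exp (-u)) := by
  set v := ∫ x, g x ^ 2 ∂μ with hvdef
  have hm : Measurable fun x => g x ^ 2 := hg.pow_const 2
  have hf := finite_range_comp hfin (fun y => y ^ 2)
  set t := √(2 * v * u) with ht
  have ht2 : t ^ 2 = 2 * v * u := Real.sq_sqrt (by positivity)
  have ht0 : 0 < t := by positivity
  have hs : 0 < t / v := by positivity
  -- For a lower tail the exponent is negative, where exp lies below its second Taylor polynomial;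
  -- hence no linear term u/3 appears in this bound.
  have h := hN.lintegral_exp_mul_pointSum_le hm hf (-(t / v)) (k₁ := -(t / v))
    (k₂ := (t / v) ^ 2 / 2) (by
      refine ae_of_all _ fun x => ?_
      have := exp_le_quadratic_of_nonpos (y := -(t / v) * g x ^ 2)
        (by have := mul_nonneg hs.le (sq_nonneg (g x)); linarith)
      calc _ ≤ _ := this
        _ = _ := by ring)
  -- The variance ∫ g⁴ of the sum of squares is dominated by its mean, because |g| ≤ 1.
  have hw : ∫ x, (g x ^ 2) ^ 2 ∂μ ≤ v := by
    refine integral_mono_ae (integrable_of_finite_range (hm.pow_const 2)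
      (finite_range_comp hf (fun y => y ^ 2))) (integrable_of_finite_range hm hf) ?_
    filter_upwards [hg1] with x hx
    have : g x ^ 2 ≤ 1 := by rw [← sq_abs]; nlinarith [abs_nonneg (g x)]
    nlinarith [sq_nonneg (g x)]
  have h2 := measure_le_of_lintegral_exp_le
    ((hN.aemeasurable_pointSum hm hf).const_mul (-(t / v))) h (-(t / v) * (v - t))
  refine (measure_mono fun ω hω => ?_).trans (h2.trans ?_)
  · simp only [Set.mem_ofPred_eq] at hω ⊢
    nlinarith
  · apply ENNReal.ofReal_le_ofReal
    apply Real.exp_le_exp.2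
    have h3 : (t / v) ^ 2 / 2 * ∫ x, (g x ^ 2) ^ 2 ∂μ ≤ (t / v) ^ 2 / 2 * v := by gcongr
    have h4 : (t / v) ^ 2 / 2 * v = u := by
      rw [div_pow, ht2]; field_simp
    have h5 : t / v * t = 2 * u := by
      rw [div_mul_eq_mul_div, ← sq, ht2]; field_simp
    nlinarith

/-- The threshold for a function with supremum norm one, in terms of `u = γ log n` and of the
sum `U` of squares. -/
def unitThreshold (u U : ℝ) : ℝ := √(2 * u * (U + √(2 * u * U) + 3 * u)) + u / 3

/-- In x = √v, y = √U and b = √(2w) the hypothesis reads x² - xb ≤ y². This forces x ≤ y + b, and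
inserting it once gives x² ≤ y² + yb + b². It makes the unknown variance observable through U. -/
lemma le_of_sub_sqrt_le {v U w : ℝ} (hv : 0 ≤ v) (hU : 0 ≤ U) (hw : 0 ≤ w)
    (h : v - U ≤ √(2 * v * w)) : v ≤ U + √(2 * w * U) + 2 * w := by
  obtain ⟨x, hx, rfl⟩ : ∃ x : ℝ, 0 ≤ x ∧ v = x ^ 2 := ⟨√v, by positivity, (Real.sq_sqrt hv).symm⟩
  obtain ⟨b, hb, hbw⟩ : ∃ b : ℝ, 0 ≤ b ∧ b ^ 2 = 2 * w :=
    ⟨√(2 * w), by positivity, Real.sq_sqrt (by positivity)⟩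
  obtain ⟨y, hy, rfl⟩ : ∃ y : ℝ, 0 ≤ y ∧ U = y ^ 2 := ⟨√U, by positivity, (Real.sq_sqrt hU).symm⟩
  have h1 : √(2 * x ^ 2 * w) = x * b := by
    rw [show 2 * x ^ 2 * w = (x * b) ^ 2 by rw [mul_pow, hbw]; ring]
    exact Real.sqrt_sq (by positivity)
  have h2 : √(2 * w * y ^ 2) = b * y := by
    rw [show 2 * w * y ^ 2 = (b * y) ^ 2 by rw [mul_pow, hbw]]
    exact Real.sqrt_sq (by positivity)
  rw [h1] at h
  rw [h2, ← hbw]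
  have h3 : x ≤ y + b := by
    by_contra hc
    push Not at hc
    nlinarith
  nlinarith

/-- The probability that the deviation exceeds a fraction of the random threshold. -/
lemma IsPoissonProcess.measure_deviation_gt_threshold_le [IsFiniteMeasure μ]
    (hN : IsPoissonProcess N P μ) {g : ℝ → ℝ} (hg : Measurable g) (hfin : (Set.range g).Finite)
    (hg1 : ∀ᵐ x ∂μ, |g x| ≤ 1) (hv : 0 < ∫ x, g x ^ 2 ∂μ) {u κ : ℝ} (hu : 0 < u) (hκ : 0 < κ)
    (hκ1 : κ ≤ 1) :
    P {ω | κ * unitThreshold u (pointSum (N ω) fun x => g x ^ 2)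
        < |pointSum (N ω) g - ∫ x, g x ∂μ|}
      ≤ ENNReal.ofReal (3 * Real.exp (-(κ ^ 2 * u))) := by
  set v := ∫ x, g x ^ 2 ∂μ with hvdef
  have hw : 0 < κ ^ 2 * u := by positivity
  have h1 := hN.measure_upper_deviation_le hg hfin hg1 hv hw
  have h2 := hN.measure_lower_deviation_le hg hfin hg1 hv hw
  have h3 := hN.measure_sum_sq_lower_le hg hfin hg1 hv hw
  rw [show 3 * Real.exp (-(κ ^ 2 * u)) = Real.exp (-(κ ^ 2 * u)) + Real.exp (-(κ ^ 2 * u))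
    + Real.exp (-(κ ^ 2 * u)) by ring, ENNReal.ofReal_add (by positivity) (by positivity),
    ENNReal.ofReal_add (by positivity) (by positivity)]
  refine le_trans (measure_mono fun ω hω => ?_) ((measure_union_le _ _).trans
    (add_le_add ((measure_union_le _ _).trans (add_le_add h1 h2)) h3))
  -- Outside the three exceptional events, all taken at exponent κ²u, the deviation cannot exceed κ
  -- times the threshold.
  simp only [Set.mem_ofPred_eq, Set.mem_union] at hω ⊢
  by_contra hc
  push Not at hc
  obtain ⟨⟨hc1, hc2⟩, hc3⟩ := hc
  set U := pointSum (N ω) fun x => g x ^ 2 with hU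
  have hU0 : 0 ≤ U := tsum_nonneg fun _ => sq_nonneg _
  have hvU := le_of_sub_sqrt_le hv.le hU0 hw.le hc3
  have hκ2 : κ ^ 2 * u ≤ u := by
    have : κ ^ 2 ≤ 1 := by nlinarith
    nlinarith
  have hvW : v ≤ U + √(2 * u * U) + 3 * u := by
    have : √(2 * (κ ^ 2 * u) * U) ≤ √(2 * u * U) := by gcongr
    linarith
  have hdev : |pointSum (N ω) g - ∫ x, g x ∂μ| ≤ √(2 * v * (κ ^ 2 * u)) + κ ^ 2 * u / 3 := by
    rw [abs_le]; constructor <;> linarith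
  -- The exponent κ²u is chosen so that the square root releases exactly one factor κ; the linear
  -- term even releases κ² ≤ κ.
  have h5 : √(2 * v * (κ ^ 2 * u)) ≤ κ * √(2 * u * (U + √(2 * u * U) + 3 * u)) := by
    rw [show 2 * v * (κ ^ 2 * u) = κ ^ 2 * (2 * u * v) by ring, Real.sqrt_mul (by positivity),
      Real.sqrt_sq hκ.le]
    gcongr
  have h6 : κ ^ 2 * u / 3 ≤ κ * (u / 3) := by
    have : κ ^ 2 ≤ κ := by nlinarith
    nlinarith
  unfold unitThreshold at hω
  linarith

end PointSums

/-! ## The risk of a single thresholded coefficient -/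

/-- If X is kept, then |x| ≥ (1 - κ)T while the error is at most κT; if it is killed, then |x| ≤ (1
+ κ)T ≤ 2T and the error is |x|. In both cases the error is comparable with the smaller of |x| and
T. -/
lemma sq_threshold_error_le {X x T κ : ℝ} (hT : 0 ≤ T) (hκ : 0 < κ) (hκ1 : κ < 1)
    (h : |X - x| ≤ κ * T) :
    ((if T ≤ |X| then X else 0) - x) ^ 2 ≤ 4 / (1 - κ) ^ 2 * min (x ^ 2) (T ^ 2) := by
  have h1 : 0 < 1 - κ := by linarith
  have hsq : (X - x) ^ 2 ≤ (κ * T) ^ 2 := by rw [← sq_abs]; gcongr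
  have hc : 4 * ((1 - κ) ^ 2 * min (x ^ 2) (T ^ 2)) ≤
      4 * (1 * min (x ^ 2) (T ^ 2)) := by
    have : (1 - κ) ^ 2 ≤ 1 := by nlinarith
    gcongr
  rw [div_mul_eq_mul_div, le_div_iff₀ (by positivity)]
  split_ifs with hX
  · have h2 : (1 - κ) * T ≤ |x| := by
      have := abs_sub_abs_le_abs_sub X x
      linarith
    have h3 : ((1 - κ) * T) ^ 2 ≤ x ^ 2 := by rw [← sq_abs x]; gcongr
    rcases min_choice (x ^ 2) (T ^ 2) with hm | hm <;> rw [hm]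
    · have : (κ * T) ^ 2 ≤ T ^ 2 := by rw [mul_pow]; nlinarith [sq_nonneg T]
      nlinarith [sq_nonneg T, sq_nonneg (1 - κ)]
    · have : (κ * T) ^ 2 ≤ T ^ 2 := by rw [mul_pow]; nlinarith [sq_nonneg T]
      have h4 : (1 - κ) ^ 2 ≤ 1 := by nlinarith
      nlinarith [sq_nonneg (X - x)]
  · have h2 : |x| ≤ 2 * T := by
      have := abs_sub_abs_le_abs_sub x X
      rw [abs_sub_comm] at this
      nlinarith
    have h3 : x ^ 2 ≤ (2 * T) ^ 2 := by rw [← sq_abs x]; gcongr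
    have h4 : (1 - κ) ^ 2 ≤ 1 := by nlinarith
    rcases min_choice (x ^ 2) (T ^ 2) with hm | hm <;> rw [hm] <;> nlinarith [sq_nonneg x]

/-- For |y| ≥ L one has y²/8 ≤ exp(|y|/2) ≤ exp(-L/2) exp|y|. The purpose is to integrate a square
over a rare event: the part L² pays with the probability of the event, the rest with a small factor
times an exponential moment. -/
lemma sq_le_truncation {y L : ℝ} :
    y ^ 2 ≤ L ^ 2 + 8 * Real.exp (-(L / 2)) * Real.exp |y| := by
  rcases le_total |y| L with h | h
  · have : y ^ 2 ≤ L ^ 2 := by rw [← sq_abs]; gcongr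
    have := Real.exp_pos (-(L / 2))
    have := Real.exp_pos |y|
    nlinarith [mul_pos this this, mul_pos (Real.exp_pos (-(L / 2))) (Real.exp_pos |y|)]
  · have h1 : (|y| / 2) ^ 2 / 2 ≤ Real.exp (|y| / 2) := by
      have := Real.quadratic_le_exp_of_nonneg (x := |y| / 2) (by positivity)
      have := abs_nonneg y
      linarith
    have h2 : Real.exp (|y| / 2) ≤ Real.exp (-(L / 2)) * Real.exp |y| := by
      rw [← Real.exp_add]; apply Real.exp_le_exp.2; linarith
    rw [div_pow, sq_abs] at h1
    nlinarith [sq_nonneg L]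

/-- The inner square root is linearised by √(2uU) ≤ u + U/2. The bound is affine in U, so only the
mean of U is needed later. -/
lemma sq_unitThreshold_le {u U : ℝ} (hu : 0 ≤ u) (hU : 0 ≤ U) :
    unitThreshold u U ^ 2 ≤ 6 * u * U + 17 * u ^ 2 := by
  have h1 : √(2 * u * U) ≤ u + U / 2 := by
    rw [Real.sqrt_le_left (by positivity)]
    nlinarith [sq_nonneg (u - U / 2)]
  have h2 : √(2 * u * (U + √(2 * u * U) + 3 * u)) ^ 2 ≤ 3 * u * U + 8 * u ^ 2 := by
    rw [Real.sq_sqrt (by positivity)]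
    nlinarith
  unfold unitThreshold
  nlinarith [sq_nonneg (√(2 * u * (U + √(2 * u * U) + 3 * u)) - u / 3), sq_nonneg u]

lemma unitThreshold_nonneg {u U : ℝ} (hu : 0 ≤ u) : 0 ≤ unitThreshold u U := by
  unfold unitThreshold; positivity

lemma pointSum_sq_nonneg (S : Set ℝ) (g : ℝ → ℝ) : 0 ≤ pointSum S fun x => g x ^ 2 :=
  tsum_nonneg fun _ => sq_nonneg _

/-- If the threshold is exceeded, then there are many points where `g` does not vanish. -/
lemma sq_deviation_le_of_threshold_le {S : Set ℝ} (hS : S.Finite) {g : ℝ → ℝ} {ρ x u : ℝ}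
    (hρ : ∀ y, |g y| ≤ ρ) (hx : |x| ≤ 1) (hu : 0 < u)
    (hT : unitThreshold u (pointSum S fun y => g y ^ 2) ≤ |pointSum S g|) :
    (pointSum S g - x) ^ 2 ≤ 2 * (ρ + 1) ^ 2 * Real.exp (-(2 * u)) *
      (Real.exp (pointSum S fun y => 2 * (if g y = 0 then 0 else 1)) - 1) := by
  classical
  have hρ0 : 0 ≤ ρ := (abs_nonneg _).trans (hρ 0)
  rw [pointSum_eq_finset_sum hS] at hT ⊢
  rw [pointSum_eq_finset_sum hS] at hT ⊢
  set F := hS.toFinset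
  set k : ℕ := (F.filter fun y => g y ≠ 0).card with hk
  have hN : ∑ y ∈ F, (2 * (if g y = 0 then 0 else 1) : ℝ) = 2 * k := by
    rw [← Finset.mul_sum, hk, Finset.card_filter]
    push_cast
    congr 1
    refine Finset.sum_congr rfl fun y _ => ?_
    split_ifs <;> simp_all
  have hXfilter : ∑ y ∈ F, g y = ∑ y ∈ F.filter (fun y => g y ≠ 0), g y :=
    (Finset.sum_filter_ne_zero _).symm
  have hUfilter : ∑ y ∈ F.filter (fun y => g y ≠ 0), g y ^ 2 ≤ ∑ y ∈ F, g y ^ 2 :=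
    Finset.sum_le_sum_of_subset_of_nonneg (Finset.filter_subset _ _) fun _ _ _ => sq_nonneg _
  set U := ∑ y ∈ F, g y ^ 2 with hU
  set X := ∑ y ∈ F, g y with hX
  have hU0 : 0 ≤ U := Finset.sum_nonneg fun _ _ => sq_nonneg _
  have hCS : X ^ 2 ≤ k * U := by
    rw [hXfilter]
    exact sq_sum_le_card_mul_sum_sq.trans (by gcongr)
  have hXk : |X| ≤ ρ * k := by
    rw [hXfilter]
    refine (Finset.abs_sum_le_sum_abs _ _).trans ((Finset.sum_le_card_nsmul _ _ ρ
      fun y _ => hρ y).trans ?_)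
    rw [nsmul_eq_mul, mul_comm]
  have hTpos : 0 < |X| := by
    refine lt_of_lt_of_le ?_ hT
    unfold unitThreshold; positivity
  have hUpos : 0 < U := by
    by_contra hc
    have h0 : U = 0 := le_antisymm (not_lt.1 hc) hU0
    rw [h0, mul_zero, ← sq_abs] at hCS
    nlinarith
  have hT2 : 2 * u * U ≤ |X| ^ 2 := by
    have h1 : √(2 * u * U) ≤ |X| := by
      refine le_trans ?_ hT
      unfold unitThreshold
      have : √(2 * u * U) ≤ √(2 * u * (U + √(2 * u * U) + 3 * u)) := by
        gcongr
        have := Real.sqrt_nonneg (2 * u * U)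
        linarith
      linarith
    exact (Real.sqrt_le_left (abs_nonneg _)).1 h1
  -- Here 2uU ≤ X² ≤ kU, the second inequality being Cauchy–Schwarz over the k points where g does
  -- not vanish; cancel U > 0.
  have hku : 2 * u ≤ k := by
    rw [sq_abs] at hT2
    exact le_of_mul_le_mul_right (hT2.trans hCS) hUpos
  have hk1 : (1 : ℝ) ≤ k := by
    have : 0 < k := by
      by_contra hc
      have : k = 0 := by omega
      rw [this] at hku
      push_cast at hku
      linarith
    exact_mod_cast this
  have h1 : (X - x) ^ 2 ≤ ((ρ + 1) * k) ^ 2 := by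
    rw [← sq_abs]
    gcongr
    refine (abs_sub _ _).trans ?_
    linarith
  have h2 : (k : ℝ) ^ 2 ≤ Real.exp k := by
    have h3 := Real.sum_le_exp_of_nonneg (x := k) (by positivity) 4
    simp [Finset.sum_range_succ, Nat.factorial] at h3
    refine le_trans ?_ h3
    have hk0 : (0 : ℝ) ≤ k := by positivity
    nlinarith [mul_nonneg hk0 (sq_nonneg ((k : ℝ) - 3 / 2))]
  -- This is k ≥ 2u again: the small factor is gained by doubling the exponent.
  have h4 : Real.exp k ≤ Real.exp (-(2 * u)) * Real.exp (2 * k) := by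
    rw [← Real.exp_add]; apply Real.exp_le_exp.2; linarith
  -- As k ≥ 1, subtracting 1 costs at most a factor 2. The difference vanishes when there are no
  -- points, which makes its mean proportional to the mass of the support.
  have h5 : Real.exp (2 * k) ≤ 2 * (Real.exp (2 * k) - 1) := by
    have := Real.add_one_le_exp (2 * (k : ℝ))
    linarith
  rw [hN]
  calc (X - x) ^ 2 ≤ (ρ + 1) ^ 2 * (k : ℝ) ^ 2 := by rw [← mul_pow]; exact h1
    _ ≤ (ρ + 1) ^ 2 * (Real.exp (-(2 * u)) * (2 * (Real.exp (2 * k) - 1))) := by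
        gcongr
        exact h2.trans (h4.trans (by gcongr))
    _ = _ := by ring

/-! ### Moments in terms of the mass of the support. -/

section PointSums

variable {Ω : Type*} [MeasurableSpace Ω] {P : Measure Ω} {N : Ω → Set ℝ} {μ : Measure ℝ}

lemma abs_integral_le_measureReal_support [IsFiniteMeasure μ] {g : ℝ → ℝ} (hg : Measurable g)
    (hfin : (Set.range g).Finite) (hg1 : ∀ᵐ x ∂μ, |g x| ≤ 1) :
    |∫ x, g x ∂μ| ≤ μ.real {x | g x ≠ 0} := by
  have hA : MeasurableSet {x | g x ≠ 0} := hg (measurableSet_singleton 0).compl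
  rw [← integral_indicator_one hA]
  refine (abs_integral_le_integral_abs).trans (integral_mono_ae
    (integrable_of_finite_range hg hfin).abs ((integrable_const 1).indicator hA) ?_)
  filter_upwards [hg1] with x hx
  by_cases h : g x = 0 <;> simp [Set.indicator, h, hx]

lemma integral_sq_le_measureReal_support [IsFiniteMeasure μ] {g : ℝ → ℝ} (hg : Measurable g)
    (hfin : (Set.range g).Finite) (hg1 : ∀ᵐ x ∂μ, |g x| ≤ 1) :
    ∫ x, g x ^ 2 ∂μ ≤ μ.real {x | g x ≠ 0} := by
  have h := abs_integral_le_measureReal_support (hg.pow_const 2)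
    (finite_range_comp hfin (fun y => y ^ 2)) (μ := μ) (by
      filter_upwards [hg1] with x hx
      rw [abs_pow]
      exact pow_le_one₀ (abs_nonneg _) hx)
  simpa using (le_abs_self _).trans h

lemma integral_sq_pos_of_measure_support_pos [IsFiniteMeasure μ] {g : ℝ → ℝ} (hg : Measurable g)
    (hfin : (Set.range g).Finite) (hm : 0 < μ.real {x | g x ≠ 0}) : 0 < ∫ x, g x ^ 2 ∂μ := by
  rw [integral_pos_iff_support_of_nonneg (fun x => sq_nonneg _)
    (integrable_of_finite_range (hg.pow_const 2) (finite_range_comp hfin (fun y => y ^ 2)))]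
  have : Function.support (fun x => g x ^ 2) = {x | g x ≠ 0} := by
    ext x; simp
  rw [this]
  exact (ENNReal.toReal_pos_iff.1 hm).1

lemma exp_mul_le_one_add {t y : ℝ} (ht : 0 ≤ t) (ht1 : t ≤ 1) (hy : 0 ≤ y) (hy1 : y ≤ 1) :
    Real.exp (t * y) ≤ 1 + 2 * t * y := by
  have h0 : 0 ≤ t * y := by positivity
  have h := exp_le_bernstein_of_nonneg (y := t * y) (by positivity) (by nlinarith)
  have h1 : t * y ≤ 1 := by nlinarith
  refine h.trans ?_
  have : (t * y) ^ 2 / (2 * (1 - t * y / 3)) ≤ t * y := by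
    rw [div_le_iff₀ (by nlinarith)]
    nlinarith
  linarith

/-- The mean of the sum of squares. -/
lemma IsPoissonProcess.lintegral_sum_sq_le [IsFiniteMeasure μ]
    (hN : IsPoissonProcess N P μ) {g : ℝ → ℝ} (hg : Measurable g) (hfin : (Set.range g).Finite)
    (hg1 : ∀ᵐ x ∂μ, |g x| ≤ 1) (hm : 1 ≤ μ.real {x | g x ≠ 0}) :
    ∫⁻ ω, ENNReal.ofReal (pointSum (N ω) fun x => g x ^ 2) ∂P
      ≤ ENNReal.ofReal (9 * μ.real {x | g x ≠ 0}) := by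
  set m := μ.real {x | g x ≠ 0} with hmdef
  have hm0 : 0 < m := by linarith
  have hv := integral_sq_le_measureReal_support hg hfin hg1
  have h := hN.lintegral_exp_mul_pointSum_le (hg.pow_const 2)
    (finite_range_comp hfin (fun y => y ^ 2)) m⁻¹ (k₁ := 2 * m⁻¹) (k₂ := 0) (by
      filter_upwards [hg1] with x hx
      have := exp_mul_le_one_add (t := m⁻¹) (y := g x ^ 2) (by positivity) (inv_le_one_of_one_le₀ hm)
        (sq_nonneg _) (by rw [← sq_abs]; exact pow_le_one₀ (abs_nonneg _) hx)
      linarith)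
  calc ∫⁻ ω, ENNReal.ofReal (pointSum (N ω) fun x => g x ^ 2) ∂P
      ≤ ∫⁻ ω, ENNReal.ofReal m *
          ENNReal.ofReal (Real.exp (m⁻¹ * pointSum (N ω) fun x => g x ^ 2)) ∂P := by
        -- The mean is read off from an exponential moment, by y ≤ m exp(y/m).
        refine lintegral_mono fun ω => ?_
        rw [← ENNReal.ofReal_mul hm0.le]
        apply ENNReal.ofReal_le_ofReal
        have := Real.add_one_le_exp (m⁻¹ * pointSum (N ω) fun x => g x ^ 2)
        have h2 : m * (m⁻¹ * pointSum (N ω) fun x => g x ^ 2) = pointSum (N ω) fun x => g x ^ 2 := by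
          field_simp
        nlinarith
    _ ≤ ENNReal.ofReal m * ENNReal.ofReal (Real.exp 2) := by
        rw [lintegral_const_mul' _ _ ENNReal.ofReal_ne_top]
        refine mul_le_mul_right (h.trans (ENNReal.ofReal_le_ofReal (Real.exp_le_exp.2 ?_))) _
        rw [zero_mul, add_zero, mul_assoc]
        have : m⁻¹ * ∫ x, g x ^ 2 ∂μ ≤ m⁻¹ * m := by gcongr
        rw [inv_mul_cancel₀ hm0.ne'] at this
        linarith
    _ ≤ ENNReal.ofReal (9 * m) := by
        rw [← ENNReal.ofReal_mul hm0.le]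
        apply ENNReal.ofReal_le_ofReal
        have h3 : Real.exp 2 ≤ 9 := by
          have h4 : Real.exp 2 = Real.exp 1 * Real.exp 1 := by rw [← Real.exp_add]; norm_num
          have := Real.exp_one_lt_d9
          have := Real.exp_pos 1
          rw [h4]; nlinarith
        nlinarith

/-- At s = 1/√m ≤ 1 the Bernstein exponent v s²/(2(1 - s/3)) is at most 1. Each of the two signs
then contributes at most e < 3, and exp|y| ≤ exp(y) + exp(-y). -/
lemma IsPoissonProcess.lintegral_exp_abs_centred_le [IsFiniteMeasure μ]
    (hN : IsPoissonProcess N P μ) {g : ℝ → ℝ} (hg : Measurable g) (hfin : (Set.range g).Finite)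
    (hg1 : ∀ᵐ x ∂μ, |g x| ≤ 1) {m : ℝ} (hm : 1 ≤ m) (hvm : ∫ x, g x ^ 2 ∂μ ≤ m) :
    ∫⁻ ω, ENNReal.ofReal (Real.exp |(pointSum (N ω) g - ∫ x, g x ∂μ) / √m|) ∂P
      ≤ ENNReal.ofReal 6 := by
  have hsm : 1 ≤ √m := Real.one_le_sqrt.2 hm
  have hs1 : (√m)⁻¹ ≤ 1 := inv_le_one_of_one_le₀ hsm
  have hs0 : 0 ≤ (√m)⁻¹ := by positivity
  have hs2 : (√m)⁻¹ ^ 2 = m⁻¹ := by rw [inv_pow, Real.sq_sqrt (by linarith)]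
  have hexp : ∀ v : ℝ, v ≤ m →
      ENNReal.ofReal (Real.exp (v * (√m)⁻¹ ^ 2 / (2 * (1 - (√m)⁻¹ / 3)))) ≤ ENNReal.ofReal 3 := by
    intro v hv
    apply ENNReal.ofReal_le_ofReal
    have hle : v * (√m)⁻¹ ^ 2 / (2 * (1 - (√m)⁻¹ / 3)) ≤ 1 := by
      rw [hs2, div_le_one (by linarith)]
      have : v * m⁻¹ ≤ m * m⁻¹ := by gcongr
      rw [mul_inv_cancel₀ (by linarith)] at this
      linarith
    exact (Real.exp_le_exp.2 hle).trans (by linarith [Real.exp_one_lt_d9])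
  have h1 := (hN.lintegral_exp_centred_le hg hfin hg1 hs0 (by linarith)).trans (hexp _ hvm)
  have h2 := (hN.lintegral_exp_centred_le (g := fun x => -1 * g x) (hg.const_mul (-1))
    (finite_range_comp hfin (fun y => -1 * y)) (by simpa using hg1) hs0 (by linarith)).trans
    (hexp _ (by simpa using hvm))
  calc _ ≤ ∫⁻ ω, (ENNReal.ofReal (Real.exp ((√m)⁻¹ * (pointSum (N ω) g - ∫ x, g x ∂μ))) +
        ENNReal.ofReal (Real.exp ((√m)⁻¹ * ((pointSum (N ω) fun x => -1 * g x)
          - ∫ x, -1 * g x ∂μ)))) ∂P := by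
        refine lintegral_mono fun ω => ?_
        rw [← ENNReal.ofReal_add (Real.exp_pos _).le (Real.exp_pos _).le]
        apply ENNReal.ofReal_le_ofReal
        rw [pointSum_const_mul, integral_const_mul]
        refine (Real.exp_abs_le _).trans (le_of_eq ?_)
        congr 2 <;> ring
    _ ≤ ENNReal.ofReal 3 + ENNReal.ofReal 3 := by
        rw [lintegral_add_left']
        · exact add_le_add h1 h2
        · exact (Real.measurable_exp.comp_aemeasurable
            (((hN.aemeasurable_pointSum hg hfin).sub_const _).const_mul _)).ennreal_ofReal
    _ = _ := by rw [← ENNReal.ofReal_add (by norm_num) (by norm_num)]; norm_num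

end PointSums

/-! ### Risk of a thresholded Poisson sum: small mass and large mass. -/

section PointSums

variable {Ω : Type*} [MeasurableSpace Ω] {P : Measure Ω} {N : Ω → Set ℝ} {μ : Measure ℝ}

/-- The thresholded Poisson sum. -/
def thresholdedSum (u : ℝ) (S : Set ℝ) (g : ℝ → ℝ) : ℝ :=
  if unitThreshold u (pointSum S fun x => g x ^ 2) ≤ |pointSum S g| then pointSum S g else 0

/-- The integrand is exp(2k) - 1, where k, the number of points at which g does not vanish, is
Poisson with parameter m. Its mean is exp(m(e² - 1)) - 1, which is O(m) for m ≤ 1. -/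
lemma IsPoissonProcess.lintegral_exp_count_sub_one_le [IsFiniteMeasure μ] [IsProbabilityMeasure P]
    (hN : IsPoissonProcess N P μ) {g : ℝ → ℝ} (hg : Measurable g) (hfin : (Set.range g).Finite)
    (hm : μ.real {x | g x ≠ 0} ≤ 1) :
    ∫⁻ ω, ENNReal.ofReal
        (Real.exp (pointSum (N ω) fun y => 2 * (if g y = 0 then 0 else 1)) - 1) ∂P
      ≤ ENNReal.ofReal (8 * Real.exp 8 * μ.real {x | g x ≠ 0}) := by
  set m := μ.real {x | g x ≠ 0} with hmdef
  have hA : MeasurableSet {x | g x ≠ 0} := hg (measurableSet_singleton 0).compl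
  have hcm : Measurable fun y => (if g y = 0 then 0 else 1 : ℝ) :=
    Measurable.ite (hg (measurableSet_singleton 0)) measurable_const measurable_const
  have hcf : (Set.range fun y => (if g y = 0 then 0 else 1 : ℝ)).Finite :=
    finite_range_comp hfin (fun z => if z = 0 then 0 else 1)
  have h := hN.lintegral_exp_pointSum (g := fun y => 2 * (if g y = 0 then 0 else 1))
    (hcm.const_mul 2) (finite_range_comp hcf (fun z => 2 * z))
  have hint : ∫ x, (Real.exp (2 * (if g x = 0 then 0 else 1)) - 1) ∂μ = m * (Real.exp 2 - 1) := by
    have : ∀ x, (Real.exp (2 * (if g x = 0 then 0 else 1)) - 1)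
        = {x | g x ≠ 0}.indicator (fun _ => Real.exp 2 - 1) x := by
      intro x
      by_cases h0 : g x = 0 <;> simp [Set.indicator, h0]
    simp_rw [this]
    rw [integral_indicator_const _ hA, smul_eq_mul]
  rw [hint] at h
  have hm0 : 0 ≤ m := measureReal_nonneg
  have he : Real.exp 2 - 1 ≤ 8 := by
    have h4 : Real.exp 2 = Real.exp 1 * Real.exp 1 := by rw [← Real.exp_add]; norm_num
    have := Real.exp_one_lt_d9
    have := Real.exp_pos 1
    rw [h4]; nlinarith
  have he0 : 0 ≤ Real.exp 2 - 1 := by linarith [Real.add_one_le_exp 2]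
  set Y : Ω → ℝ := fun ω => pointSum (N ω) fun y => 2 * (if g y = 0 then 0 else 1) with hY
  have hY0 : ∀ ω, 0 ≤ Y ω := fun ω => tsum_nonneg fun _ => by
    dsimp only; split_ifs <;> simp
  -- The comparison is made after adding 1 to both sides, so that no subtraction of extended
  -- nonnegative numbers occurs.
  have hsplit : ∫⁻ ω, ENNReal.ofReal (Real.exp (Y ω) - 1) ∂P + 1
      = ENNReal.ofReal (Real.exp (m * (Real.exp 2 - 1))) := by
    rw [← h]
    have : (1 : ℝ≥0∞) = ∫⁻ _, 1 ∂P := by simp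
    rw [this, ← lintegral_add_right _ measurable_const]
    refine lintegral_congr fun ω => ?_
    rw [← ENNReal.ofReal_one, ← ENNReal.ofReal_add _ zero_le_one]
    · congr 1; ring
    · linarith [Real.one_le_exp (hY0 ω)]
  have h2 : Real.exp (m * (Real.exp 2 - 1)) ≤ 8 * Real.exp 8 * m + 1 := by
    have h3 : m * (Real.exp 2 - 1) ≤ 8 * m := by nlinarith
    have h4 : Real.exp (m * (Real.exp 2 - 1)) ≤ Real.exp (8 * m) := Real.exp_le_exp.2 h3
    have h5 : Real.exp (8 * m) * (1 - 8 * m) ≤ 1 := by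
      have := Real.add_one_le_exp (-(8 * m))
      calc _ ≤ Real.exp (8 * m) * Real.exp (-(8 * m)) := by
            gcongr; linarith
        _ = 1 := by rw [← Real.exp_add]; simp
    have h6 : Real.exp (8 * m) ≤ Real.exp 8 := Real.exp_le_exp.2 (by linarith)
    nlinarith
  have h3 : ∫⁻ ω, ENNReal.ofReal (Real.exp (Y ω) - 1) ∂P + 1
      ≤ ENNReal.ofReal (8 * Real.exp 8 * m) + 1 := by
    rw [hsplit]
    rw [← ENNReal.ofReal_one, ← ENNReal.ofReal_add (by positivity) zero_le_one]
    exact ENNReal.ofReal_le_ofReal h2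
  exact (ENNReal.add_le_add_iff_right ENNReal.one_ne_top).1 h3

/-- A killed sum has error x², and a kept one is charged to the exponential count. With little mass
no concentration of X is needed, and both parts are at most linear in m, as x² ≤ m². -/
lemma IsPoissonProcess.lintegral_thresholdedSum_le_of_le_one [IsFiniteMeasure μ]
    [IsProbabilityMeasure P] (hN : IsPoissonProcess N P μ) {g : ℝ → ℝ} (hg : Measurable g)
    (hfin : (Set.range g).Finite) (hg1 : ∀ᵐ x ∂μ, |g x| ≤ 1) {ρ : ℝ} (hρ : ∀ x, |g x| ≤ ρ)
    {u : ℝ} (hu : 0 < u) (hm : μ.real {x | g x ≠ 0} ≤ 1) :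
    ∫⁻ ω, ENNReal.ofReal ((thresholdedSum u (N ω) g - ∫ x, g x ∂μ) ^ 2) ∂P
      ≤ ENNReal.ofReal ((∫ x, g x ∂μ) ^ 2 + 16 * (ρ + 1) ^ 2 * Real.exp 8 *
          μ.real {x | g x ≠ 0} * Real.exp (-(2 * u))) := by
  set m := μ.real {x | g x ≠ 0} with hmdef
  set x := ∫ y, g y ∂μ with hx
  have hm0 : 0 ≤ m := measureReal_nonneg
  have hx1 : |x| ≤ 1 := (abs_integral_le_measureReal_support hg hfin hg1).trans hm
  have hρ0 : 0 ≤ ρ := (abs_nonneg _).trans (hρ 0)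
  have h := hN.lintegral_exp_count_sub_one_le hg hfin hm
  calc ∫⁻ ω, ENNReal.ofReal ((thresholdedSum u (N ω) g - x) ^ 2) ∂P
      ≤ ∫⁻ ω, (ENNReal.ofReal (x ^ 2) +
          ENNReal.ofReal (2 * (ρ + 1) ^ 2 * Real.exp (-(2 * u))) * ENNReal.ofReal
          (Real.exp (pointSum (N ω) fun y => 2 * (if g y = 0 then 0 else 1)) - 1)) ∂P := by
        refine lintegral_mono_ae ?_
        filter_upwards [hN.ae_finite] with ω hω
        unfold thresholdedSum
        split_ifs with hT
        · refine le_add_left ?_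
          rw [← ENNReal.ofReal_mul (by positivity)]
          exact ENNReal.ofReal_le_ofReal (sq_deviation_le_of_threshold_le hω hρ hx1 hu hT)
        · refine le_add_right ?_
          simp
    _ ≤ ENNReal.ofReal (x ^ 2) + ENNReal.ofReal (2 * (ρ + 1) ^ 2 * Real.exp (-(2 * u))) *
          ENNReal.ofReal (8 * Real.exp 8 * m) := by
        rw [lintegral_add_left measurable_const, lintegral_const_mul' _ _ ENNReal.ofReal_ne_top]
        simp only [lintegral_const, measure_univ, mul_one]
        gcongr
    _ = _ := by
        rw [← ENNReal.ofReal_mul (by positivity), ← ENNReal.ofReal_add (by positivity)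
          (by positivity)]
        congr 1; ring

/-- The three summands correspond to the event |X - x| ≤ κT, to the truncated error on its
complement, and to the part of the error beyond the truncation. -/
lemma IsPoissonProcess.lintegral_thresholdedSum_le_of_one_le [IsFiniteMeasure μ]
    [IsProbabilityMeasure P] (hN : IsPoissonProcess N P μ) {g : ℝ → ℝ} (hg : Measurable g)
    (hfin : (Set.range g).Finite) (hg1 : ∀ᵐ x ∂μ, |g x| ≤ 1)
    {u κ : ℝ} (hu : 0 < u) (hκ : 0 < κ) (hκ1 : κ < 1) (hm : 1 ≤ μ.real {x | g x ≠ 0}) :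
    ∫⁻ ω, ENNReal.ofReal ((thresholdedSum u (N ω) g - ∫ x, g x ∂μ) ^ 2) ∂P
      ≤ ENNReal.ofReal (4 / (1 - κ) ^ 2 *
            (71 * min ((∫ x, g x ∂μ) ^ 2) (μ.real {x | g x ≠ 0} * u))
          + ((∫ x, g x ∂μ) ^ 2 + 4 * u ^ 2 * μ.real {x | g x ≠ 0}) *
            (3 * Real.exp (-(κ ^ 2 * u)))
          + 48 * μ.real {x | g x ≠ 0} * Real.exp (-u)) := by
  set m := μ.real {x | g x ≠ 0} with hmdef
  set x := ∫ y, g y ∂μ with hx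
  have hm0 : 0 < m := by linarith
  have hxm : |x| ≤ m := abs_integral_le_measureReal_support hg hfin hg1
  have hvm : ∫ y, g y ^ 2 ∂μ ≤ m := integral_sq_le_measureReal_support hg hfin hg1
  have hκ' : 0 < 1 - κ := by linarith
  have hv : 0 < ∫ y, g y ^ 2 ∂μ := integral_sq_pos_of_measure_support_pos hg hfin hm0
  set U : Ω → ℝ := fun ω => pointSum (N ω) fun y => g y ^ 2 with hU
  set X : Ω → ℝ := fun ω => pointSum (N ω) g with hX
  have hXm : AEMeasurable X P := hN.aemeasurable_pointSum hg hfin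
  have hUm : AEMeasurable U P := hN.aemeasurable_pointSum (hg.pow_const 2)
    (finite_range_comp hfin (fun y => y ^ 2))
  have hU0 : ∀ ω, 0 ≤ U ω := fun ω => pointSum_sq_nonneg _ _
  have hTm : AEMeasurable (fun ω => unitThreshold u (U ω)) P := by
    have : Measurable (unitThreshold u) := by unfold unitThreshold; fun_prop
    exact this.comp_aemeasurable hUm
  set B : Set Ω := {ω | κ * unitThreshold u (U ω) < |X ω - x|} with hB
  have hBm : NullMeasurableSet B P := by
    refine nullMeasurableSet_lt (hTm.const_mul κ) ?_
    exact continuous_abs.measurable.comp_aemeasurable (hXm.sub_const x)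
  have hPB : P B ≤ ENNReal.ofReal (3 * Real.exp (-(κ ^ 2 * u))) :=
    hN.measure_deviation_gt_threshold_le hg hfin hg1 hv hu hκ hκ1.le
  have hsqm : √m ^ 2 = m := Real.sq_sqrt hm0.le
  have hpoint : ∀ ω, ENNReal.ofReal ((thresholdedSum u (N ω) g - x) ^ 2) ≤
      ENNReal.ofReal (4 / (1 - κ) ^ 2 * min (x ^ 2) (unitThreshold u (U ω) ^ 2)) +
      B.indicator (fun _ => ENNReal.ofReal (x ^ 2 + 4 * u ^ 2 * m)) ω +
      ENNReal.ofReal (8 * m * Real.exp (-u)) * ENNReal.ofReal (Real.exp |(X ω - x) / √m|) := by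
    intro ω
    by_cases hω : ω ∈ B
    · rw [Set.indicator_of_mem hω, ← ENNReal.ofReal_mul (by positivity), add_assoc,
        ← ENNReal.ofReal_add (by positivity) (by positivity)]
      refine le_add_left (ENNReal.ofReal_le_ofReal ?_)
      have h1 : (X ω - x) ^ 2 ≤ 4 * u ^ 2 * m +
          8 * m * Real.exp (-u) * Real.exp |(X ω - x) / √m| := by
        -- Truncating at L = 2u leaves the factor exp(-u) in front of the exponential moment.
        have h2 := sq_le_truncation (y := (X ω - x) / √m) (L := 2 * u)
        rw [div_pow, hsqm, div_le_iff₀ hm0, mul_div_cancel_left₀ u two_ne_zero] at h2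
        linarith
      have h3 : 0 ≤ 8 * m * Real.exp (-u) * Real.exp |(X ω - x) / √m| := by positivity
      have h4 : 0 ≤ 4 * u ^ 2 * m := by positivity
      unfold thresholdedSum
      split_ifs
      · nlinarith [sq_nonneg x]
      · nlinarith
    · refine le_add_right (le_add_right (ENNReal.ofReal_le_ofReal ?_))
      exact sq_threshold_error_le (unitThreshold_nonneg hu.le) hκ hκ1 (not_lt.1 hω)
  have hmain : ∫⁻ ω, ENNReal.ofReal (min (x ^ 2) (unitThreshold u (U ω) ^ 2)) ∂P
      ≤ ENNReal.ofReal (71 * min (x ^ 2) (m * u)) := by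
    have hx2 : ∫⁻ ω, ENNReal.ofReal (min (x ^ 2) (unitThreshold u (U ω) ^ 2)) ∂P
        ≤ ENNReal.ofReal (x ^ 2) := by
      calc _ ≤ ∫⁻ _, ENNReal.ofReal (x ^ 2) ∂P :=
            lintegral_mono fun ω => ENNReal.ofReal_le_ofReal (min_le_left _ _)
        _ = _ := by simp
    have hxle : x ^ 2 ≤ m ^ 2 := by rw [← sq_abs]; gcongr
    rcases le_total (x ^ 2) (m * u) with hc | hc
    · rw [min_eq_left hc]
      exact hx2.trans (ENNReal.ofReal_le_ofReal (by nlinarith [sq_nonneg x]))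
    · rw [min_eq_right hc]
      -- From mu ≤ x² ≤ m². Hence 6u·9m + 17u² ≤ (54 + 17)mu, which is the constant 71.
      have hum : u ≤ m := by nlinarith
      calc _ ≤ ∫⁻ ω, (ENNReal.ofReal (6 * u) * ENNReal.ofReal (U ω)
              + ENNReal.ofReal (17 * u ^ 2)) ∂P := by
            refine lintegral_mono fun ω => ?_
            rw [← ENNReal.ofReal_mul (by positivity), ← ENNReal.ofReal_add
              (mul_nonneg (by positivity) (hU0 ω)) (by positivity)]
            exact ENNReal.ofReal_le_ofReal
              ((min_le_right _ _).trans (sq_unitThreshold_le hu.le (hU0 ω)))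
        _ ≤ ENNReal.ofReal (6 * u) * ENNReal.ofReal (9 * m) + ENNReal.ofReal (17 * u ^ 2) := by
            rw [lintegral_add_right _ measurable_const,
              lintegral_const_mul' _ _ ENNReal.ofReal_ne_top]
            simp only [lintegral_const, measure_univ, mul_one]
            gcongr
            exact hN.lintegral_sum_sq_le hg hfin hg1 hm
        _ ≤ _ := by
            rw [← ENNReal.ofReal_mul (by positivity), ← ENNReal.ofReal_add (by positivity)
              (by positivity)]
            apply ENNReal.ofReal_le_ofReal
            nlinarith
  have hexp := hN.lintegral_exp_abs_centred_le hg hfin hg1 hm hvm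
  have hmeas3 : AEMeasurable (fun ω => ENNReal.ofReal (8 * m * Real.exp (-u)) *
      ENNReal.ofReal (Real.exp |(X ω - x) / √m|)) P :=
    (Real.measurable_exp.comp_aemeasurable (continuous_abs.measurable.comp_aemeasurable
      ((hXm.sub_const x).div_const _))).ennreal_ofReal.const_mul _
  calc _ ≤ ∫⁻ ω, (ENNReal.ofReal (4 / (1 - κ) ^ 2 * min (x ^ 2) (unitThreshold u (U ω) ^ 2)) +
      B.indicator (fun _ => ENNReal.ofReal (x ^ 2 + 4 * u ^ 2 * m)) ω +
      ENNReal.ofReal (8 * m * Real.exp (-u)) * ENNReal.ofReal (Real.exp |(X ω - x) / √m|)) ∂P :=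
        lintegral_mono hpoint
    _ ≤ ENNReal.ofReal (4 / (1 - κ) ^ 2) * ENNReal.ofReal (71 * min (x ^ 2) (m * u)) +
        ENNReal.ofReal (x ^ 2 + 4 * u ^ 2 * m) * ENNReal.ofReal (3 * Real.exp (-(κ ^ 2 * u))) +
        ENNReal.ofReal (8 * m * Real.exp (-u)) * ENNReal.ofReal 6 := by
        rw [lintegral_add_right' _ hmeas3, lintegral_add_right' _
          (aemeasurable_const.indicator₀ hBm), lintegral_indicator_const₀ hBm,
          lintegral_const_mul' _ _ ENNReal.ofReal_ne_top]
        gcongr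
        simp_rw [ENNReal.ofReal_mul (show 0 ≤ 4 / (1 - κ) ^ 2 by positivity)]
        rw [lintegral_const_mul' _ _ ENNReal.ofReal_ne_top]
        gcongr
    _ = _ := by
        have h0 : 0 ≤ min (x ^ 2) (m * u) := le_min (sq_nonneg _) (by positivity)
        rw [← ENNReal.ofReal_mul (by positivity), ← ENNReal.ofReal_mul (by positivity),
          ← ENNReal.ofReal_mul (by positivity), ← ENNReal.ofReal_add (by positivity)
          (by positivity), ← ENNReal.ofReal_add (by positivity) (by positivity)]
        congr 1; ring

end PointSums

/-- The gap d = κ² - θ absorbs the polynomial factor: u² exp(-du) ≤ 2/d². This is why the final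
exponent θ is strictly below κ². -/
lemma risk_large_mass_le {κ θ u x m : ℝ} (hκ : κ < 1) (hκθ : θ < κ ^ 2) (hθ1 : θ < 1)
    (hu : 0 < u) (hm : 0 ≤ m) :
    4 / (1 - κ) ^ 2 * (71 * min (x ^ 2) (m * u)) +
      (x ^ 2 + 4 * u ^ 2 * m) * (3 * Real.exp (-(κ ^ 2 * u))) + 48 * m * Real.exp (-u)
      ≤ (4 / (1 - κ) ^ 2 * 71 + (3 + 24 / (κ ^ 2 - θ) ^ 2) + 48) *
        (min (x ^ 2) (m * u) + (m + x ^ 2) * Real.exp (-(θ * u))) := by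
  obtain ⟨d, hd0, hd⟩ : ∃ d : ℝ, 0 < d ∧ κ ^ 2 = θ + d := ⟨κ ^ 2 - θ, by linarith, by ring⟩
  have hM0 : 0 ≤ min (x ^ 2) (m * u) := le_min (sq_nonneg _) (by positivity)
  have h1κ : 0 < 1 - κ := by linarith
  rw [hd, add_sub_cancel_left]
  have hEle : ∀ a, θ ≤ a → Real.exp (-(a * u)) ≤ Real.exp (-(θ * u)) :=
    fun a ha => Real.exp_le_exp.2 (by nlinarith)
  have h1 : u ^ 2 * Real.exp (-((θ + d) * u)) ≤ 2 / d ^ 2 * Real.exp (-(θ * u)) := by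
    have h2 := Real.quadratic_le_exp_of_nonneg (x := d * u) (by positivity)
    have h3 : u ^ 2 ≤ 2 / d ^ 2 * Real.exp (d * u) := by
      rw [div_mul_eq_mul_div, le_div_iff₀ (by positivity)]
      have : 0 ≤ d * u := by positivity
      nlinarith
    calc _ ≤ 2 / d ^ 2 * Real.exp (d * u) * Real.exp (-((θ + d) * u)) := by gcongr
      _ = 2 / d ^ 2 * Real.exp (-(θ * u)) := by
        rw [mul_assoc, ← Real.exp_add]
        congr 2
        ring
  have h2 : Real.exp (-((θ + d) * u)) ≤ Real.exp (-(θ * u)) := hEle _ (by linarith)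
  have h3 : Real.exp (-u) ≤ Real.exp (-(θ * u)) := by simpa using hEle 1 hθ1.le
  have hE := (Real.exp_pos (-(θ * u))).le
  clear hEle
  generalize Real.exp (-(θ * u)) = E at *
  generalize Real.exp (-((θ + d) * u)) = E' at *
  generalize Real.exp (-u) = E'' at *
  generalize min (x ^ 2) (m * u) = M at *
  have h6 : 0 ≤ 4 / (1 - κ) ^ 2 := by positivity
  have h7 : 0 ≤ 24 / d ^ 2 := by positivity
  have h8 : 2 / d ^ 2 = 24 / d ^ 2 / 12 := by ring
  rw [h8] at h1
  generalize 4 / (1 - κ) ^ 2 = A at *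
  generalize 24 / d ^ 2 = D at *
  have hmE : 0 ≤ m * E := by positivity
  have hxE : 0 ≤ x ^ 2 * E := by positivity
  have h4 : (x ^ 2 + 4 * u ^ 2 * m) * (3 * E') ≤ 3 * (x ^ 2 * E) + D * (m * E) := by
    have h5 : 12 * m * (u ^ 2 * E') ≤ 12 * m * (D / 12 * E) := by gcongr
    have h6 : x ^ 2 * E' ≤ x ^ 2 * E := by gcongr
    linarith
  have h5 : 48 * m * E'' ≤ 48 * (m * E) := by rw [mul_assoc]; gcongr
  have e1 := mul_nonneg h6 hM0
  have e2 := mul_nonneg h7 hM0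
  have e3 := mul_nonneg h6 hmE
  have e4 := mul_nonneg h6 hxE
  have e5 := mul_nonneg h7 hxE
  nlinarith

/-- The risk of a thresholded Poisson sum. -/
theorem exists_lintegral_thresholdedSum_le {θ ρ u₀ : ℝ} (hθ : 0 < θ) (hθ1 : θ < 1)
    (hu₀ : 0 < u₀) :
    ∃ C : ℝ, 0 ≤ C ∧ ∀ {Ω : Type*} [MeasurableSpace Ω] {P : Measure Ω} [IsProbabilityMeasure P]
      {N : Ω → Set ℝ} {μ : Measure ℝ} [IsFiniteMeasure μ], IsPoissonProcess N P μ →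
      ∀ {g : ℝ → ℝ}, Measurable g → (Set.range g).Finite → (∀ᵐ x ∂μ, |g x| ≤ 1) →
      (∀ x, |g x| ≤ ρ) → ∀ u, u₀ ≤ u →
      ∫⁻ ω, ENNReal.ofReal ((thresholdedSum u (N ω) g - ∫ x, g x ∂μ) ^ 2) ∂P
        ≤ ENNReal.ofReal (C * (min ((∫ x, g x ∂μ) ^ 2) (μ.real {x | g x ≠ 0} * u) +
          (μ.real {x | g x ≠ 0} + (∫ x, g x ∂μ) ^ 2) * Real.exp (-(θ * u)))) := by
  obtain ⟨κ, hκ0, hκ1, hκθ⟩ : ∃ κ : ℝ, 0 < κ ∧ κ < 1 ∧ θ < κ ^ 2 := by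
    -- The square of κ is the midpoint between θ and 1.
    refine ⟨√((1 + θ) / 2), by positivity, ?_, ?_⟩
    · rw [Real.sqrt_lt' one_pos]; linarith
    · rw [Real.sq_sqrt (by positivity)]; linarith
  set d := κ ^ 2 - θ with hd
  have hd0 : 0 < d := by linarith
  have h1κ : 0 < 1 - κ := by linarith
  set C₁ := 1 + 1 / u₀ + 16 * (ρ + 1) ^ 2 * Real.exp 8 with hC₁
  set C₂ := 4 / (1 - κ) ^ 2 * 71 + (3 + 24 / d ^ 2) + 48 with hC₂
  have hC₁0 : 0 ≤ C₁ := by positivity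
  have hC₂0 : 0 ≤ C₂ := by positivity
  refine ⟨C₁ + C₂, by positivity, ?_⟩
  intro Ω _ P _ N μ _ hN g hg hfin hg1 hρ u hu
  set m := μ.real {x | g x ≠ 0} with hmdef
  set x := ∫ y, g y ∂μ with hx
  have hm0 : 0 ≤ m := measureReal_nonneg
  have hu0 : 0 < u := by linarith
  have hxm : |x| ≤ m := abs_integral_le_measureReal_support hg hfin hg1
  have hM0 : 0 ≤ min (x ^ 2) (m * u) := le_min (sq_nonneg _) (by positivity)
  set E := Real.exp (-(θ * u)) with hE
  have hE0 : 0 < E := Real.exp_pos _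
  have hEle : ∀ a, θ ≤ a → Real.exp (-(a * u)) ≤ E := fun a ha => Real.exp_le_exp.2 (by nlinarith)
  have hmE : 0 ≤ m * E := by positivity
  have hxE : 0 ≤ x ^ 2 * E := by positivity
  have hR0 : 0 ≤ min (x ^ 2) (m * u) + (m + x ^ 2) * E := by positivity
  rcases le_total m 1 with hm | hm
  · refine (hN.lintegral_thresholdedSum_le_of_le_one hg hfin hg1 hρ hu0 hm).trans
      (ENNReal.ofReal_le_ofReal ?_)
    -- Here x² ≤ m² ≤ m ≤ mu/u₀, so with small mass even killing every coefficient is within the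
    -- oracle bound.
    have h1 : x ^ 2 ≤ (1 + 1 / u₀) * min (x ^ 2) (m * u) := by
      have hx2 : x ^ 2 ≤ m ^ 2 := by rw [← sq_abs]; gcongr
      have h10 : 0 ≤ 1 / u₀ := by positivity
      rcases min_choice (x ^ 2) (m * u) with h | h <;> rw [h]
      · nlinarith [sq_nonneg x]
      · have : m ≤ 1 / u₀ * (m * u) := by
          rw [div_mul_eq_mul_div, le_div_iff₀ hu₀]; nlinarith
        have hmu : 0 ≤ m * u := by positivity
        nlinarith
    have h2 : Real.exp (-(2 * u)) ≤ E := hEle 2 (by linarith)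
    have h3 : 16 * (ρ + 1) ^ 2 * Real.exp 8 * m * Real.exp (-(2 * u)) ≤
        16 * (ρ + 1) ^ 2 * Real.exp 8 * (m * E) := by
      rw [mul_assoc _ m]; gcongr
    have h4 : 0 ≤ 1 + 1 / u₀ := by positivity
    have h5 : 0 ≤ 16 * (ρ + 1) ^ 2 * Real.exp 8 := by positivity
    calc _ ≤ (1 + 1 / u₀) * min (x ^ 2) (m * u) + 16 * (ρ + 1) ^ 2 * Real.exp 8 * (m * E) :=
          add_le_add h1 h3
      _ ≤ C₁ * (min (x ^ 2) (m * u) + (m + x ^ 2) * E) := by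
          rw [hC₁]
          nlinarith [mul_nonneg h5 hM0, mul_nonneg h4 hmE, mul_nonneg h4 hxE, mul_nonneg h5 hxE]
      _ ≤ _ := by gcongr; linarith
  · refine (hN.lintegral_thresholdedSum_le_of_one_le hg hfin hg1 hu0 hκ0 hκ1 hm).trans
      (ENNReal.ofReal_le_ofReal ?_)
    refine (risk_large_mass_le hκ1 hκθ hθ1 hu0 hm0).trans ?_
    rw [← hd, ← hC₂]
    gcongr
    linarith

/-! ## Riesz bound for unconditional biorthogonal bases -/

/-- A convergent net need not be bounded, but here the sum over F is the sum over F₀ ∪ F, which is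
near the limit, minus a sum over a subset of the fixed finite set F₀. -/
lemma exists_norm_sum_le_of_tendsto {E ι : Type*} [NormedAddCommGroup E] {x : ι → E} {f : E}
    (h : Tendsto (fun F : Finset ι => ∑ i ∈ F, x i) atTop (𝓝 f)) :
    ∃ C, ∀ F : Finset ι, ‖∑ i ∈ F, x i‖ ≤ C := by
  classical
  obtain ⟨F₀, hF₀⟩ := (Metric.tendsto_atTop.1 h) 1 one_pos
  refine ⟨‖f‖ + 1 + ∑ i ∈ F₀, ‖x i‖, fun F => ?_⟩
  have h1 : ∑ i ∈ F, x i = ∑ i ∈ F₀ ∪ F, x i - ∑ i ∈ F₀ \ F, x i := by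
    rw [← Finset.sdiff_union_self_eq_union, Finset.sum_union Finset.sdiff_disjoint]
    simp
  have h2 : ‖∑ i ∈ F₀ ∪ F, x i‖ ≤ ‖f‖ + 1 := by
    have := hF₀ (F₀ ∪ F) Finset.subset_union_left
    rw [dist_eq_norm] at this
    calc _ = ‖f + (∑ i ∈ F₀ ∪ F, x i - f)‖ := by congr 1; abel
      _ ≤ _ := (norm_add_le _ _).trans (by linarith)
  have h3 : ‖∑ i ∈ F₀ \ F, x i‖ ≤ ∑ i ∈ F₀, ‖x i‖ :=
    (norm_sum_le _ _).trans (Finset.sum_le_sum_of_subset_of_nonneg Finset.sdiff_subset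
      fun _ _ _ => norm_nonneg _)
  rw [h1]
  exact (norm_sub_le _ _).trans (add_le_add h2 h3)

section Hilbert

variable {E ι : Type*} [NormedAddCommGroup E] [InnerProductSpace ℝ E]

/-- The signs are chosen one at a time: by the parallelogram law, one of the two signs of the new
vector adds at most its squared norm. -/
lemma exists_signs_norm_sq_sum_le (F : Finset ι) (x : ι → E) :
    ∃ ε : ι → ℝ, (∀ i, ε i = 1 ∨ ε i = -1) ∧ ‖∑ i ∈ F, ε i • x i‖ ^ 2 ≤ ∑ i ∈ F, ‖x i‖ ^ 2 := by
  classical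
  induction F using Finset.induction_on with
  | empty => exact ⟨fun _ => 1, fun _ => Or.inl rfl, by simp⟩
  | insert j F hj ih =>
    obtain ⟨ε, hε, h⟩ := ih
    have hpar := parallelogram_law_with_norm ℝ (∑ i ∈ F, ε i • x i) (x j)
    obtain ⟨s, hs, hs2⟩ : ∃ s : ℝ, (s = 1 ∨ s = -1) ∧
        ‖∑ i ∈ F, ε i • x i + s • x j‖ ^ 2 ≤ ‖∑ i ∈ F, ε i • x i‖ ^ 2 + ‖x j‖ ^ 2 := by
      rcases le_total (‖∑ i ∈ F, ε i • x i + x j‖ ^ 2)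
        (‖∑ i ∈ F, ε i • x i - x j‖ ^ 2) with hc | hc
      · exact ⟨1, Or.inl rfl, by rw [one_smul]; nlinarith⟩
      · refine ⟨-1, Or.inr rfl, ?_⟩
        rw [neg_one_smul, ← sub_eq_add_neg]; nlinarith
    refine ⟨Function.update ε j s, fun i => ?_, ?_⟩
    · by_cases hij : i = j
      · subst hij; simpa using hs
      · simpa [Function.update_of_ne hij] using hε i
    · rw [Finset.sum_insert hj, Finset.sum_insert hj, Function.update_self, add_comm]
      have : ∑ i ∈ F, Function.update ε j s i • x i = ∑ i ∈ F, ε i • x i := by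
        refine Finset.sum_congr rfl fun i hi => ?_
        rw [Function.update_of_ne (ne_of_mem_of_not_mem hi hj)]
      rw [this]
      linarith

/-- An unconditional biorthogonal basis that is bounded satisfies an upper Riesz inequality. -/
theorem exists_norm_sq_sum_le_of_biorthogonal [CompleteSpace E] [DecidableEq ι]
    {d e : ι → E}
    (hde : ∀ i j, inner ℝ (d i) (e j) = if i = j then (1 : ℝ) else 0)
    (hsum : ∀ f, Tendsto (fun F : Finset ι => ∑ i ∈ F, inner ℝ (d i) f • e i) atTop (𝓝 f))
    {M : ℝ} (hM : ∀ i, ‖e i‖ ≤ M) :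
    ∃ K : ℝ, 0 ≤ K ∧ ∀ (F : Finset ι) (a : ι → ℝ),
      ‖∑ i ∈ F, a i • e i‖ ^ 2 ≤ K * ∑ i ∈ F, a i ^ 2 := by
  classical
  set T : Finset ι → E →L[ℝ] E := fun F => ∑ i ∈ F, (innerSL ℝ (d i)).smulRight (e i) with hTdef
  have hT : ∀ F f, T F f = ∑ i ∈ F, inner ℝ (d i) f • e i := by
    intro F f
    simp [hTdef]
  -- Unconditional convergence makes the partial sum operators pointwise bounded, hence uniformly
  -- bounded over all finite index sets.
  obtain ⟨B, hB⟩ := banach_steinhaus (g := T) fun f => by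
    obtain ⟨C, hC⟩ := exists_norm_sum_le_of_tendsto (hsum f)
    exact ⟨C, fun F => by rw [hT]; exact hC F⟩
  have hB0 : 0 ≤ B := (norm_nonneg _).trans (hB ∅)
  refine ⟨(2 * B) ^ 2 * M ^ 2, by positivity, fun F a => ?_⟩
  obtain ⟨ε, hε, hg⟩ := exists_signs_norm_sq_sum_le F fun i => a i • e i
  set g := ∑ i ∈ F, ε i • a i • e i with hgdef
  have hcoef : ∀ i ∈ F, inner ℝ (d i) g = ε i * a i := by
    intro i hi
    rw [hgdef, inner_sum, Finset.sum_eq_single i]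
    · rw [inner_smul_right, inner_smul_right, hde, if_pos rfl, mul_one]
    · intro j _ hj
      rw [inner_smul_right, inner_smul_right, hde, if_neg hj.symm, mul_zero, mul_zero]
    · exact fun h => absurd hi h
  -- By biorthogonality, projecting g on the indices of either sign and subtracting undoes the sign
  -- changes. So passing from g to the original sum costs at most a factor 2B.
  have hf : ∑ i ∈ F, a i • e i = T (F.filter fun i => ε i = 1) g - T (F.filter fun i => ¬ ε i = 1) g := by
    rw [hT, hT, ← Finset.sum_filter_add_sum_filter_not F fun i => ε i = 1, sub_eq_add_neg,
      ← Finset.sum_neg_distrib]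
    congr 1
    · refine Finset.sum_congr rfl fun i hi => ?_
      rw [Finset.mem_filter] at hi
      rw [hcoef i hi.1, hi.2, one_mul]
    · refine Finset.sum_congr rfl fun i hi => ?_
      rw [Finset.mem_filter] at hi
      rw [hcoef i hi.1, (hε i).resolve_left hi.2, neg_one_mul, neg_smul, neg_neg]
  have hnorm : ‖∑ i ∈ F, a i • e i‖ ≤ 2 * B * ‖g‖ := by
    rw [hf]
    refine (norm_sub_le _ _).trans ?_
    have h1 := (T (F.filter fun i => ε i = 1)).le_of_opNorm_le (hB _) g
    have h2 := (T (F.filter fun i => ¬ ε i = 1)).le_of_opNorm_le (hB _) g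
    linarith
  calc ‖∑ i ∈ F, a i • e i‖ ^ 2 ≤ (2 * B * ‖g‖) ^ 2 := by gcongr
    _ = (2 * B) ^ 2 * ‖g‖ ^ 2 := by ring
    _ ≤ (2 * B) ^ 2 * ∑ i ∈ F, ‖a i • e i‖ ^ 2 := by gcongr
    _ ≤ (2 * B) ^ 2 * ∑ i ∈ F, a i ^ 2 * M ^ 2 := by
        gcongr with i
        rw [norm_smul, mul_pow, Real.norm_eq_abs, sq_abs]
        gcongr
        exact hM i
    _ = _ := by rw [← Finset.sum_mul]; ring

end Hilbert

/-- The properties of a wavelet system that the risk bound uses. -/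
structure WaveletSystem.IsUnconditionalBasis (Φ : WaveletSystem) : Prop where
  memLp_analysis : ∀ l, MemLp (Φ.analysis l) 2 volume
  memLp_synthesis : ∀ l, MemLp (Φ.synthesis l) 2 volume
  synthesis_le : ∃ M : ℝ≥0, ∀ l, eLpNorm (Φ.synthesis l) 2 volume ≤ M
  biorthogonal : ∀ l l' : WaveletIndex,
    ∫ x, Φ.analysis l x * Φ.synthesis l' x = if l = l' then 1 else 0
  decomposition : ∀ f : ℝ → ℝ, MemLp f 2 volume →
    Tendsto (fun F : Finset WaveletIndex =>
      eLpNorm (fun x => f x - ∑ l ∈ F, Φ.coeff f l * Φ.synthesis l x) 2 volume) atTop (𝓝 0)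

/-! ### Transfer of the Riesz bound to wavelet expansions in L²(ℝ). -/

lemma inner_toLp_eq_integral {f g : ℝ → ℝ} (hf : MemLp f 2 volume) (hg : MemLp g 2 volume) :
    inner ℝ (hf.toLp f) (hg.toLp g) = ∫ x, f x * g x := by
  rw [L2.inner_def]
  refine integral_congr_ae ?_
  filter_upwards [hf.coeFn_toLp, hg.coeFn_toLp] with x h1 h2
  rw [h1, h2]
  simp [mul_comm]

lemma coeFn_finset_sum_toLp {e : WaveletIndex → ℝ → ℝ} (he : ∀ l, MemLp (e l) 2 volume)
    (F : Finset WaveletIndex) (a : WaveletIndex → ℝ) :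
    (∑ l ∈ F, a l • (he l).toLp (e l) : Lp ℝ 2 (volume : Measure ℝ))
      =ᵐ[volume] fun x => ∑ l ∈ F, a l * e l x := by
  have hm : MemLp (fun x => ∑ l ∈ F, a l * e l x) 2 volume :=
    memLp_finsetSum F fun l _ => (he l).const_mul (a l)
  have : (∑ l ∈ F, a l • (he l).toLp (e l)) = hm.toLp _ := by
    classical
    induction F using Finset.induction_on with
    | empty =>
      simp only [Finset.sum_empty]
      exact (MemLp.toLp_zero _).symm
    | insert j F hj ih =>
      have hm' : MemLp (fun x => ∑ l ∈ F, a l * e l x) 2 volume :=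
        memLp_finsetSum F fun l _ => (he l).const_mul (a l)
      rw [Finset.sum_insert hj, ih hm', ← MemLp.toLp_const_smul, ← MemLp.toLp_add]
      congr 1
      ext x
      simp [Finset.sum_insert hj]
  rw [this]
  exact hm.coeFn_toLp

lemma WaveletSystem.IsUnconditionalBasis.exists_eLpNorm_sum_sq_le {Φ : WaveletSystem}
    (hΦ : Φ.IsUnconditionalBasis) :
    ∃ K : ℝ, 0 ≤ K ∧ ∀ (F : Finset WaveletIndex) (a : WaveletIndex → ℝ),
      eLpNorm (fun x => ∑ l ∈ F, a l * Φ.synthesis l x) 2 volume ^ 2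
        ≤ ENNReal.ofReal (K * ∑ l ∈ F, a l ^ 2) := by
  set e : WaveletIndex → Lp ℝ 2 (volume : Measure ℝ) :=
    fun l => (hΦ.memLp_synthesis l).toLp (Φ.synthesis l) with he
  set d : WaveletIndex → Lp ℝ 2 (volume : Measure ℝ) :=
    fun l => (hΦ.memLp_analysis l).toLp (Φ.analysis l) with hd
  obtain ⟨M, hM⟩ := hΦ.synthesis_le
  have hde : ∀ i j, inner ℝ (d i) (e j) = if i = j then (1 : ℝ) else 0 := fun i j => by
    rw [he, hd, inner_toLp_eq_integral, hΦ.biorthogonal]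
  have hnorm : ∀ i, ‖e i‖ ≤ M := fun i => by
    rw [he, Lp.norm_toLp]
    exact ENNReal.toReal_le_of_le_ofReal M.2 (by simpa using hM i)
  have hsum : ∀ f, Tendsto (fun F : Finset WaveletIndex => ∑ i ∈ F, inner ℝ (d i) f • e i)
      atTop (𝓝 f) := by
    intro f
    have h := hΦ.decomposition f (Lp.memLp f)
    rw [tendsto_iff_norm_sub_tendsto_zero]
    have h2 := (ENNReal.tendsto_toReal ENNReal.zero_ne_top).comp h
    rw [ENNReal.toReal_zero] at h2
    refine h2.congr fun F => ?_
    rw [Function.comp_apply, norm_sub_rev, Lp.norm_def]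
    congr 1
    refine eLpNorm_congr_ae ?_
    have hcoef : ∀ l, inner ℝ (d l) f = Φ.coeff f l := by
      intro l
      have := inner_toLp_eq_integral (hΦ.memLp_analysis l) (Lp.memLp f)
      rwa [Lp.toLp_coeFn] at this
    simp_rw [hcoef]
    filter_upwards [Lp.coeFn_sub f (∑ i ∈ F, Φ.coeff f i • e i),
      coeFn_finset_sum_toLp hΦ.memLp_synthesis F (Φ.coeff f)] with x h1 h2
    rw [h1, Pi.sub_apply, h2]
  obtain ⟨K, hK0, hK⟩ := exists_norm_sq_sum_le_of_biorthogonal hde hsum hnorm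
  refine ⟨K, hK0, fun F a => ?_⟩
  rw [← eLpNorm_congr_ae (coeFn_finset_sum_toLp hΦ.memLp_synthesis F a)]
  have h := ENNReal.ofReal_le_ofReal (hK F a)
  rw [ENNReal.ofReal_pow (norm_nonneg _), Lp.norm_def, ENNReal.ofReal_toReal (Lp.eLpNorm_ne_top _)]
    at h
  exact h

/-- The loss of a finite expansion is bounded by the squared error of its coefficients. -/
theorem WaveletSystem.IsUnconditionalBasis.exists_loss_le {Φ : WaveletSystem}
    (hΦ : Φ.IsUnconditionalBasis) :
    ∃ K : ℝ, 0 ≤ K ∧ ∀ (f : ℝ → ℝ), MemLp f 2 volume → ∀ (F : Finset WaveletIndex)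
      (a : WaveletIndex → ℝ), (∀ l ∉ F, a l = 0) →
      eLpNorm (fun x => ∑ l ∈ F, a l * Φ.synthesis l x - f x) 2 volume ^ 2
        ≤ ENNReal.ofReal K * ∑' l, ENNReal.ofReal ((a l - Φ.coeff f l) ^ 2) := by
  obtain ⟨K, hK0, hK⟩ := hΦ.exists_eLpNorm_sum_sq_le
  refine ⟨K, hK0, fun f hf F a ha => ?_⟩
  classical
  set D := ENNReal.ofReal K * ∑' l, ENNReal.ofReal ((a l - Φ.coeff f l) ^ 2) with hD
  have hsq : ∀ z : ℝ≥0∞, (z ^ (1 / 2 : ℝ)) ^ 2 = z := fun z => by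
    rw [← ENNReal.rpow_natCast, ← ENNReal.rpow_mul]; simp
  have hms : ∀ (G : Finset WaveletIndex) (b : WaveletIndex → ℝ),
      MemLp (fun x => ∑ l ∈ G, b l * Φ.synthesis l x) 2 volume := fun G b =>
    memLp_finsetSum G fun l _ => (hΦ.memLp_synthesis l).const_mul (b l)
  have hlim := (hΦ.decomposition f hf).const_add (D ^ (1 / 2 : ℝ))
  rw [add_zero] at hlim
  have hle : eLpNorm (fun x => ∑ l ∈ F, a l * Φ.synthesis l x - f x) 2 volume
      ≤ D ^ (1 / 2 : ℝ) := by
    refine ge_of_tendsto hlim ?_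
    -- Once G contains F, the loss splits into an expansion over G with coefficients a - β,
    -- controlled by the Riesz bound, and the remainder of the expansion of f, which tends to 0.
    filter_upwards [eventually_ge_atTop F] with G hG
    have hsplit : (fun x => ∑ l ∈ F, a l * Φ.synthesis l x - f x) =
        (fun x => ∑ l ∈ G, (a l - Φ.coeff f l) * Φ.synthesis l x) -
        fun x => f x - ∑ l ∈ G, Φ.coeff f l * Φ.synthesis l x := by
      ext x
      have : ∑ l ∈ F, a l * Φ.synthesis l x = ∑ l ∈ G, a l * Φ.synthesis l x :=
        Finset.sum_subset hG fun l _ hl => by rw [ha l hl, zero_mul]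
      rw [this, Pi.sub_apply]
      simp only [sub_mul, Finset.sum_sub_distrib]
      ring
    rw [hsplit]
    refine (eLpNorm_sub_le (hms G _).1 (hf.sub (hms G _)).1 (by norm_num)).trans ?_
    refine add_le_add ?_ le_rfl
    have h1 : eLpNorm (fun x => ∑ l ∈ G, (a l - Φ.coeff f l) * Φ.synthesis l x) 2 volume ^ 2
        ≤ D := by
      refine (hK G _).trans ?_
      rw [ENNReal.ofReal_mul hK0, ENNReal.ofReal_sum_of_nonneg fun _ _ => sq_nonneg _, hD]
      gcongr
      exact ENNReal.sum_le_tsum G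
    have h2 : ∀ z : ℝ≥0∞, (z ^ 2) ^ (1 / 2 : ℝ) = z := fun z => by
      rw [← ENNReal.rpow_natCast, ← ENNReal.rpow_mul]; simp
    rw [← h2 (eLpNorm _ 2 volume)]
    gcongr
  calc _ ≤ (D ^ (1 / 2 : ℝ)) ^ 2 := by gcongr
    _ = D := hsq D

/-! ## The Haar basis -/

/-- The rank of the dyadic partition for which the Haar function of index `l` is constant. -/
def haarRank : WaveletIndex → ℕ
  | Sum.inl _ => 0
  | Sum.inr (j, _) => j + 1

/-- The values of a Haar function on the dyadic intervals. -/
def haarProfile : WaveletIndex → ℤ → ℝ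
  | Sum.inl k => fun z => if z = k then 1 else 0
  | Sum.inr (j, k) => fun z =>
      (2 : ℝ) ^ ((j : ℝ) / 2) * ((if z = 2 * k then 1 else 0) - if z = 2 * k + 1 then 1 else 0)

/-- The Haar functions with half-open dyadic intervals. -/
def haarFun (l : WaveletIndex) (x : ℝ) : ℝ := haarProfile l ⌊(2 : ℝ) ^ haarRank l * x⌋

/-- The half-open dyadic interval `[k 2⁻ⁱ, (k+1) 2⁻ⁱ)`. -/
def dyadicCell (i : ℕ) (k : ℤ) : Set ℝ := {x | ⌊(2 : ℝ) ^ i * x⌋ = k}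

lemma dyadicCell_eq_Ico (i : ℕ) (k : ℤ) :
    dyadicCell i k = Set.Ico ((k : ℝ) / 2 ^ i) (((k : ℝ) + 1) / 2 ^ i) := by
  ext x
  have h : (0 : ℝ) < 2 ^ i := by positivity
  simp only [dyadicCell, Set.mem_ofPred_eq, Int.floor_eq_iff, Set.mem_Ico]
  rw [div_le_iff₀ h, lt_div_iff₀ h, mul_comm]

lemma measurableSet_dyadicCell (i : ℕ) (k : ℤ) : MeasurableSet (dyadicCell i k) := by
  rw [dyadicCell_eq_Ico]; exact measurableSet_Ico

lemma volume_dyadicCell (i : ℕ) (k : ℤ) :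
    volume (dyadicCell i k) = ENNReal.ofReal (1 / 2 ^ i) := by
  rw [dyadicCell_eq_Ico, Real.volume_Ico]
  congr 1; ring

lemma volume_dyadicCell_ne_top (i : ℕ) (k : ℤ) : volume (dyadicCell i k) ≠ ∞ := by
  rw [volume_dyadicCell]; exact ENNReal.ofReal_ne_top

lemma ite_floor_eq_indicator (i : ℕ) (k : ℤ) :
    (fun x : ℝ => if ⌊(2 : ℝ) ^ i * x⌋ = k then (1 : ℝ) else 0)
      = (dyadicCell i k).indicator fun _ => 1 := by
  ext x
  by_cases h : ⌊(2 : ℝ) ^ i * x⌋ = k <;> simp [Set.indicator, dyadicCell, h]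

lemma integrable_ite_floor (i : ℕ) (k : ℤ) :
    Integrable (fun x : ℝ => if ⌊(2 : ℝ) ^ i * x⌋ = k then (1 : ℝ) else 0) := by
  rw [ite_floor_eq_indicator]
  exact (integrable_indicator_iff (measurableSet_dyadicCell i k)).2
    (integrableOn_const (volume_dyadicCell_ne_top i k))

lemma integral_ite_floor (i : ℕ) (k : ℤ) :
    ∫ x : ℝ, (if ⌊(2 : ℝ) ^ i * x⌋ = k then (1 : ℝ) else 0) = 1 / 2 ^ i := by
  rw [ite_floor_eq_indicator, integral_indicator_const _ (measurableSet_dyadicCell i k),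
    measureReal_def, volume_dyadicCell, ENNReal.toReal_ofReal (by positivity)]
  simp

lemma floor_two_pow_mul (i m : ℕ) (x : ℝ) :
    ⌊(2 : ℝ) ^ i * x⌋ = ⌊(2 : ℝ) ^ (i + m) * x⌋ / 2 ^ m := by
  have h := Int.cast_mul_floor_div_cancel_of_pos (n := (2 : ℤ) ^ m) (by positivity)
    ((2 : ℝ) ^ i * x)
  rw [← h]
  congr 2
  push_cast
  ring

lemma ae_ne_intCast (i : ℕ) : ∀ᵐ x : ℝ, ∀ z : ℤ, (2 : ℝ) ^ i * x ≠ z := by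
  rw [ae_all_iff]
  intro z
  have : {x : ℝ | ¬ (2 : ℝ) ^ i * x ≠ z} ⊆ {(z : ℝ) / 2 ^ i} := by
    intro x hx
    simp only [ne_eq, not_not, Set.mem_ofPred_eq] at hx
    rw [Set.mem_singleton_iff, eq_div_iff (by positivity), mul_comm, hx]
  exact measure_mono_null this (by simp)

/-- The closed intervals in the definition differ from the half-open dyadic ones only at dyadic
points, a null set. The half-open version is the one that is constant on the cells of a partition.
-/
lemma haar_analysis_ae_eq (l : WaveletIndex) : haar.analysis l =ᵐ[volume] haarFun l := by
  rcases l with k | ⟨j, k⟩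
  · filter_upwards [ae_ne_intCast 0] with x hx
    simp only [pow_zero, one_mul] at hx
    simp only [WaveletSystem.analysis, dilate, father, haarFun, haarProfile, haarRank, pow_zero,
      one_mul, Set.indicator, Set.mem_Icc, Int.floor_eq_iff, Pi.one_apply]
    have h1 := hx (k + 1)
    push_cast at h1
    refine if_congr ⟨fun h => ⟨by linarith [h.1], lt_of_le_of_ne (by linarith [h.2]) h1⟩,
      fun h => ⟨by linarith [h.1], by linarith [h.2]⟩⟩ rfl rfl
  · filter_upwards [ae_ne_intCast (j + 1)] with x hx
    simp only [WaveletSystem.analysis, dilate, haar, haarFun, haarProfile, haarRank,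
      Set.indicator, Set.mem_Icc, Int.floor_eq_iff, Pi.one_apply, Pi.sub_apply]
    have hp : (2 : ℝ) ^ (j + 1) * x = 2 * ((2 : ℝ) ^ j * x) := by ring
    simp only [hp] at hx ⊢
    generalize (2 : ℝ) ^ j * x = y at hx ⊢
    have h1 := hx (2 * k + 1)
    have h2 := hx (2 * k + 2)
    push_cast at h1 h2 ⊢
    congr 2
    · refine if_congr ⟨fun h => ⟨by linarith [h.1], lt_of_le_of_ne (by linarith [h.2]) h1⟩,
        fun h => ⟨by linarith [h.1], by linarith [h.2]⟩⟩ rfl rfl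
    · refine if_congr ⟨fun h => ⟨by linarith [h.1], lt_of_le_of_ne (by linarith [h.2])
        fun h' => h2 (by linarith)⟩, fun h => ⟨by linarith [h.1], by linarith [h.2]⟩⟩ rfl rfl

lemma haar_synthesis_eq : haar.synthesis = haar.analysis := rfl

lemma haarFun_inr (j : ℕ) (k : ℤ) (x : ℝ) : haarFun (Sum.inr (j, k)) x =
    (2 : ℝ) ^ ((j : ℝ) / 2) * ((if ⌊(2 : ℝ) ^ (j + 1) * x⌋ = 2 * k then 1 else 0) -
      if ⌊(2 : ℝ) ^ (j + 1) * x⌋ = 2 * k + 1 then 1 else 0) := rfl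

lemma haarFun_inl (k : ℤ) (x : ℝ) :
    haarFun (Sum.inl k) x = if ⌊(2 : ℝ) ^ 0 * x⌋ = k then 1 else 0 := rfl

lemma two_rpow_half_mul_self (j : ℕ) : (2 : ℝ) ^ ((j : ℝ) / 2) * (2 : ℝ) ^ ((j : ℝ) / 2) = 2 ^ j := by
  rw [← Real.rpow_add two_pos, add_halves, Real.rpow_natCast]

lemma integral_haarFun_inr (j : ℕ) (k : ℤ) : ∫ x, haarFun (Sum.inr (j, k)) x = 0 := by
  simp_rw [haarFun_inr]
  rw [integral_const_mul, integral_sub (integrable_ite_floor _ _) (integrable_ite_floor _ _),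
    integral_ite_floor, integral_ite_floor]
  simp

/-- The coarser function is constant on the dyadic interval carrying the finer one, so the product
is a multiple of a function of mean zero. -/
lemma haarFun_mul_of_rank_le {l : WaveletIndex} {j : ℕ} (k : ℤ) (h : haarRank l ≤ j) :
    ∃ c : ℝ, ∀ x, haarFun l x * haarFun (Sum.inr (j, k)) x = c * haarFun (Sum.inr (j, k)) x := by
  obtain ⟨m, rfl⟩ := Nat.exists_eq_add_of_le h
  refine ⟨haarProfile l (k / 2 ^ m), fun x => ?_⟩
  by_cases hz : haarFun (Sum.inr (haarRank l + m, k)) x = 0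
  · rw [hz, mul_zero, mul_zero]
  · congr 1
    have h1 : ⌊(2 : ℝ) ^ (haarRank l + m) * x⌋ = k := by
      rw [floor_two_pow_mul (haarRank l + m) 1 x]
      rw [haarFun_inr] at hz
      split_ifs at hz with h1 h2 h2
      · rw [h1]; omega
      · rw [h1]; omega
      · rw [h2]; omega
      · simp at hz
    rw [haarFun, floor_two_pow_mul _ m x, h1]

lemma integral_haarFun_mul_of_rank_le {l : WaveletIndex} {j : ℕ} (k : ℤ) (h : haarRank l ≤ j) :
    ∫ x, haarFun l x * haarFun (Sum.inr (j, k)) x = 0 := by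
  obtain ⟨c, hc⟩ := haarFun_mul_of_rank_le k h
  simp_rw [hc]
  rw [integral_const_mul, integral_haarFun_inr, mul_zero]

lemma integral_haarFun_mul (l l' : WaveletIndex) :
    ∫ x, haarFun l x * haarFun l' x = if l = l' then 1 else 0 := by
  rcases l with k | ⟨j, k⟩ <;> rcases l' with k' | ⟨j', k'⟩
  · simp_rw [haarFun_inl]
    by_cases hk : k = k'
    · subst hk
      rw [if_pos rfl]
      have : ∀ x : ℝ, ((if ⌊(2 : ℝ) ^ 0 * x⌋ = k then (1 : ℝ) else 0) *
        if ⌊(2 : ℝ) ^ 0 * x⌋ = k then (1 : ℝ) else 0) =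
        if ⌊(2 : ℝ) ^ 0 * x⌋ = k then (1 : ℝ) else 0 := fun x => by split_ifs <;> simp
      simp_rw [this]
      rw [integral_ite_floor]; simp
    · rw [if_neg (by simpa using hk)]
      refine integral_eq_zero_of_ae (ae_of_all _ fun x => ?_)
      dsimp only [Pi.zero_apply]
      split_ifs <;> first | omega | simp
  · rw [if_neg (by simp)]
    exact integral_haarFun_mul_of_rank_le k' (Nat.zero_le _)
  · rw [if_neg (by simp)]
    refine (integral_congr_ae (ae_of_all _ fun x => mul_comm _ _)).trans ?_
    exact integral_haarFun_mul_of_rank_le k (Nat.zero_le _)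
  · rcases lt_trichotomy j j' with hj | rfl | hj
    · rw [if_neg (by simp [hj.ne])]
      exact integral_haarFun_mul_of_rank_le k' hj
    · by_cases hk : k = k'
      · subst hk
        rw [if_pos rfl]
        have : ∀ x : ℝ, haarFun (Sum.inr (j, k)) x * haarFun (Sum.inr (j, k)) x =
            2 ^ j * ((if ⌊(2 : ℝ) ^ (j + 1) * x⌋ = 2 * k then 1 else 0) +
            if ⌊(2 : ℝ) ^ (j + 1) * x⌋ = 2 * k + 1 then 1 else 0) := fun x => by
          rw [haarFun_inr, mul_mul_mul_comm, two_rpow_half_mul_self]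
          split_ifs <;> first | omega | simp
        simp_rw [this]
        rw [integral_const_mul, integral_add (integrable_ite_floor _ _)
          (integrable_ite_floor _ _), integral_ite_floor, integral_ite_floor, pow_succ]
        field_simp
        norm_num
      · rw [if_neg (by simp [hk])]
        refine integral_eq_zero_of_ae (ae_of_all _ fun x => ?_)
        dsimp only [Pi.zero_apply]
        rw [haarFun_inr, haarFun_inr]
        split_ifs <;> first | omega | simp
    · rw [if_neg (by simp [hj.ne'])]
      refine (integral_congr_ae (ae_of_all _ fun x => mul_comm _ _)).trans ?_
      exact integral_haarFun_mul_of_rank_le k hj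

lemma memLp_haarFun (l : WaveletIndex) : MemLp (haarFun l) 2 volume := by
  have h : ∀ i k, MemLp (fun x : ℝ => if ⌊(2 : ℝ) ^ i * x⌋ = k then (1 : ℝ) else 0) 2 volume :=
    fun i k => by
      rw [ite_floor_eq_indicator]
      exact memLp_indicator_const 2 (measurableSet_dyadicCell i k) 1
        (Or.inr (volume_dyadicCell_ne_top i k))
  rcases l with k | ⟨j, k⟩
  · exact h 0 k
  · exact ((h (j + 1) (2 * k)).sub (h (j + 1) (2 * k + 1))).const_mul _

lemma dyadicCell_succ (i : ℕ) (k : ℤ) :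
    dyadicCell i k = dyadicCell (i + 1) (2 * k) ∪ dyadicCell (i + 1) (2 * k + 1) := by
  ext x
  simp only [dyadicCell, Set.mem_union, Set.mem_ofPred_eq, floor_two_pow_mul i 1 x]
  omega

lemma integral_haarFun_inr_mul {f : ℝ → ℝ} (hf : LocallyIntegrable f) (j : ℕ) (k : ℤ) :
    ∫ x, haarFun (Sum.inr (j, k)) x * f x = (2 : ℝ) ^ ((j : ℝ) / 2) *
      ((∫ x in dyadicCell (j + 1) (2 * k), f x) - ∫ x in dyadicCell (j + 1) (2 * k + 1), f x) := by
  have hint : ∀ i z, IntegrableOn f (dyadicCell i z) := fun i z => by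
    rw [dyadicCell_eq_Ico]
    exact (hf.integrableOn_isCompact isCompact_Icc).mono_set Set.Ico_subset_Icc_self
  have : ∀ x, haarFun (Sum.inr (j, k)) x * f x = (2 : ℝ) ^ ((j : ℝ) / 2) *
      ((dyadicCell (j + 1) (2 * k)).indicator f x -
        (dyadicCell (j + 1) (2 * k + 1)).indicator f x) := fun x => by
    rw [haarFun_inr, mul_assoc]
    congr 1
    by_cases h1 : ⌊(2 : ℝ) ^ (j + 1) * x⌋ = 2 * k <;>
      by_cases h2 : ⌊(2 : ℝ) ^ (j + 1) * x⌋ = 2 * k + 1 <;>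
      simp [Set.indicator, dyadicCell, h1, h2]
  simp_rw [this]
  rw [integral_const_mul, integral_sub, integral_indicator (measurableSet_dyadicCell _ _),
    integral_indicator (measurableSet_dyadicCell _ _)]
  · exact (integrable_indicator_iff (measurableSet_dyadicCell _ _)).2 (hint _ _)
  · exact (integrable_indicator_iff (measurableSet_dyadicCell _ _)).2 (hint _ _)

/-- Induction on the scale: the integrals over the two halves of a cell have sum 0 by induction and
difference 0 by orthogonality to the Haar function of the cell. -/
lemma setIntegral_dyadicCell_eq_zero {f : ℝ → ℝ} (hf : LocallyIntegrable f)
    (h : ∀ l, ∫ x, haarFun l x * f x = 0) (i : ℕ) (k : ℤ) : ∫ x in dyadicCell i k, f x = 0 := by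
  induction i generalizing k with
  | zero =>
    rw [← h (Sum.inl k), ← integral_indicator (measurableSet_dyadicCell _ _)]
    congr 1
    ext x
    rw [haarFun_inl]
    simp [Set.indicator, dyadicCell]
  | succ i ih =>
    have hint : ∀ z, IntegrableOn f (dyadicCell (i + 1) z) := fun z => by
      rw [dyadicCell_eq_Ico]
      exact (hf.integrableOn_isCompact isCompact_Icc).mono_set Set.Ico_subset_Icc_self
    have key : ∀ k, (∫ x in dyadicCell (i + 1) (2 * k), f x) = 0 ∧
        (∫ x in dyadicCell (i + 1) (2 * k + 1), f x) = 0 := by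
      intro k
      have h1 := h (Sum.inr (i, k))
      rw [integral_haarFun_inr_mul hf] at h1
      have h2 := (mul_eq_zero.1 h1).resolve_left (by positivity)
      have h3 := ih k
      rw [dyadicCell_succ, setIntegral_union _ (measurableSet_dyadicCell _ _) (hint _) (hint _)]
        at h3
      · constructor <;> linarith
      · refine Set.disjoint_left.2 fun x hx hx' => ?_
        simp only [dyadicCell, Set.mem_ofPred_eq] at hx hx'
        omega
    rcases Int.even_or_odd' k with ⟨z, rfl | rfl⟩
    · exact (key z).1
    · exact (key z).2

lemma ae_eq_zero_of_integral_haarFun_mul {f : ℝ → ℝ} (hf : LocallyIntegrable f)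
    (h : ∀ l, ∫ x, haarFun l x * f x = 0) : f =ᵐ[volume] 0 := by
  filter_upwards [IsUnifLocDoublingMeasure.ae_tendsto_average (μ := (volume : Measure ℝ)) hf 1]
    with x hx
  -- The dyadic cell around x is, up to an endpoint, a closed ball centred at its midpoint; the
  -- differentiation theorem used allows balls that contain x without being centred there.
  have hlim := hx (l := atTop) (fun i : ℕ => ((⌊(2 : ℝ) ^ i * x⌋ : ℝ) + 1 / 2) / 2 ^ i)
    (fun i => 1 / 2 / 2 ^ i) ?_ ?_
  · refine tendsto_nhds_unique hlim ?_
    refine tendsto_const_nhds.congr fun i => ?_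
    have hball : Metric.closedBall (((⌊(2 : ℝ) ^ i * x⌋ : ℝ) + 1 / 2) / 2 ^ i) (1 / 2 / 2 ^ i)
        =ᵐ[volume] dyadicCell i ⌊(2 : ℝ) ^ i * x⌋ := by
      rw [Real.closedBall_eq_Icc, dyadicCell_eq_Ico]
      have e1 : ((⌊(2 : ℝ) ^ i * x⌋ : ℝ) + 1 / 2) / 2 ^ i - 1 / 2 / 2 ^ i =
        (⌊(2 : ℝ) ^ i * x⌋ : ℝ) / 2 ^ i := by ring
      have e2 : ((⌊(2 : ℝ) ^ i * x⌋ : ℝ) + 1 / 2) / 2 ^ i + 1 / 2 / 2 ^ i =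
        ((⌊(2 : ℝ) ^ i * x⌋ : ℝ) + 1) / 2 ^ i := by ring
      rw [e1, e2]
      exact Ico_ae_eq_Icc.symm
    rw [setAverage_eq, setIntegral_congr_set hball, setIntegral_dyadicCell_eq_zero hf h, smul_zero,
      Pi.zero_apply]
  · refine tendsto_nhdsWithin_iff.2 ⟨?_, Eventually.of_forall fun i => ?_⟩
    · have := (tendsto_pow_atTop_nhds_zero_of_lt_one (r := (1 / 2 : ℝ)) (by norm_num)
        (by norm_num)).const_mul (1 / 2)
      simpa [div_eq_mul_inv] using this
    · simp only [Set.mem_Ioi]; positivity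
  · refine Eventually.of_forall fun i => ?_
    have hp : (0 : ℝ) < 2 ^ i := by positivity
    have h1 := Int.floor_le ((2 : ℝ) ^ i * x)
    have h2 := Int.lt_floor_add_one ((2 : ℝ) ^ i * x)
    rw [one_mul, Metric.mem_closedBall, Real.dist_eq, ← mul_le_mul_iff_of_pos_left hp,
      ← abs_of_pos hp, ← abs_mul, abs_of_pos hp, mul_sub, mul_div_cancel₀ _ hp.ne',
      mul_div_cancel₀ _ hp.ne', abs_le]
    constructor <;> linarith

/-- The system is orthonormal with trivial orthogonal complement, hence a Hilbert basis, and the sum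
of a Hilbert basis expansion converges along finite subsets. -/
theorem haar_isUnconditionalBasis : haar.IsUnconditionalBasis := by
  have hmem : ∀ l, MemLp (haar.analysis l) 2 volume := fun l =>
    (memLp_congr_ae (haar_analysis_ae_eq l)).2 (memLp_haarFun l)
  have hbi : ∀ l l', ∫ x, haar.analysis l x * haar.analysis l' x = if l = l' then 1 else 0 := by
    intro l l'
    rw [← integral_haarFun_mul]
    exact integral_congr_ae ((haar_analysis_ae_eq l).mul (haar_analysis_ae_eq l'))
  set e : WaveletIndex → Lp ℝ 2 (volume : Measure ℝ) := fun l => (hmem l).toLp _ with he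
  have hon : Orthonormal ℝ e := by
    rw [orthonormal_iff_ite]
    intro i j
    rw [he, inner_toLp_eq_integral, hbi]
  have hcoef : ∀ (f : Lp ℝ 2 (volume : Measure ℝ)) l,
      inner ℝ (e l) f = ∫ x, haar.analysis l x * f x := by
    intro f l
    have := inner_toLp_eq_integral (hmem l) (Lp.memLp f)
    rwa [Lp.toLp_coeFn] at this
  have hbot : (Submodule.span ℝ (Set.range e))ᗮ = ⊥ := by
    rw [Submodule.eq_bot_iff]
    intro f hf
    have h0 : ∀ l, ∫ x, haarFun l x * f x = 0 := fun l => by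
      have h1 := (Submodule.mem_orthogonal _ f).1 hf (e l)
        (Submodule.subset_span (Set.mem_range_self l))
      rw [hcoef] at h1
      rw [← h1]
      exact integral_congr_ae ((haar_analysis_ae_eq l).symm.mul (ae_eq_refl _))
    exact (Lp.eq_zero_iff_ae_eq_zero).2
      (ae_eq_zero_of_integral_haarFun_mul ((Lp.memLp f).locallyIntegrable (by norm_num)) h0)
  refine ⟨hmem, hmem, ⟨1, fun l => ?_⟩, hbi, fun f hf => ?_⟩
  · have h1 := hon.1 l
    rw [he, Lp.norm_toLp] at h1
    rw [haar_synthesis_eq, ← ENNReal.ofReal_toReal ((hmem l).2.ne), h1]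
    simp
  · have hb := (HilbertBasis.mkOfOrthogonalEqBot hon hbot).hasSum_repr (hf.toLp f)
    rw [HasSum, SummationFilter.unconditional_filter, tendsto_iff_norm_sub_tendsto_zero] at hb
    have hb2 := ENNReal.tendsto_ofReal hb
    rw [ENNReal.ofReal_zero] at hb2
    refine hb2.congr fun F => ?_
    rw [norm_sub_rev, Lp.norm_def, ENNReal.ofReal_toReal (Lp.eLpNorm_ne_top _)]
    refine eLpNorm_congr_ae ?_
    have hc : ∀ l, (HilbertBasis.mkOfOrthogonalEqBot hon hbot).repr (hf.toLp f) l
        = haar.coeff f l := fun l => by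
      rw [HilbertBasis.repr_apply_apply, HilbertBasis.coe_mkOfOrthogonalEqBot, he,
        inner_toLp_eq_integral]
      rfl
    simp_rw [hc, HilbertBasis.coe_mkOfOrthogonalEqBot]
    filter_upwards [Lp.coeFn_sub (hf.toLp f) (∑ i ∈ F, haar.coeff f i • e i),
      coeFn_finset_sum_toLp hmem F (haar.coeff f), hf.coeFn_toLp] with x h1 h2 h3
    rw [h1, Pi.sub_apply, h2, h3]
    rfl

/-! ## Piecewise constant functions -/

/-- A bounded support step function. -/
structure IsStepAtom (h : ℝ → ℝ) (A : ℕ) : Prop where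
  measurable : Measurable h
  finite_range : (Set.range h).Finite
  abs_le : ∀ x, h x ≠ 0 → |x| ≤ A

lemma IsStepAtom.mono {h : ℝ → ℝ} {A B : ℕ} (hh : IsStepAtom h A) (hAB : A ≤ B) :
    IsStepAtom h B :=
  ⟨hh.measurable, hh.finite_range, fun x hx => (hh.abs_le x hx).trans (by exact_mod_cast hAB)⟩

lemma IsStepAtom.exists_bound {h : ℝ → ℝ} {A : ℕ} (hh : IsStepAtom h A) : ∃ B, ∀ x, |h x| ≤ B := by
  obtain ⟨b, hb⟩ := (hh.finite_range.image abs).bddAbove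
  exact ⟨b, fun x => hb ⟨h x, ⟨x, rfl⟩, rfl⟩⟩

/-- Off the breakpoints the value depends only on how many of them lie to the left. Finiteness of
the range and measurability follow, the count being a monotone function of x. -/
lemma IsPiecewiseConstant.exists_factorization {g : ℝ → ℝ} (hg : IsPiecewiseConstant g) :
    ∃ (S : Finset ℝ) (h : ℕ → ℝ), ∀ x ∉ S, g x = h (S.filter (· < x)).card := by
  classical
  obtain ⟨S, hS⟩ := hg
  have key : ∀ x y, x ∉ S → y ∉ S → x ≤ y →
      (S.filter (· < x)).card = (S.filter (· < y)).card → g x = g y := by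
    intro x y hx hy hxy hc
    refine hS x y hxy fun t ht htxy => ?_
    have h1 : x < t := lt_of_le_of_ne htxy.1 (ne_of_mem_of_not_mem ht hx).symm
    have h2 : t < y := lt_of_le_of_ne htxy.2 (ne_of_mem_of_not_mem ht hy)
    refine (Finset.card_lt_card ?_).ne hc
    rw [Finset.ssubset_iff_of_subset fun s hs => ?_]
    · exact ⟨t, by simp [ht, h2], by simp [h1.le]⟩
    · rw [Finset.mem_filter] at hs ⊢
      exact ⟨hs.1, hs.2.trans_le hxy⟩
  refine ⟨S, fun c => if hc : ∃ x, x ∉ S ∧ (S.filter (· < x)).card = c then g hc.choose else 0,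
    fun x hx => ?_⟩
  have hc : ∃ y, y ∉ S ∧ (S.filter (· < y)).card = (S.filter (· < x)).card := ⟨x, hx, rfl⟩
  dsimp only
  rw [dif_pos hc]
  obtain ⟨h1, h2⟩ := hc.choose_spec
  rcases le_total x hc.choose with h | h
  · exact key _ _ hx h1 h h2.symm
  · exact (key _ _ h1 hx h h2).symm

lemma IsPiecewiseConstant.finite_range {g : ℝ → ℝ} (hg : IsPiecewiseConstant g) :
    (Set.range g).Finite := by
  obtain ⟨S, h, hS⟩ := hg.exists_factorization
  refine ((S.finite_toSet.image g).union ((Finset.range (S.card + 1)).finite_toSet.image h)).subset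
    ?_
  rintro _ ⟨x, rfl⟩
  by_cases hx : x ∈ S
  · exact Or.inl ⟨x, hx, rfl⟩
  · refine Or.inr ⟨_, ?_, (hS x hx).symm⟩
    simp only [Finset.coe_range, Set.mem_Iio]
    exact Nat.lt_succ_of_le (Finset.card_filter_le _ _)

lemma IsPiecewiseConstant.measurable {g : ℝ → ℝ} (hg : IsPiecewiseConstant g) :
    Measurable g := by
  obtain ⟨S, h, hS⟩ := hg.exists_factorization
  have hmono : Monotone fun x : ℝ => (S.filter (· < x)).card := fun x y hxy =>
    Finset.card_le_card fun s hs => by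
      rw [Finset.mem_filter] at hs ⊢
      exact ⟨hs.1, hs.2.trans_le hxy⟩
  have hm : Measurable fun x : ℝ => h (S.filter (· < x)).card :=
    (measurable_of_countable h).comp hmono.measurable
  refine hm.measurable_of_countable_ne ((S.finite_toSet.subset fun x hx => ?_).countable)
  by_contra hxS
  exact hx (hS x hxS).symm

lemma isStepAtom_of_subset_Icc {h : ℝ → ℝ} (hm : Measurable h) (hf : (Set.range h).Finite)
    (hs : ∀ x, x ∉ Set.Icc (0 : ℝ) 1 → h x = 0) : IsStepAtom h 1 := by
  refine ⟨hm, hf, fun x hx => ?_⟩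
  by_contra hc
  refine hx (hs x fun hx' => hc ?_)
  rw [abs_of_nonneg hx'.1]
  simpa using hx'.2

lemma isStepAtom_father : IsStepAtom father 1 := by
  refine isStepAtom_of_subset_Icc (measurable_one.indicator measurableSet_Icc) ?_
    fun x hx => Set.indicator_of_notMem hx _
  refine (Set.toFinite {(0 : ℝ), 1}).subset ?_
  rintro _ ⟨x, rfl⟩
  by_cases hx : x ∈ Set.Icc (0 : ℝ) 1 <;> simp [father, Set.indicator, hx]

lemma isStepAtom_haar_psi : IsStepAtom haar.psi 1 := by
  refine isStepAtom_of_subset_Icc ((measurable_one.indicator measurableSet_Icc).sub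
    (measurable_one.indicator measurableSet_Icc)) ?_ fun x hx => ?_
  · refine (Set.toFinite {(0 : ℝ), 1, -1}).subset ?_
    rintro _ ⟨x, rfl⟩
    by_cases h1 : x ∈ Set.Icc (0 : ℝ) (1 / 2) <;> by_cases h2 : x ∈ Set.Icc (1 / 2 : ℝ) 1 <;>
      simp only [haar, Pi.sub_apply, Set.indicator, h1, h2] <;> simp
  · have h1 : x ∉ Set.Icc (0 : ℝ) (1 / 2) := fun h => hx ⟨h.1, by linarith [h.2]⟩
    have h2 : x ∉ Set.Icc (1 / 2 : ℝ) 1 := fun h => hx ⟨by linarith [h.1], h.2⟩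
    simp only [haar, Pi.sub_apply, Set.indicator, h1, h2]
    simp

/-! ## Dilated and translated functions -/

/-- The function `x ↦ 2^(j/2) h(2^j x - k)`. -/
def atomFun (h : ℝ → ℝ) (j : ℕ) (k : ℤ) : ℝ → ℝ :=
  fun x => (2 : ℝ) ^ ((j : ℝ) / 2) * h ((2 : ℝ) ^ j * x - (k : ℝ))

lemma dilate_inl (g h : ℝ → ℝ) (k : ℤ) : dilate g h (Sum.inl k) = atomFun g 0 k := by
  ext x; simp [dilate, atomFun]

lemma dilate_inr (g h : ℝ → ℝ) (j : ℕ) (k : ℤ) : dilate g h (Sum.inr (j, k)) = atomFun h j k := rfl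

lemma map_dilation (j : ℕ) (k : ℤ) :
    Measure.map (fun x : ℝ => (2 : ℝ) ^ j * x - (k : ℝ)) volume
      = ENNReal.ofReal |((2 : ℝ) ^ j)⁻¹| • (volume : Measure ℝ) := by
  have h : (fun x : ℝ => (2 : ℝ) ^ j * x - (k : ℝ)) = (fun x => x - (k : ℝ)) ∘ fun x => (2 : ℝ) ^ j * x :=
    rfl
  rw [h, ← Measure.map_map (by fun_prop) (by fun_prop), Real.map_volume_mul_left (by positivity),
    Measure.map_smul, map_sub_right_eq_self]

lemma eLpNorm_atomFun {h : ℝ → ℝ} (hh : AEStronglyMeasurable h volume) (p : ℝ≥0∞) (j : ℕ) (k : ℤ) :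
    eLpNorm (atomFun h j k) p volume = ENNReal.ofReal ((2 : ℝ) ^ ((j : ℝ) / 2)) *
      (ENNReal.ofReal |((2 : ℝ) ^ j)⁻¹| ^ (1 / p).toReal * eLpNorm h p volume) := by
  have hc : ENNReal.ofReal |((2 : ℝ) ^ j)⁻¹| ≠ 0 := by
    rw [abs_of_pos (by positivity)]; simp
  have h1 : atomFun h j k =
      (2 : ℝ) ^ ((j : ℝ) / 2) • (h ∘ fun x : ℝ => (2 : ℝ) ^ j * x - (k : ℝ)) := rfl
  rw [h1, eLpNorm_const_smul, ← eLpNorm_map_measure _ (by fun_prop), map_dilation,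
    eLpNorm_smul_measure_of_ne_zero hc, smul_eq_mul, Real.enorm_of_nonneg (by positivity)]
  rw [map_dilation]
  exact hh.mono_ac (Measure.smul_absolutelyContinuous)

lemma measurable_atomFun {h : ℝ → ℝ} (hh : Measurable h) (j : ℕ) (k : ℤ) :
    Measurable (atomFun h j k) :=
  (hh.comp (by fun_prop)).const_mul _

lemma memLp_atomFun {h : ℝ → ℝ} (hh : MemLp h 2 volume) (j : ℕ) (k : ℤ) :
    MemLp (atomFun h j k) 2 volume := by
  refine ⟨?_, ?_⟩
  · have h1 : AEStronglyMeasurable h (Measure.map (fun x : ℝ => (2 : ℝ) ^ j * x - (k : ℝ)) volume) := by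
      rw [map_dilation]
      exact hh.1.mono_ac (Measure.smul_absolutelyContinuous)
    exact (h1.comp_aemeasurable (by fun_prop)).const_mul _
  · rw [eLpNorm_atomFun hh.1]
    refine ENNReal.mul_lt_top ENNReal.ofReal_lt_top (ENNReal.mul_lt_top ?_ hh.2)
    exact ENNReal.rpow_lt_top_of_nonneg ENNReal.toReal_nonneg ENNReal.ofReal_ne_top

lemma eLpNorm_two_atomFun {h : ℝ → ℝ} (hh : AEStronglyMeasurable h volume) (j : ℕ) (k : ℤ) :
    eLpNorm (atomFun h j k) 2 volume = eLpNorm h 2 volume := by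
  rw [eLpNorm_atomFun hh, ← mul_assoc, abs_of_pos (by positivity),
    ENNReal.ofReal_rpow_of_nonneg (by positivity) ENNReal.toReal_nonneg,
    ← ENNReal.ofReal_mul (by positivity)]
  have : (2 : ℝ) ^ ((j : ℝ) / 2) * (((2 : ℝ) ^ j)⁻¹) ^ (1 / (2 : ℝ≥0∞)).toReal = 1 := by
    rw [← Real.rpow_natCast, ← Real.rpow_neg two_pos.le, ← Real.rpow_mul two_pos.le,
      ← Real.rpow_add two_pos]
    simp [div_eq_mul_inv]
  rw [this]; simp

lemma supNorm_atomFun {h : ℝ → ℝ} (hh : Measurable h) (j : ℕ) (k : ℤ) :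
    supNorm (atomFun h j k) = (2 : ℝ) ^ ((j : ℝ) / 2) * supNorm h := by
  rw [supNorm, eLpNorm_atomFun hh.aestronglyMeasurable, ENNReal.toReal_mul,
    ENNReal.toReal_ofReal (by positivity)]
  simp [supNorm]

lemma IsStepAtom.memLp {h : ℝ → ℝ} {A : ℕ} (hh : IsStepAtom h A) (p : ℝ≥0∞) :
    MemLp h p volume := by
  obtain ⟨B, hB⟩ := hh.exists_bound
  have h1 : MemLp ((Set.Icc (-(A : ℝ)) A).indicator fun _ => B) p volume :=
    memLp_indicator_const p measurableSet_Icc B (Or.inr (by simp))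
  refine h1.of_le hh.measurable.aestronglyMeasurable (ae_of_all _ fun x => ?_)
  by_cases hx : h x = 0
  · simp [hx]
  · have : x ∈ Set.Icc (-(A : ℝ)) A := _root_.abs_le.1 (hh.abs_le x hx)
    rw [Set.indicator_of_mem this, Real.norm_eq_abs, Real.norm_eq_abs]
    exact (hB x).trans (le_abs_self B)

/-- The properties of a wavelet system on which the risk bound rests. -/
structure WaveletSystem.IsRegular (Φ : WaveletSystem) (A : ℕ) : Prop where
  basis : Φ.IsUnconditionalBasis
  father : IsStepAtom father A
  psi : IsStepAtom Φ.psi A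

lemma isUnconditionalBasis_of_isStepAtom {Φ : WaveletSystem} {A : ℕ} {r : ℝ}
    (hΦ : Φ.IsBiorthogonalBasis r) (hpsi : IsStepAtom Φ.psi A) : Φ.IsUnconditionalBasis := by
  have h1 : MemLp Φ.dualPhi 2 volume := by
    obtain ⟨m, -, -, hc, -⟩ := hΦ.holder_dualPhi
    exact hc.continuous.memLp_of_hasCompactSupport hΦ.compact_dualPhi
  have h2 : MemLp Φ.dualPsi 2 volume := by
    obtain ⟨m, -, -, hc, -⟩ := hΦ.holder_dualPsi
    exact hc.continuous.memLp_of_hasCompactSupport hΦ.compact_dualPsi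
  refine ⟨fun l => ?_, fun l => ?_, ?_, hΦ.biorthogonal, hΦ.decomposition⟩
  · rcases l with k | ⟨j, k⟩
    · rw [WaveletSystem.analysis, dilate_inl]
      exact memLp_atomFun (isStepAtom_father.memLp 2) _ _
    · exact memLp_atomFun (hpsi.memLp 2) _ _
  · rcases l with k | ⟨j, k⟩
    · rw [WaveletSystem.synthesis, dilate_inl]
      exact memLp_atomFun h1 _ _
    · exact memLp_atomFun h2 _ _
  · refine ⟨(eLpNorm Φ.dualPhi 2 volume).toNNReal + (eLpNorm Φ.dualPsi 2 volume).toNNReal,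
      fun l => ?_⟩
    rw [ENNReal.coe_add, ENNReal.coe_toNNReal h1.2.ne, ENNReal.coe_toNNReal h2.2.ne]
    rcases l with k | ⟨j, k⟩
    · rw [WaveletSystem.synthesis, dilate_inl, eLpNorm_two_atomFun h1.1]
      exact le_self_add
    · rw [WaveletSystem.synthesis, dilate_inr, eLpNorm_two_atomFun h2.1]
      exact le_add_self

theorem WaveletSystem.IsAdmissible.exists_isRegular {Φ : WaveletSystem} {r : ℝ}
    (hΦ : Φ.IsAdmissible r) : ∃ A, Φ.IsRegular A := by
  rcases hΦ with hΦ | ⟨-, rfl⟩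
  · obtain ⟨A, hA⟩ : ∃ A : ℕ, ∀ x, Φ.psi x ≠ 0 → |x| ≤ A := by
      obtain ⟨b, hb⟩ := hΦ.compact_psi.isCompact.isBounded.subset_closedBall 0
      obtain ⟨A, hA⟩ := exists_nat_ge b
      refine ⟨A, fun x hx => ?_⟩
      have := hb (subset_tsupport _ (Function.mem_support.2 hx))
      rw [Metric.mem_closedBall, dist_zero_right, Real.norm_eq_abs] at this
      exact this.trans hA
    have hpsi : IsStepAtom Φ.psi A :=
      ⟨hΦ.piecewise_psi.measurable, hΦ.piecewise_psi.finite_range, hA⟩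
    exact ⟨A + 1, isUnconditionalBasis_of_isStepAtom hΦ hpsi,
      isStepAtom_father.mono (by omega), hpsi.mono (by omega)⟩
  · exact ⟨1, haar_isUnconditionalBasis, isStepAtom_father, isStepAtom_haar_psi⟩

/-- Biorthogonality excludes an analysis function that vanishes almost everywhere; this permits
division by the supremum norm. -/
lemma WaveletSystem.IsUnconditionalBasis.supNorm_analysis_pos {Φ : WaveletSystem}
    (hΦ : Φ.IsUnconditionalBasis) (l : WaveletIndex) (hl : MemLp (Φ.analysis l) ∞ volume) :
    0 < supNorm (Φ.analysis l) := by
  refine ENNReal.toReal_pos (fun h => ?_) hl.2.ne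
  rw [eLpNorm_eq_zero_iff hl.1 (by simp)] at h
  have h1 := hΦ.biorthogonal l l
  rw [if_pos rfl, integral_eq_zero_of_ae] at h1
  · exact zero_ne_one h1
  · filter_upwards [h] with x hx
    simp [hx]

lemma abs_le_supNorm_ae {g : ℝ → ℝ} (hg : eLpNorm g ∞ volume ≠ ∞) :
    ∀ᵐ x, |g x| ≤ supNorm g := by
  filter_upwards [ae_le_eLpNormEssSup (f := g) (μ := volume)] with x hx
  rw [← eLpNorm_exponent_top] at hx
  have := ENNReal.toReal_mono hg hx
  simpa [supNorm] using this

/-! ## The intensity measure -/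

/-- The mean measure `n f(x) dx`. -/
def intensity (n : ℕ) (f : ℝ → ℝ) : Measure ℝ :=
  volume.withDensity fun x => ENNReal.ofReal (n * f x)

lemma intensity_univ_le {f : ℝ → ℝ} {R : ℝ} (hf : f ∈ ballL12Inf R) (n : ℕ) :
    intensity n f Set.univ ≤ ENNReal.ofReal (n * R) := by
  rw [intensity, withDensity_apply _ MeasurableSet.univ, Measure.restrict_univ]
  calc ∫⁻ x, ENNReal.ofReal (n * f x) ≤ ∫⁻ x, ENNReal.ofReal n * ‖f x‖ₑ := by
        refine lintegral_mono fun x => ?_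
        rw [ENNReal.ofReal_mul (by positivity), ← ofReal_norm]
        gcongr
        exact Real.le_norm_self _
    _ = ENNReal.ofReal n * eLpNorm f 1 volume := by
        rw [lintegral_const_mul' _ _ ENNReal.ofReal_ne_top, eLpNorm_one_eq_lintegral_enorm]
    _ ≤ _ := by
        rw [ENNReal.ofReal_mul (by positivity)]
        gcongr
        exact hf.2.1

lemma isFiniteMeasure_intensity {f : ℝ → ℝ} {R : ℝ} (hf : f ∈ ballL12Inf R) (n : ℕ) :
    IsFiniteMeasure (intensity n f) :=
  ⟨(intensity_univ_le hf n).trans_lt ENNReal.ofReal_lt_top⟩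

lemma intensity_le {f : ℝ → ℝ} {R : ℝ} (hf : f ∈ ballL12Inf R) (n : ℕ)
    {M : Set ℝ} (hM : MeasurableSet M) :
    intensity n f M ≤ ENNReal.ofReal (n * R) * volume M := by
  rw [intensity, withDensity_apply _ hM, ← setLIntegral_const]
  refine lintegral_mono_ae (ae_restrict_of_ae ?_)
  filter_upwards [ae_le_eLpNormEssSup (f := f) (μ := volume)] with x hx
  rw [← eLpNorm_exponent_top] at hx
  rw [ENNReal.ofReal_mul (by positivity), ENNReal.ofReal_mul (by positivity)]
  refine mul_le_mul_right ?_ _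
  calc ENNReal.ofReal (f x) ≤ ‖f x‖ₑ := by
        rw [← ofReal_norm]
        exact ENNReal.ofReal_le_ofReal (Real.le_norm_self _)
    _ ≤ _ := hx.trans hf.2.2.2

lemma integral_intensity {f : ℝ → ℝ} (hf : AEStronglyMeasurable f volume) (hf0 : 0 ≤ᵐ[volume] f)
    (n : ℕ) (g : ℝ → ℝ) : ∫ x, g x ∂(intensity n f) = n * ∫ x, g x * f x := by
  rw [intensity, integral_withDensity_eq_integral_toReal_smul₀
    (hf.aemeasurable.const_mul _).ennreal_ofReal (ae_of_all _ fun _ => ENNReal.ofReal_lt_top),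
    ← integral_const_mul]
  refine integral_congr_ae ?_
  filter_upwards [hf0] with x hx
  rw [ENNReal.toReal_ofReal (mul_nonneg (by positivity) hx), smul_eq_mul]
  ring

/-! ## Variance bounds -/

/-- Bounded overlap: k must be an integer in an interval of length 2A around 2^j x. -/
lemma tsum_indicator_atomFun_ne_zero_le {h : ℝ → ℝ} {A : ℕ} (hh : IsStepAtom h A) (j : ℕ) (x : ℝ) :
    ∑' k : ℤ, {x | atomFun h j k x ≠ 0}.indicator (fun _ => (1 : ℝ≥0∞)) x
      ≤ ENNReal.ofReal (2 * A + 1) := by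
  classical
  set y := (2 : ℝ) ^ j * x
  have hsupp : ∀ k : ℤ, k ∉ Finset.Icc ⌈y - A⌉ ⌊y + A⌋ →
      {x | atomFun h j k x ≠ 0}.indicator (fun _ => (1 : ℝ≥0∞)) x = 0 := by
    intro k hk
    refine Set.indicator_of_notMem (fun hx => hk ?_) _
    have h1 : h (y - k) ≠ 0 := right_ne_zero_of_mul hx
    have h2 := _root_.abs_le.1 (hh.abs_le _ h1)
    rw [Finset.mem_Icc, Int.ceil_le, Int.le_floor]
    constructor <;> linarith [h2.1, h2.2]
  rw [tsum_eq_sum hsupp]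
  calc _ ≤ ∑ k ∈ Finset.Icc ⌈y - A⌉ ⌊y + A⌋, (1 : ℝ≥0∞) :=
        Finset.sum_le_sum fun k _ => Set.indicator_le_self' (fun _ _ => zero_le) x
    _ = ENNReal.ofReal ((⌊y + A⌋ + 1 - ⌈y - A⌉).toNat : ℝ) := by
        simp
    _ ≤ _ := by
        apply ENNReal.ofReal_le_ofReal
        have h1 := Int.floor_le (y + A)
        have h2 := Int.le_ceil (y - A)
        have h3 : (⌊y + A⌋ + 1 - ⌈y - A⌉ : ℤ) ≤ 2 * A + 1 := by
          have : ((⌊y + A⌋ + 1 - ⌈y - A⌉ : ℤ) : ℝ) ≤ ((2 * A + 1 : ℤ) : ℝ) := by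
            push_cast; linarith
          exact_mod_cast this
        have h4 : (⌊y + A⌋ + 1 - ⌈y - A⌉).toNat ≤ 2 * A + 1 := by omega
        exact_mod_cast h4

lemma tsum_intensity_atomFun_le {h : ℝ → ℝ} {A : ℕ} (hh : IsStepAtom h A) {f : ℝ → ℝ} {R : ℝ}
    (hf : f ∈ ballL12Inf R) (n j : ℕ) :
    ∑' k : ℤ, intensity n f {x | atomFun h j k x ≠ 0}
      ≤ ENNReal.ofReal (2 * A + 1) * ENNReal.ofReal (n * R) := by
  have hM : ∀ k : ℤ, MeasurableSet {x | atomFun h j k x ≠ 0} := fun k =>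
    measurable_atomFun hh.measurable j k (measurableSet_singleton 0).compl
  calc _ = ∑' k : ℤ, ∫⁻ x, {x | atomFun h j k x ≠ 0}.indicator (fun _ => (1 : ℝ≥0∞)) x
          ∂(intensity n f) := by
        refine tsum_congr fun k => ?_
        rw [lintegral_indicator_const (hM k), one_mul]
    _ = ∫⁻ x, ∑' k : ℤ, {x | atomFun h j k x ≠ 0}.indicator (fun _ => (1 : ℝ≥0∞)) x
          ∂(intensity n f) := by
        rw [lintegral_tsum]
        exact fun k => (measurable_const.indicator (hM k)).aemeasurable
    _ ≤ ∫⁻ _, ENNReal.ofReal (2 * A + 1) ∂(intensity n f) :=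
        lintegral_mono fun x => tsum_indicator_atomFun_ne_zero_le hh j x
    _ ≤ _ := by
        rw [lintegral_const]
        gcongr
        exact intensity_univ_le hf n

lemma intensity_atomFun_le {h : ℝ → ℝ} {A : ℕ} (hh : IsStepAtom h A) {f : ℝ → ℝ} {R : ℝ}
    (hf : f ∈ ballL12Inf R) (n j : ℕ) (k : ℤ) :
    intensity n f {x | atomFun h j k x ≠ 0}
      ≤ ENNReal.ofReal (n * R) * ENNReal.ofReal (2 * A / 2 ^ j) := by
  have hM : MeasurableSet {x | atomFun h j k x ≠ 0} :=
    measurable_atomFun hh.measurable j k (measurableSet_singleton 0).compl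
  refine (intensity_le hf n hM).trans ?_
  gcongr
  have hsub : {x | atomFun h j k x ≠ 0} ⊆
      Set.Icc (((k : ℝ) - A) / 2 ^ j) (((k : ℝ) + A) / 2 ^ j) := by
    intro x hx
    have h1 : h ((2 : ℝ) ^ j * x - k) ≠ 0 := right_ne_zero_of_mul hx
    have h2 := _root_.abs_le.1 (hh.abs_le _ h1)
    have hp : (0 : ℝ) < 2 ^ j := by positivity
    rw [Set.mem_Icc, div_le_iff₀ hp, le_div_iff₀ hp]
    constructor <;> linarith [h2.1, h2.2]
  refine (measure_mono hsub).trans (le_of_eq ?_)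
  rw [Real.volume_Icc]
  congr 1; ring

/-- An upper bound of the variance of an empirical coefficient. -/
def varBound (g : ℝ → ℝ) (n : ℕ) (f : ℝ → ℝ) : ℝ :=
  (supNorm g / n) ^ 2 * (intensity n f).real {x | g x ≠ 0}

lemma varBound_nonneg (g : ℝ → ℝ) (n : ℕ) (f : ℝ → ℝ) : 0 ≤ varBound g n f := by
  unfold varBound; positivity

lemma sq_supNorm_atomFun {h : ℝ → ℝ} (hh : Measurable h) (j : ℕ) (k : ℤ) :
    supNorm (atomFun h j k) ^ 2 = 2 ^ j * supNorm h ^ 2 := by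
  rw [supNorm_atomFun hh, mul_pow, sq ((2 : ℝ) ^ ((j : ℝ) / 2)), two_rpow_half_mul_self]

/-- The factor 2^j of the squared supremum norm cancels against the length 2A/2^j of the support, so
the bound is uniform in the level. The larger constant 2A + 1 is shared with the bound of the sum
over k. -/
lemma varBound_atomFun_le {h : ℝ → ℝ} {A : ℕ} (hh : IsStepAtom h A) {f : ℝ → ℝ} {R : ℝ}
    (hR : 0 ≤ R) (hf : f ∈ ballL12Inf R) {n : ℕ} (hn : 0 < n) (j : ℕ) (k : ℤ) :
    varBound (atomFun h j k) n f ≤ supNorm h ^ 2 * (2 * A + 1) * R / n := by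
  have hn' : (0 : ℝ) < n := by exact_mod_cast hn
  have h1 := intensity_atomFun_le hh hf n j k
  rw [← ENNReal.ofReal_mul (by positivity)] at h1
  have h2 : (intensity n f).real {x | atomFun h j k x ≠ 0} ≤ n * R * (2 * A / 2 ^ j) :=
    ENNReal.toReal_le_of_le_ofReal (by positivity) h1
  rw [varBound, div_pow, sq_supNorm_atomFun hh.measurable]
  calc _ ≤ 2 ^ j * supNorm h ^ 2 / n ^ 2 * (n * R * (2 * A / 2 ^ j)) := by gcongr
    _ = supNorm h ^ 2 * (2 * A) * R / n := by field_simp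
    _ ≤ _ := by gcongr; linarith

/-- Bounded overlap lets the masses of the supports add up to at most 2A + 1 times the total mass
nR; here the factor 2^j remains. -/
lemma tsum_varBound_atomFun_le {h : ℝ → ℝ} {A : ℕ} (hh : IsStepAtom h A) {f : ℝ → ℝ} {R : ℝ}
    (hf : f ∈ ballL12Inf R) {n : ℕ} (hn : 0 < n) (j : ℕ) :
    ∑' k : ℤ, ENNReal.ofReal (varBound (atomFun h j k) n f)
      ≤ ENNReal.ofReal (supNorm h ^ 2 * (2 * A + 1) * R / n * 2 ^ j) := by
  have hn' : (0 : ℝ) < n := by exact_mod_cast hn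
  have := isFiniteMeasure_intensity hf n
  have h1 : ∀ k : ℤ, ENNReal.ofReal (varBound (atomFun h j k) n f) =
      ENNReal.ofReal (2 ^ j * supNorm h ^ 2 / n ^ 2) *
        intensity n f {x | atomFun h j k x ≠ 0} := by
    intro k
    rw [varBound, div_pow, sq_supNorm_atomFun hh.measurable, ENNReal.ofReal_mul (by positivity),
      ofReal_measureReal]
  simp_rw [h1]
  rw [ENNReal.tsum_mul_left]
  calc _ ≤ ENNReal.ofReal (2 ^ j * supNorm h ^ 2 / n ^ 2) *
        (ENNReal.ofReal (2 * A + 1) * ENNReal.ofReal (n * R)) := by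
        gcongr
        exact tsum_intensity_atomFun_le hh hf n j
    _ = _ := by
        rw [← ENNReal.ofReal_mul (by positivity), ← ENNReal.ofReal_mul (by positivity)]
        congr 1
        field_simp

/-! ## The risk of a single thresholded coefficient of the estimator -/

lemma WaveletSystem.IsRegular.measurable_analysis {Φ : WaveletSystem} {A : ℕ}
    (hΦ : Φ.IsRegular A) (l : WaveletIndex) : Measurable (Φ.analysis l) := by
  rcases l with k | ⟨j, k⟩
  · rw [WaveletSystem.analysis, dilate_inl]
    exact measurable_atomFun hΦ.father.measurable _ _
  · exact measurable_atomFun hΦ.psi.measurable _ _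

lemma finite_range_atomFun {h : ℝ → ℝ} (hh : (Set.range h).Finite) (j : ℕ) (k : ℤ) :
    (Set.range (atomFun h j k)).Finite := by
  refine (hh.image fun y => (2 : ℝ) ^ ((j : ℝ) / 2) * y).subset ?_
  rintro _ ⟨x, rfl⟩
  exact ⟨_, ⟨_, rfl⟩, rfl⟩

lemma WaveletSystem.IsRegular.finite_range_analysis {Φ : WaveletSystem} {A : ℕ}
    (hΦ : Φ.IsRegular A) (l : WaveletIndex) : (Set.range (Φ.analysis l)).Finite := by
  rcases l with k | ⟨j, k⟩
  · rw [WaveletSystem.analysis, dilate_inl]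
    exact finite_range_atomFun hΦ.father.finite_range _ _
  · exact finite_range_atomFun hΦ.psi.finite_range _ _

lemma eLpNorm_top_ne_top_of_finite_range {g : ℝ → ℝ} (hg : (Set.range g).Finite) :
    eLpNorm g ∞ volume ≠ ∞ := by
  obtain ⟨b, hb⟩ := (hg.image abs).bddAbove
  refine ((eLpNorm_le_of_ae_bound (C := b) (ae_of_all _ fun x => ?_)).trans_lt ?_).ne
  · exact hb ⟨g x, ⟨x, rfl⟩, rfl⟩
  · simp

lemma WaveletSystem.IsRegular.supNorm_analysis_pos {Φ : WaveletSystem} {A : ℕ}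
    (hΦ : Φ.IsRegular A) (l : WaveletIndex) : 0 < supNorm (Φ.analysis l) :=
  hΦ.basis.supNorm_analysis_pos l ⟨(hΦ.measurable_analysis l).aestronglyMeasurable,
    (eLpNorm_top_ne_top_of_finite_range (hΦ.finite_range_analysis l)).lt_top⟩

/-- `supNorm` is an essential supremum and may be exceeded at breakpoints, while the points of the
process are arbitrary reals. The ratio of the two suprema is unchanged by dilation and translation,
so one ρ serves every index. -/
lemma exists_abs_atomFun_le {h : ℝ → ℝ} {A : ℕ} (hh : IsStepAtom h A) (hs : 0 < supNorm h) :
    ∃ ρ : ℝ, ∀ j k x, |atomFun h j k x| ≤ ρ * supNorm (atomFun h j k) := by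
  obtain ⟨B, hB⟩ := hh.exists_bound
  refine ⟨B / supNorm h, fun j k x => ?_⟩
  rw [supNorm_atomFun hh.measurable, atomFun, abs_mul, abs_of_pos (by positivity)]
  calc _ ≤ (2 : ℝ) ^ ((j : ℝ) / 2) * B := by gcongr; exact hB _
    _ = _ := by field_simp

lemma WaveletSystem.IsRegular.exists_abs_analysis_le {Φ : WaveletSystem} {A : ℕ}
    (hΦ : Φ.IsRegular A) :
    ∃ ρ : ℝ, ∀ l x, |Φ.analysis l x| ≤ ρ * supNorm (Φ.analysis l) := by
  have h1 : 0 < supNorm PoissonWavelet.father := by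
    have := hΦ.supNorm_analysis_pos (Sum.inl 0)
    rw [WaveletSystem.analysis, dilate_inl, supNorm_atomFun hΦ.father.measurable] at this
    simpa using this
  have h2 : 0 < supNorm Φ.psi := by
    have := hΦ.supNorm_analysis_pos (Sum.inr (0, 0))
    rw [WaveletSystem.analysis, dilate_inr, supNorm_atomFun hΦ.psi.measurable] at this
    simpa using this
  obtain ⟨ρ₁, hρ₁⟩ := exists_abs_atomFun_le hΦ.father h1
  obtain ⟨ρ₂, hρ₂⟩ := exists_abs_atomFun_le hΦ.psi h2
  refine ⟨max ρ₁ ρ₂, fun l x => ?_⟩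
  have hs := (hΦ.supNorm_analysis_pos l).le
  rcases l with k | ⟨j, k⟩
  · rw [WaveletSystem.analysis, dilate_inl] at hs ⊢
    exact (hρ₁ 0 k x).trans (by gcongr; exact le_max_left _ _)
  · exact (hρ₂ j k x).trans (by
      refine mul_le_mul_of_nonneg_right (le_max_right _ _) hs)

/-- The threshold is homogeneous: with s the supremum norm, empirical coefficient and threshold both
scale by s/n, so the comparison between them is that of the normalised function. -/
lemma thrCoeff_eq_mul_thresholdedSum {Φ : WaveletSystem} {l : WaveletIndex}
    (hs : 0 < supNorm (Φ.analysis l)) {γ : ℝ} {n : ℕ} (hn : 0 < n) {j₀ : ℤ} (hl : l.level ≤ j₀)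
    (S : Set ℝ) :
    thrCoeff Φ γ n j₀ S l = supNorm (Φ.analysis l) / n *
      thresholdedSum (γ * Real.log n) S fun x => (supNorm (Φ.analysis l))⁻¹ * Φ.analysis l x := by
  have hn' : (0 : ℝ) < n := by exact_mod_cast hn
  set s := supNorm (Φ.analysis l) with hsdef
  set g : ℝ → ℝ := fun x => s⁻¹ * Φ.analysis l x with hg
  have hX : empCoeff Φ n S l = s / n * pointSum S g := by
    rw [empCoeff, hg, pointSum_const_mul]
    field_simp
  have hU : empVar Φ n S l = (s / n) ^ 2 * pointSum S fun x => g x ^ 2 := by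
    have : (fun x => g x ^ 2) = fun x => s⁻¹ ^ 2 * Φ.analysis l x ^ 2 := by
      ext x; rw [hg, mul_pow]
    rw [empVar, this, pointSum_const_mul]
    field_simp
  have hW : overVar Φ γ n S l = (s / n) ^ 2 * ((pointSum S fun x => g x ^ 2) +
      √(2 * (γ * Real.log n) * pointSum S fun x => g x ^ 2) + 3 * (γ * Real.log n)) := by
    have h1 : 2 * γ * Real.log n * ((s / n) ^ 2 * pointSum S fun x => g x ^ 2) * (s ^ 2 / n ^ 2)
        = ((s / n) ^ 2) ^ 2 * (2 * (γ * Real.log n) * pointSum S fun x => g x ^ 2) := by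
      field_simp
    rw [overVar, hU, ← hsdef, h1, Real.sqrt_mul (by positivity), Real.sqrt_sq (by positivity)]
    field_simp
  have hT : threshold Φ γ n S l =
      s / n * unitThreshold (γ * Real.log n) (pointSum S fun x => g x ^ 2) := by
    have h1 : ∀ W : ℝ, 2 * γ * ((s / n) ^ 2 * W) * Real.log n
        = (s / n) ^ 2 * (2 * (γ * Real.log n) * W) := fun W => by ring
    rw [threshold, hW, h1, Real.sqrt_mul (by positivity), Real.sqrt_sq (by positivity),
      unitThreshold, ← hsdef]
    field_simp
  have hsn : 0 < s / n := by positivity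
  rw [thrCoeff, thresholdedSum, hT, hX, abs_mul, abs_of_pos hsn]
  simp only [mul_le_mul_iff_right₀ hsn, hl, and_true]
  split_ifs <;> simp

/-- The risk of a thresholded empirical coefficient. -/
theorem WaveletSystem.IsRegular.exists_coefficient_risk_le {Φ : WaveletSystem} {A : ℕ}
    (hΦ : Φ.IsRegular A) {c γ : ℝ} (hc : 0 < c) (hγ : c < γ) :
    ∃ C : ℝ, 0 ≤ C ∧ ∀ {Ω : Type*} [MeasurableSpace Ω] {P : Measure Ω} [IsProbabilityMeasure P]
      {N : Ω → Set ℝ} {f : ℝ → ℝ} {R : ℝ} {n : ℕ} {j₀ : ℤ}, f ∈ ballL12Inf R → 0 ≤ᵐ[volume] f →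
      2 ≤ n → IsPoissonProcess N P (intensity n f) → ∀ l : WaveletIndex, l.level ≤ j₀ →
      AEMeasurable (fun ω => thrCoeff Φ γ n j₀ (N ω) l) P ∧
      ∫⁻ ω, ENNReal.ofReal ((thrCoeff Φ γ n j₀ (N ω) l - Φ.coeff f l) ^ 2) ∂P
        ≤ ENNReal.ofReal (C * (min (Φ.coeff f l ^ 2)
            (varBound (Φ.analysis l) n f * (γ * Real.log n)) +
          (varBound (Φ.analysis l) n f + Φ.coeff f l ^ 2) * (n : ℝ) ^ (-c))) := by
  obtain ⟨ρ, hρ⟩ := hΦ.exists_abs_analysis_le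
  have hγ0 : 0 < γ := hc.trans hγ
  obtain ⟨C, hC0, hC⟩ := exists_lintegral_thresholdedSum_le (θ := c / γ) (ρ := ρ)
    (u₀ := γ * Real.log 2) (by positivity) (by rwa [div_lt_one hγ0])
    (mul_pos hγ0 (Real.log_pos (by norm_num)))
  refine ⟨C, hC0, ?_⟩
  intro Ω _ P _ N f R n j₀ hf hf0 hn hN l hl
  have := isFiniteMeasure_intensity hf n
  have hn' : (0 : ℝ) < n := by positivity
  set s := supNorm (Φ.analysis l) with hsdef
  have hs : 0 < s := hΦ.supNorm_analysis_pos l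
  have hsn : 0 < s / n := by positivity
  set g : ℝ → ℝ := fun x => s⁻¹ * Φ.analysis l x with hg
  have hgm : Measurable g := (hΦ.measurable_analysis l).const_mul _
  have hgf : (Set.range g).Finite := finite_range_comp (hΦ.finite_range_analysis l) fun y => s⁻¹ * y
  have habs : ∀ x, |g x| = s⁻¹ * |Φ.analysis l x| := fun x => by
    rw [hg, abs_mul, abs_of_pos (by positivity)]
  have hg1 : ∀ᵐ x ∂(intensity n f), |g x| ≤ 1 := by
    refine (withDensity_absolutelyContinuous _ _).ae_le ?_
    filter_upwards [abs_le_supNorm_ae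
      (eLpNorm_top_ne_top_of_finite_range (hΦ.finite_range_analysis l))] with x hx
    rw [habs, inv_mul_le_one₀ hs]
    exact hx
  have hgρ : ∀ x, |g x| ≤ ρ := fun x => by
    rw [habs, inv_mul_le_iff₀ hs, mul_comm]
    exact hρ l x
  have hu : γ * Real.log 2 ≤ γ * Real.log n := by
    gcongr
    exact_mod_cast hn
  have hcoef : Φ.coeff f l = s / n * ∫ x, g x ∂(intensity n f) := by
    rw [integral_intensity hf.1 hf0, WaveletSystem.coeff]
    simp_rw [hg, mul_assoc]
    rw [integral_const_mul]
    field_simp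
  have hsupp : {x | g x ≠ 0} = {x | Φ.analysis l x ≠ 0} := by
    ext x; simp [hg, hs.ne']
  -- With θ = c/γ and u = γ log n the exponential remainder is exactly n^(-c).
  have hexp : Real.exp (-(c / γ * (γ * Real.log n))) = (n : ℝ) ^ (-c) := by
    rw [Real.rpow_def_of_pos hn']
    congr 1
    field_simp
  have hthr := fun S => thrCoeff_eq_mul_thresholdedSum (γ := γ) hs (by omega : 0 < n) hl S
  constructor
  · simp_rw [hthr]
    refine AEMeasurable.const_mul ?_ _
    have hX := hN.aemeasurable_pointSum hgm hgf
    have hU := hN.aemeasurable_pointSum (hgm.pow_const 2) (finite_range_comp hgf fun y => y ^ 2)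
    have hthrm : Measurable fun z : ℝ × ℝ =>
        if unitThreshold (γ * Real.log n) z.2 ≤ |z.1| then z.1 else 0 := by
      have : Measurable (unitThreshold (γ * Real.log n)) := by unfold unitThreshold; fun_prop
      exact Measurable.ite (measurableSet_le (this.comp measurable_snd) (by fun_prop))
        measurable_fst measurable_const
    exact hthrm.comp_aemeasurable (hX.prodMk hU)
  · have h := hC hN hgm hgf hg1 hgρ _ hu
    rw [hexp, hsupp] at h
    have h1 : ∀ ω, ENNReal.ofReal ((thrCoeff Φ γ n j₀ (N ω) l - Φ.coeff f l) ^ 2) =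
        ENNReal.ofReal ((s / n) ^ 2) * ENNReal.ofReal
          ((thresholdedSum (γ * Real.log n) (N ω) g - ∫ x, g x ∂(intensity n f)) ^ 2) := fun ω => by
      rw [hthr, hcoef, ← mul_sub, mul_pow, ENNReal.ofReal_mul (by positivity)]
    simp_rw [h1]
    rw [lintegral_const_mul' _ _ ENNReal.ofReal_ne_top]
    refine (mul_le_mul_right h _).trans (le_of_eq ?_)
    rw [← ENNReal.ofReal_mul (by positivity), hcoef, varBound, ← hsdef]
    congr 1
    rw [mul_pow, mul_assoc ((s / n) ^ 2) (Measure.real _ _), ← mul_min_of_nonneg _ _ (sq_nonneg _)]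
    ring

/-! ## Besov balls -/

lemma le_of_ellNorm_le {ι : Type*} {p : ℝ≥0∞} (hp : 1 ≤ p) {a : ι → ℝ≥0∞} {X : ℝ≥0∞}
    (h : ellNorm p a ≤ X) (i : ι) : a i ≤ X := by
  rw [ellNorm] at h
  split_ifs at h with hp'
  · exact (le_iSup a i).trans h
  · have hp0 : 0 < p.toReal := ENNReal.toReal_pos (by positivity) hp'
    refine le_trans ?_ h
    rw [one_div, ENNReal.le_rpow_inv_iff hp0]
    exact ENNReal.le_tsum (f := fun i => a i ^ p.toReal) i

lemma tsum_rpow_le_of_ellNorm_le {ι : Type*} {p : ℝ} (hp : 1 ≤ p) {a : ι → ℝ≥0∞} {X : ℝ≥0∞}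
    (h : ellNorm (ENNReal.ofReal p) a ≤ X) : ∑' i, a i ^ p ≤ X ^ p := by
  have hp0 : 0 < p := by linarith
  rw [ellNorm, if_neg ENNReal.ofReal_ne_top, ENNReal.toReal_ofReal hp0.le, one_div,
    ENNReal.rpow_inv_le_iff hp0] at h
  exact h

/-- Every term is at most the ℓ_p norm, so a² ≤ a^p X^(2-p); this is the inclusion of ℓ_p in ℓ_2. -/
lemma tsum_sq_le_of_ellNorm_le {ι : Type*} {p : ℝ} (hp : 1 ≤ p) (hp2 : p ≤ 2) {a : ι → ℝ≥0∞}
    {X : ℝ≥0∞} (h : ellNorm (ENNReal.ofReal p) a ≤ X) : ∑' i, a i ^ 2 ≤ X ^ 2 := by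
  have hp' : (1 : ℝ≥0∞) ≤ ENNReal.ofReal p := by simpa using hp
  have hsplit : ∀ z : ℝ≥0∞, z ^ 2 = z ^ p * z ^ (2 - p) := fun z => by
    rw [← ENNReal.rpow_add_of_nonneg _ _ (by linarith) (by linarith), add_sub_cancel]
    simp
  calc ∑' i, a i ^ 2 = ∑' i, a i ^ p * a i ^ (2 - p) := tsum_congr fun i => hsplit _
    _ ≤ ∑' i, a i ^ p * X ^ (2 - p) := by
        refine ENNReal.tsum_le_tsum fun i => ?_
        exact mul_le_mul_right
          (ENNReal.rpow_le_rpow (le_of_ellNorm_le hp' h i) (by linarith)) _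
    _ = (∑' i, a i ^ p) * X ^ (2 - p) := ENNReal.tsum_mul_right
    _ ≤ X ^ p * X ^ (2 - p) := by
        gcongr
        exact tsum_rpow_le_of_ellNorm_le hp h
    _ = X ^ 2 := (hsplit X).symm

lemma ellNorm_father_le_of_mem_besovBall {Φ : WaveletSystem} {α R : ℝ} {p q : ℝ≥0∞} {f : ℝ → ℝ}
    (hf : f ∈ besovBall Φ α p q R) :
    ellNorm p (fun k : ℤ => ENNReal.ofReal |Φ.coeff f (Sum.inl k)|) ≤ ENNReal.ofReal R :=
  le_self_add.trans hf

/-- Only the supremum over the levels is retained from the ℓ_q norm, which makes the constants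
independent of q. -/
lemma ellNorm_level_le_of_mem_besovBall {Φ : WaveletSystem} {α R p : ℝ} (hp : 1 ≤ p)
    {q : ℝ≥0∞} (hq : 1 ≤ q) {f : ℝ → ℝ} (hf : f ∈ besovBall Φ α (ENNReal.ofReal p) q R) (j : ℕ) :
    ellNorm (ENNReal.ofReal p) (fun k : ℤ => ENNReal.ofReal |Φ.coeff f (Sum.inr (j, k))|)
      ≤ ENNReal.ofReal (R * (2 : ℝ) ^ (-((j : ℝ) * (α + 1 / 2 - 1 / p)))) := by
  have h := le_of_ellNorm_le hq (le_add_self.trans hf) j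
  rw [ENNReal.toReal_ofReal (by linarith)] at h
  rw [Real.rpow_neg two_pos.le, ENNReal.ofReal_mul' (by positivity),
    ENNReal.ofReal_inv_of_pos (by positivity), ← div_eq_mul_inv,
    ENNReal.le_div_iff_mul_le (Or.inl (by simp; positivity)) (Or.inl ENNReal.ofReal_ne_top),
    mul_comm]
  exact h

lemma ofReal_abs_sq (x : ℝ) : ENNReal.ofReal |x| ^ 2 = ENNReal.ofReal (x ^ 2) := by
  rw [← ENNReal.ofReal_pow (abs_nonneg _), sq_abs]

/-- The minimum is below any weighted geometric mean of its arguments; the weight p/2 on x² produces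
the summable power |x|^p. -/
lemma min_sq_le_rpow {x w p : ℝ} (hw : 0 ≤ w) (hp : 0 ≤ p) (hp2 : p ≤ 2) :
    min (x ^ 2) w ≤ |x| ^ p * w ^ (1 - p / 2) := by
  have hm : 0 ≤ min (x ^ 2) w := le_min (sq_nonneg _) hw
  calc min (x ^ 2) w = min (x ^ 2) w ^ (p / 2) * min (x ^ 2) w ^ (1 - p / 2) := by
        rw [← Real.rpow_add_of_nonneg hm (by linarith) (by linarith)]
        simp
    _ ≤ (x ^ 2) ^ (p / 2) * w ^ (1 - p / 2) := by
        gcongr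
        · exact min_le_left _ _
        · linarith
        · exact min_le_right _ _
    _ = _ := by
        rw [← sq_abs, ← Real.rpow_natCast, ← Real.rpow_mul (abs_nonneg _)]
        congr 2
        push_cast; ring

lemma tsum_min_sq_le {ι : Type*} {p : ℝ} (hp : 1 ≤ p) (hp2 : p ≤ 2) {b v : ι → ℝ} {X w : ℝ}
    (hX : 0 ≤ X) (hw : 0 ≤ w) (hvw : ∀ i, v i ≤ w)
    (h : ellNorm (ENNReal.ofReal p) (fun i => ENNReal.ofReal |b i|) ≤ ENNReal.ofReal X) :
    ∑' i, ENNReal.ofReal (min (b i ^ 2) (v i)) ≤ ENNReal.ofReal (X ^ p * w ^ (1 - p / 2)) := by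
  have hp0 : 0 ≤ p := by linarith
  calc _ ≤ ∑' i, ENNReal.ofReal |b i| ^ p * ENNReal.ofReal (w ^ (1 - p / 2)) := by
        refine ENNReal.tsum_le_tsum fun i => ?_
        rw [ENNReal.ofReal_rpow_of_nonneg (abs_nonneg _) hp0, ← ENNReal.ofReal_mul (by positivity)]
        exact ENNReal.ofReal_le_ofReal
          ((min_le_min_left _ (hvw i)).trans (min_sq_le_rpow hw hp0 hp2))
    _ = (∑' i, ENNReal.ofReal |b i| ^ p) * ENNReal.ofReal (w ^ (1 - p / 2)) :=
        ENNReal.tsum_mul_right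
    _ ≤ ENNReal.ofReal X ^ p * ENNReal.ofReal (w ^ (1 - p / 2)) := by
        gcongr
        exact tsum_rpow_le_of_ellNorm_le hp h
    _ = _ := by
        rw [ENNReal.ofReal_rpow_of_nonneg hX hp0, ← ENNReal.ofReal_mul (by positivity)]

/-! ## Geometric sums -/

lemma tsum_ofReal_geometric {a q : ℝ} (ha : 0 ≤ a) (hq : 0 ≤ q) (hq1 : q < 1) :
    ∑' i : ℕ, ENNReal.ofReal (a * q ^ i) = ENNReal.ofReal (a / (1 - q)) := by
  rw [← ENNReal.ofReal_tsum_of_nonneg (fun i => by positivity)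
    ((summable_geometric_of_lt_one hq hq1).mul_left a), tsum_mul_left,
    tsum_geometric_of_lt_one hq hq1, div_eq_mul_inv]

lemma tsum_ite_le_two_pow {a : ℝ} (ha : 0 ≤ a) (J : ℕ) :
    ∑' j : ℕ, (if j ≤ J then ENNReal.ofReal (a * 2 ^ j) else 0)
      ≤ ENNReal.ofReal (a * 2 ^ (J + 1)) := by
  rw [tsum_eq_sum (s := Finset.range (J + 1)) fun j hj => by
    rw [if_neg]; simpa [Nat.lt_succ_iff] using hj]
  calc _ ≤ ∑ j ∈ Finset.range (J + 1), ENNReal.ofReal (a * 2 ^ j) :=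
        Finset.sum_le_sum fun j _ => by split_ifs <;> simp
    _ = ENNReal.ofReal (∑ j ∈ Finset.range (J + 1), a * 2 ^ j) :=
        (ENNReal.ofReal_sum_of_nonneg fun j _ => by positivity).symm
    _ ≤ _ := by
        apply ENNReal.ofReal_le_ofReal
        rw [← Finset.mul_sum]
        gcongr
        rw [geom_sum_eq (by norm_num)]
        norm_num

lemma tsum_ite_gt_geometric_le {a q : ℝ} (ha : 0 ≤ a) (hq : 0 ≤ q) (hq1 : q < 1) (J : ℕ) :
    ∑' j : ℕ, (if j ≤ J then 0 else ENNReal.ofReal (a * q ^ j))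
      ≤ ENNReal.ofReal (a * q ^ (J + 1) / (1 - q)) := by
  rw [← Summable.sum_add_tsum_nat_add' (k := J + 1) ENNReal.summable, Finset.sum_eq_zero, zero_add,
    ← tsum_ofReal_geometric (by positivity) hq hq1]
  · refine ENNReal.tsum_le_tsum fun i => ?_
    rw [if_neg (by omega)]
    apply le_of_eq
    congr 1
    ring
  · intro j hj
    rw [if_pos (by simpa [Nat.lt_succ_iff] using hj)]

/-- Split at the J with 2^J ≤ X < 2^(J+1). Below, the sum is geometric with total at most 2^(J+1)/X
≤ 2; above, it has ratio 2^(-τ) and first term at most 1. -/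
lemma tsum_min_dyadic_le {τ X : ℝ} (hτ : 0 < τ) (hX : 1 ≤ X) :
    ∑' j : ℕ, ENNReal.ofReal (min (2 ^ j / X) ((2 ^ j / X) ^ (-τ)))
      ≤ ENNReal.ofReal (2 + 1 / (1 - (2 : ℝ) ^ (-τ))) := by
  obtain ⟨J, hJ1, hJ2⟩ := exists_nat_pow_near hX (one_lt_two : (1 : ℝ) < 2)
  have hX0 : 0 < X := by linarith
  have hq0 : 0 < (2 : ℝ) ^ (-τ) := by positivity
  have hq1 : (2 : ℝ) ^ (-τ) < 1 := Real.rpow_lt_one_of_one_lt_of_neg one_lt_two (by linarith)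
  have hpow : ∀ j : ℕ, ((2 : ℝ) ^ j / X) ^ (-τ) = X ^ τ * ((2 : ℝ) ^ (-τ)) ^ j := fun j => by
    rw [Real.div_rpow (by positivity) hX0.le, Real.rpow_neg hX0.le, div_inv_eq_mul, mul_comm,
      ← Real.rpow_natCast, ← Real.rpow_natCast, ← Real.rpow_mul two_pos.le,
      ← Real.rpow_mul two_pos.le, mul_comm (-τ)]
  calc _ ≤ ∑' j : ℕ, ((if j ≤ J then ENNReal.ofReal (1 / X * 2 ^ j) else 0) +
          if j ≤ J then 0 else ENNReal.ofReal (X ^ τ * ((2 : ℝ) ^ (-τ)) ^ j)) := by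
        refine ENNReal.tsum_le_tsum fun j => ?_
        split_ifs
        · rw [add_zero, one_div_mul_eq_div]
          exact ENNReal.ofReal_le_ofReal (min_le_left _ _)
        · rw [zero_add, ← hpow]
          exact ENNReal.ofReal_le_ofReal (min_le_right _ _)
    _ ≤ ENNReal.ofReal (1 / X * 2 ^ (J + 1)) +
          ENNReal.ofReal (X ^ τ * ((2 : ℝ) ^ (-τ)) ^ (J + 1) / (1 - (2 : ℝ) ^ (-τ))) := by
        rw [ENNReal.tsum_add]
        exact add_le_add (tsum_ite_le_two_pow (by positivity) J)
          (tsum_ite_gt_geometric_le (by positivity) hq0.le hq1 J)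
    _ ≤ _ := by
        have h1q : 0 < 1 - (2 : ℝ) ^ (-τ) := by linarith
        rw [← ENNReal.ofReal_add (by positivity) (by positivity), ← hpow]
        apply ENNReal.ofReal_le_ofReal
        gcongr
        · rw [one_div_mul_eq_div, div_le_iff₀ hX0, pow_succ]; linarith
        · refine Real.rpow_le_one_of_one_le_of_nonpos ?_ (by linarith)
          rw [one_le_div hX0]; exact hJ2.le

lemma tsum_waveletIndex (F : WaveletIndex → ℝ≥0∞) :
    ∑' l, F l = ∑' k : ℤ, F (Sum.inl k) + ∑' j : ℕ, ∑' k : ℤ, F (Sum.inr (j, k)) := by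
  rw [(HasSum.sum ENNReal.summable.hasSum ENNReal.summable.hasSum).tsum_eq, ← ENNReal.tsum_prod]
  rfl

/-! ## The estimator as a finite expansion -/

lemma finite_setOf_atomFun_ne_zero {h : ℝ → ℝ} {A : ℕ} (hh : IsStepAtom h A) (j : ℕ) (x : ℝ) :
    {k : ℤ | atomFun h j k x ≠ 0}.Finite := by
  refine (Finset.Icc ⌈(2 : ℝ) ^ j * x - A⌉ ⌊(2 : ℝ) ^ j * x + A⌋).finite_toSet.subset fun k hk => ?_
  have h1 : h ((2 : ℝ) ^ j * x - k) ≠ 0 := right_ne_zero_of_mul hk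
  have h2 := _root_.abs_le.1 (hh.abs_le _ h1)
  rw [Finset.mem_coe, Finset.mem_Icc, Int.ceil_le, Int.le_floor]
  constructor <;> linarith [h2.1, h2.2]

/-- A coefficient whose analysis function vanishes at every observed point is zero, and each of the
finitely many points meets finitely many supports at levels up to j₀. -/
lemma WaveletSystem.IsRegular.finite_setOf_thrCoeff_ne_zero {Φ : WaveletSystem} {A : ℕ}
    (hΦ : Φ.IsRegular A) (γ : ℝ) (n : ℕ) (j₀ : ℤ) {S : Set ℝ} (hS : S.Finite) :
    {l | thrCoeff Φ γ n j₀ S l ≠ 0}.Finite := by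
  have hfin : ∀ x, {l : WaveletIndex | l.level ≤ j₀ ∧ Φ.analysis l x ≠ 0}.Finite := by
    intro x
    refine (((finite_setOf_atomFun_ne_zero hΦ.father 0 x).image Sum.inl).union
      ((Set.finite_Iic j₀.toNat).biUnion fun j _ =>
        (finite_setOf_atomFun_ne_zero hΦ.psi j x).image fun k => Sum.inr (j, k))).subset ?_
    rintro (k | ⟨j, k⟩) ⟨hl, hx⟩
    · rw [WaveletSystem.analysis, dilate_inl] at hx
      exact Or.inl ⟨k, hx, rfl⟩
    · refine Or.inr (Set.mem_biUnion (x := j) ?_ ⟨k, hx, rfl⟩)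
      simp only [WaveletIndex.level] at hl
      rw [Set.mem_Iic]
      omega
  refine (hS.biUnion fun x _ => hfin x).subset fun l hl => ?_
  rw [Set.mem_ofPred_eq, thrCoeff] at hl
  split_ifs at hl with h
  · by_contra hc
    simp only [Set.mem_iUnion, Set.mem_ofPred_eq, not_exists, not_and, not_not] at hc
    refine hl ?_
    rw [empCoeff, pointSum_eq_finset_sum hS, Finset.sum_eq_zero, mul_zero]
    intro x hx
    exact hc x (by simpa using hx) h.2
  · exact absurd rfl hl

lemma memLp_two_of_mem_ballL12Inf {f : ℝ → ℝ} {R : ℝ} (hf : f ∈ ballL12Inf R) :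
    MemLp f 2 volume :=
  ⟨hf.1, hf.2.2.1.trans_lt ENNReal.ofReal_lt_top⟩

/-- Almost surely the estimator is a finite expansion, so the Riesz bound applies pathwise and
expectation passes inside the sum. Indices above j₀ contribute their squared coefficients. -/
theorem WaveletSystem.IsRegular.exists_lintegral_loss_le {Φ : WaveletSystem} {A : ℕ}
    (hΦ : Φ.IsRegular A) {c γ : ℝ} (hc : 0 < c) (hγ : c < γ) :
    ∃ K C : ℝ, 0 ≤ K ∧ 0 ≤ C ∧ ∀ {Ω : Type*} [MeasurableSpace Ω] {P : Measure Ω}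
      [IsProbabilityMeasure P] {N : Ω → Set ℝ} {f : ℝ → ℝ} {R : ℝ} {n : ℕ} {j₀ : ℤ},
      f ∈ ballL12Inf R → 0 ≤ᵐ[volume] f → 2 ≤ n → IsPoissonProcess N P (intensity n f) →
      ∫⁻ ω, eLpNorm (fun x => estimator Φ γ n j₀ (N ω) x - f x) 2 volume ^ 2 ∂P
        ≤ ENNReal.ofReal K * ∑' l : WaveletIndex, if l.level ≤ j₀ then
          ENNReal.ofReal (C * (min (Φ.coeff f l ^ 2)
            (varBound (Φ.analysis l) n f * (γ * Real.log n)) +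
          (varBound (Φ.analysis l) n f + Φ.coeff f l ^ 2) * (n : ℝ) ^ (-c)))
          else ENNReal.ofReal (Φ.coeff f l ^ 2) := by
  obtain ⟨K, hK0, hK⟩ := hΦ.basis.exists_loss_le
  obtain ⟨C, hC0, hC⟩ := hΦ.exists_coefficient_risk_le hc hγ
  refine ⟨K, C, hK0, hC0, ?_⟩
  intro Ω _ P _ N f R n j₀ hf hf0 hn hN
  have := isFiniteMeasure_intensity hf n
  have hzero : ∀ l : WaveletIndex, ¬ l.level ≤ j₀ → ∀ S, thrCoeff Φ γ n j₀ S l = 0 := by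
    intro l hl S
    rw [thrCoeff, if_neg fun h => hl h.2]
  have hmeas : ∀ l, AEMeasurable (fun ω => thrCoeff Φ γ n j₀ (N ω) l) P := by
    intro l
    by_cases hl : l.level ≤ j₀
    · exact (hC hf hf0 hn hN l hl).1
    · simp_rw [hzero l hl]
      exact aemeasurable_const
  calc _ ≤ ∫⁻ ω, ENNReal.ofReal K *
          ∑' l, ENNReal.ofReal ((thrCoeff Φ γ n j₀ (N ω) l - Φ.coeff f l) ^ 2) ∂P := by
        refine lintegral_mono_ae ?_
        filter_upwards [hN.ae_finite] with ω hω
        have hfin := hΦ.finite_setOf_thrCoeff_ne_zero γ n j₀ hω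
        have hout : ∀ l ∉ hfin.toFinset, thrCoeff Φ γ n j₀ (N ω) l = 0 := fun l hl => by
          simpa using hl
        have hest : ∀ x, estimator Φ γ n j₀ (N ω) x =
            ∑ l ∈ hfin.toFinset, thrCoeff Φ γ n j₀ (N ω) l * Φ.synthesis l x := fun x =>
          tsum_eq_sum fun l hl => by rw [hout l hl, zero_mul]
        simp_rw [hest]
        exact hK f (memLp_two_of_mem_ballL12Inf hf) _ _ hout
    _ = ENNReal.ofReal K * ∑' l, ∫⁻ ω,
          ENNReal.ofReal ((thrCoeff Φ γ n j₀ (N ω) l - Φ.coeff f l) ^ 2) ∂P := by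
        rw [lintegral_const_mul' _ _ ENNReal.ofReal_ne_top, lintegral_tsum]
        exact fun l => (((hmeas l).sub_const _).pow_const 2).ennreal_ofReal
    _ ≤ _ := by
        refine mul_le_mul_right (ENNReal.tsum_le_tsum fun l => ?_) _
        split_ifs with hl
        · exact (hC hf hf0 hn hN l hl).2
        · simp [hzero l hl]

/-! ## Summation over the levels -/

/-- The part of the risk that stems from one resolution level. -/
lemma tsum_level_risk_le {ι : Type*} {b v : ι → ℝ} {C t X V₁ V₂ e p : ℝ} (hp : 1 ≤ p) (hp2 : p ≤ 2)
    (hC : 0 ≤ C) (ht : 0 ≤ t) (he : 0 ≤ e) (hX : 0 ≤ X) (hV₂ : 0 ≤ V₂)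
    (hv0 : ∀ i, 0 ≤ v i) (hv2 : ∀ i, v i ≤ V₂)
    (hv1 : ∑' i, ENNReal.ofReal (v i) ≤ ENNReal.ofReal V₁) (hV₁ : 0 ≤ V₁)
    (hb : ellNorm (ENNReal.ofReal p) (fun i => ENNReal.ofReal |b i|) ≤ ENNReal.ofReal X) :
    ∑' i, ENNReal.ofReal (C * (min (b i ^ 2) (v i * t) + (v i + b i ^ 2) * e))
      ≤ ENNReal.ofReal (C * (min (V₁ * t) (X ^ p * (V₂ * t) ^ (1 - p / 2)) + (V₁ + X ^ 2) * e)) := by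
  have hmin0 : ∀ i, 0 ≤ min (b i ^ 2) (v i * t) := fun i =>
    le_min (sq_nonneg _) (mul_nonneg (hv0 i) ht)
  have hM0 : 0 ≤ min (V₁ * t) (X ^ p * (V₂ * t) ^ (1 - p / 2)) := le_min (by positivity) (by positivity)
  have hsq : ∑' i, ENNReal.ofReal (b i ^ 2) ≤ ENNReal.ofReal (X ^ 2) := by
    have := tsum_sq_le_of_ellNorm_le hp hp2 hb
    simp_rw [ofReal_abs_sq] at this
    rwa [ENNReal.ofReal_pow hX]
  have hmin : ∑' i, ENNReal.ofReal (min (b i ^ 2) (v i * t)) ≤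
      ENNReal.ofReal (min (V₁ * t) (X ^ p * (V₂ * t) ^ (1 - p / 2))) := by
    rw [ENNReal.ofReal_min]
    -- The first bound uses the total variance of the level, the second interpolates between the ℓ_p
    -- norm and the uniform variance bound.
    refine le_min ?_ ?_
    · calc _ ≤ ∑' i, ENNReal.ofReal (v i) * ENNReal.ofReal t := by
            refine ENNReal.tsum_le_tsum fun i => ?_
            rw [← ENNReal.ofReal_mul (hv0 i)]
            exact ENNReal.ofReal_le_ofReal (min_le_right _ _)
        _ ≤ ENNReal.ofReal V₁ * ENNReal.ofReal t := by
            rw [ENNReal.tsum_mul_right]; gcongr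
        _ = _ := (ENNReal.ofReal_mul hV₁).symm
    · exact tsum_min_sq_le hp hp2 hX (by positivity) (fun i => by gcongr; exact hv2 i) hb
  have hsplit : ∀ i, ENNReal.ofReal (C * (min (b i ^ 2) (v i * t) + (v i + b i ^ 2) * e)) =
      ENNReal.ofReal C * (ENNReal.ofReal (min (b i ^ 2) (v i * t)) +
        (ENNReal.ofReal (v i) + ENNReal.ofReal (b i ^ 2)) * ENNReal.ofReal e) := fun i => by
    have := hv0 i
    rw [ENNReal.ofReal_mul hC, ENNReal.ofReal_add (hmin0 i) (by positivity),
      ENNReal.ofReal_mul (by positivity), ENNReal.ofReal_add this (sq_nonneg _)]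
  simp_rw [hsplit]
  rw [ENNReal.tsum_mul_left, ENNReal.tsum_add, ENNReal.tsum_mul_right, ENNReal.tsum_add,
    ENNReal.ofReal_mul hC, ENNReal.ofReal_add hM0 (by positivity),
    ENNReal.ofReal_mul (by positivity), ENNReal.ofReal_add hV₁ (sq_nonneg _)]
  gcongr

/-- The trade-off between the two bounds of the main term. -/
lemma min_main_term_le {W R ε α p : ℝ} (hW : 0 ≤ W) (hR : 0 ≤ R) (hε : 0 < ε) (hα : 0 < α)
    (hp : p ≠ 0) (j : ℕ) :
    min (W * ε * 2 ^ j) ((R * (2 : ℝ) ^ (-((j : ℝ) * (α + 1 / 2 - 1 / p)))) ^ p *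
        (W * ε) ^ (1 - p / 2)) ≤
      (W + R ^ p * W ^ (1 - p / 2)) * ε ^ (2 * α / (2 * α + 1)) *
        min (2 ^ j / ε ^ (-(1 / (2 * α + 1))))
          ((2 ^ j / ε ^ (-(1 / (2 * α + 1)))) ^ (-(p * (α + 1 / 2 - 1 / p)))) := by
  have hα1 : 2 * α + 1 ≠ 0 := by positivity
  have hQ : 0 ≤ W + R ^ p * W ^ (1 - p / 2) := by positivity
  rw [mul_min_of_nonneg _ _ (by positivity)]
  -- Both branches are rewritten in the ratio of 2^j to the critical resolution ε^(-1/(2α+1)), which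
  -- extracts the common factor ε^(2α/(2α+1)).
  refine min_le_min ?_ ?_
  · have h1 : ε ^ (2 * α / (2 * α + 1)) * (2 ^ j / ε ^ (-(1 / (2 * α + 1)))) = ε * 2 ^ j := by
      rw [Real.rpow_neg hε.le, div_inv_eq_mul, mul_left_comm, ← Real.rpow_add hε,
        show 2 * α / (2 * α + 1) + 1 / (2 * α + 1) = 1 by field_simp, Real.rpow_one, mul_comm]
    rw [mul_assoc (W + _), h1, mul_assoc W]
    gcongr
    have : 0 ≤ R ^ p * W ^ (1 - p / 2) := by positivity
    linarith
  · have h1 : ε ^ (2 * α / (2 * α + 1)) *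
        (2 ^ j / ε ^ (-(1 / (2 * α + 1)))) ^ (-(p * (α + 1 / 2 - 1 / p)))
        = (2 : ℝ) ^ (-((j : ℝ) * (α + 1 / 2 - 1 / p)) * p) * ε ^ (1 - p / 2) := by
      rw [Real.div_rpow (by positivity) (by positivity), ← Real.rpow_natCast,
        ← Real.rpow_mul two_pos.le, ← Real.rpow_mul hε.le, mul_div_assoc', mul_comm (ε ^ _),
        mul_div_assoc, ← Real.rpow_sub hε]
      congr 2
      · ring
      · field_simp
        ring
    rw [mul_assoc (W + _), h1, Real.mul_rpow hR (by positivity), Real.mul_rpow hW hε.le,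
      ← Real.rpow_mul two_pos.le]
    have h2 : 0 ≤ (2 : ℝ) ^ (-((j : ℝ) * (α + 1 / 2 - 1 / p)) * p) * ε ^ (1 - p / 2) := by positivity
    calc _ = R ^ p * W ^ (1 - p / 2) *
          ((2 : ℝ) ^ (-((j : ℝ) * (α + 1 / 2 - 1 / p)) * p) * ε ^ (1 - p / 2)) := by ring
      _ ≤ _ := by gcongr; linarith

/-! ## Rates -/

lemma log_natCast_pos {n : ℕ} (hn : 2 ≤ n) : Real.log 2 ≤ Real.log n ∧ 0 < Real.log n := by
  have h : Real.log 2 ≤ Real.log n := Real.log_le_log two_pos (by exact_mod_cast hn)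
  exact ⟨h, (Real.log_pos one_lt_two).trans_le h⟩

lemma log_div_le_one {n : ℕ} (hn : 2 ≤ n) : Real.log n / n ≤ 1 := by
  have h : (0 : ℝ) < n := by positivity
  rw [div_le_one h]
  exact (Real.log_le_sub_one_of_pos h).trans (by linarith)

lemma resolution_bound_eq {n : ℕ} (hn : 2 ≤ n) (c : ℝ) :
    (n : ℝ) ^ c * Real.log n ^ (-c) = (Real.log n / n) ^ (-c) := by
  have h := (log_natCast_pos hn).2
  rw [Real.div_rpow h.le (by positivity), Real.rpow_neg (by positivity : (0 : ℝ) ≤ n), div_inv_eq_mul,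
    mul_comm]

/-- As log n ≤ n, the resolution bound (log n / n)^(-c) is at least 1, so j₀ + 1 > 0. -/
lemma exists_nat_level {n : ℕ} (hn : 2 ≤ n) {c : ℝ} (hc : 0 ≤ c) {j₀ : ℤ}
    (h : (n : ℝ) ^ c * Real.log n ^ (-c) < (2 : ℝ) ^ (j₀ + 1)) : ∃ J : ℕ, j₀ = J := by
  have hl := (log_natCast_pos hn).2
  have hn' : (0 : ℝ) < n := by positivity
  refine ⟨j₀.toNat, (Int.toNat_of_nonneg ?_).symm⟩
  by_contra hneg
  have h1 : (1 : ℝ) ≤ (n : ℝ) ^ c * Real.log n ^ (-c) := by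
    rw [resolution_bound_eq hn]
    exact Real.one_le_rpow_of_pos_of_le_one_of_nonpos (by positivity) (log_div_le_one hn)
      (by linarith)
  have h2 : (2 : ℝ) ^ (j₀ + 1) ≤ 1 := zpow_le_one_of_nonpos₀ one_le_two (by omega)
  linarith

lemma rpow_neg_le_rate {n : ℕ} (hn : 2 ≤ n) {c a : ℝ} (hc : 1 ≤ c) (ha : a ≤ 1) :
    (n : ℝ) ^ (-c) ≤ 1 / Real.log 2 * (Real.log n / n) ^ a := by
  obtain ⟨hl2, hl⟩ := log_natCast_pos hn
  have hlog2 := Real.log_pos one_lt_two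
  have hn' : (0 : ℝ) < n := by positivity
  calc (n : ℝ) ^ (-c) ≤ (n : ℝ) ^ (-1 : ℝ) := by
        apply Real.rpow_le_rpow_of_exponent_le _ (by linarith)
        have : (2 : ℝ) ≤ n := by exact_mod_cast hn
        linarith
    _ = 1 / Real.log 2 * (Real.log 2 / n) := by
        rw [Real.rpow_neg_one]; field_simp
    _ ≤ 1 / Real.log 2 * (Real.log n / n) ^ (1 : ℝ) := by rw [Real.rpow_one]; gcongr
    _ ≤ _ := mul_le_mul_of_nonneg_left
        (Real.rpow_le_rpow_of_exponent_ge (by positivity) (log_div_le_one hn) ha) (by positivity)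

/-- The 2^(J+1) produced by summing variances up to the finest level is cancelled by the remainder
n^(-c); the power of log n left over is bounded because n ≥ 2. -/
lemma two_pow_mul_rpow_neg_le {n : ℕ} (hn : 2 ≤ n) {c : ℝ} (hc : 0 ≤ c) {J : ℕ}
    (h : (2 : ℝ) ^ J ≤ (n : ℝ) ^ c * Real.log n ^ (-c)) :
    (n : ℝ) ^ (-c) * 2 ^ (J + 1) ≤ 2 * Real.log 2 ^ (-c) := by
  obtain ⟨hl2, hl⟩ := log_natCast_pos hn
  have hlog2 := Real.log_pos one_lt_two
  have hn' : (0 : ℝ) < n := by positivity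
  have h1 : (n : ℝ) ^ (-c) * 2 ^ J ≤ Real.log n ^ (-c) := by
    calc _ ≤ (n : ℝ) ^ (-c) * ((n : ℝ) ^ c * Real.log n ^ (-c)) := by gcongr
      _ = _ := by
        rw [← mul_assoc, ← Real.rpow_add hn']; simp
  have h2 : Real.log n ^ (-c) ≤ Real.log 2 ^ (-c) :=
    Real.rpow_le_rpow_of_nonpos hlog2 hl2 (by linarith)
  rw [pow_succ]
  linarith

/-- Since 2^(J+1) exceeds (log n / n)^(-c), the squared bias is at most (log n / n)^(2cδ). -/
lemma tail_le_rate {n : ℕ} (hn : 2 ≤ n) {c δ a : ℝ} (hδ : 0 ≤ δ) (ha : a ≤ 2 * c * δ) {J : ℕ}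
    (h : (n : ℝ) ^ c * Real.log n ^ (-c) < (2 : ℝ) ^ (J + 1)) :
    ((2 : ℝ) ^ (-(2 * δ))) ^ (J + 1) ≤ (Real.log n / n) ^ a := by
  have hl := (log_natCast_pos hn).2
  have hn' : (0 : ℝ) < n := by positivity
  have hε : 0 < Real.log n / n := by positivity
  rw [resolution_bound_eq hn] at h
  calc ((2 : ℝ) ^ (-(2 * δ))) ^ (J + 1) = ((2 : ℝ) ^ (J + 1)) ^ (-(2 * δ)) := by
        rw [← Real.rpow_natCast, ← Real.rpow_natCast, ← Real.rpow_mul two_pos.le,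
          ← Real.rpow_mul two_pos.le, mul_comm]
    _ ≤ ((Real.log n / n) ^ (-c)) ^ (-(2 * δ)) :=
        Real.rpow_le_rpow_of_nonpos (by positivity) h.le (by linarith)
    _ = (Real.log n / n) ^ (2 * c * δ) := by
        rw [← Real.rpow_mul hε.le]; congr 1; ring
    _ ≤ _ := Real.rpow_le_rpow_of_exponent_ge hε (log_div_le_one hn) ha

set_option maxHeartbeats 800000 in
/-- The sum of the coefficient risks over a Besov ball is of the order of the minimax rate. -/
lemma tsum_risk_le {Φ : WaveletSystem} {A : ℕ} (hΦ : Φ.IsRegular A) {C R R' p α c γ δ a : ℝ}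
    (hC : 0 ≤ C) (hR : 0 ≤ R) (hR' : 0 ≤ R') (hp₁ : 1 ≤ p) (hp₂ : p ≤ 2) (hα : 0 < α)
    (hδ : δ = α + 1 / 2 - 1 / p) (hδ0 : 0 < δ) (ha : a = 2 * α / (2 * α + 1)) (hac : a ≤ 2 * c * δ)
    (hc : 1 ≤ c) (hγ : 0 ≤ γ) :
    ∃ C' : ℝ, ∀ (q : ℝ≥0∞), 1 ≤ q → ∀ n : ℕ, 2 ≤ n → ∀ J : ℕ,
      (2 : ℝ) ^ J ≤ (n : ℝ) ^ c * Real.log n ^ (-c) →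
      (n : ℝ) ^ c * Real.log n ^ (-c) < (2 : ℝ) ^ (J + 1) →
      ∀ f ∈ besovBall Φ α (ENNReal.ofReal p) q R ∩ ballL12Inf R',
      (∑' l : WaveletIndex, if l.level ≤ (J : ℤ) then
          ENNReal.ofReal (C * (min (Φ.coeff f l ^ 2)
            (varBound (Φ.analysis l) n f * (γ * Real.log n)) +
          (varBound (Φ.analysis l) n f + Φ.coeff f l ^ 2) * (n : ℝ) ^ (-c)))
          else ENNReal.ofReal (Φ.coeff f l ^ 2))
        ≤ ENNReal.ofReal (C' * (Real.log n / n) ^ a) := by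
  set D₀ := supNorm father ^ 2 * (2 * A + 1) with hD₀
  set D := supNorm Φ.psi ^ 2 * (2 * A + 1) with hD
  have hD₀0 : 0 ≤ D₀ := by positivity
  have hD0 : 0 ≤ D := by positivity
  set w := 1 / Real.log 2 with hw
  have hlog2 := Real.log_pos one_lt_two
  have hw0 : 0 ≤ w := by positivity
  set H := Real.log 2 ^ (-c) with hH
  set Q := D * R' * γ + R ^ p * (D * R' * γ) ^ (1 - p / 2) with hQ
  have hQ0 : 0 ≤ Q := by positivity
  set G := 2 + 1 / (1 - (2 : ℝ) ^ (-(p * δ))) with hG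
  set s := (2 : ℝ) ^ (-(2 * δ)) with hs
  have hs0 : 0 < s := by positivity
  have hs1 : s < 1 := Real.rpow_lt_one_of_one_lt_of_neg one_lt_two (by linarith)
  have h1s : 0 < 1 - s := by linarith
  have hpδ : 0 < p * δ := by positivity
  have hG0 : 0 ≤ G := by
    have : (2 : ℝ) ^ (-(p * δ)) < 1 := Real.rpow_lt_one_of_one_lt_of_neg one_lt_two (by linarith)
    have : 0 < 1 - (2 : ℝ) ^ (-(p * δ)) := by linarith
    positivity
  have ha1 : a ≤ 1 := by rw [ha, div_le_one (by positivity)]; linarith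
  -- The first summand is the father level. The others are, in order, the main term, the variance
  -- remainder, the squared coefficient remainder and the levels above J.
  refine ⟨C * (D₀ * R' * γ + (D₀ * R' + R ^ 2) * w) + (C * Q * G + C * (D * R') * w * (2 * H) +
    C * R ^ 2 * w / (1 - s) + R ^ 2 / (1 - s)), ?_⟩
  intro q hq n hn J hJ1 hJ2 f hf
  have hl := (log_natCast_pos hn).2
  have hn' : (0 : ℝ) < n := by positivity
  have hn1 : (1 : ℝ) ≤ n := by exact_mod_cast (by omega : 1 ≤ n)
  set ε := Real.log n / n with hε
  have hε0 : 0 < ε := by positivity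
  have hε1 : ε ≤ 1 := log_div_le_one hn
  set e := (n : ℝ) ^ (-c) with he
  have he0 : 0 ≤ e := by positivity
  have hew : e ≤ w * ε ^ a := rpow_neg_le_rate hn hc ha1
  have hεa : ε ≤ ε ^ a := by
    simpa using Real.rpow_le_rpow_of_exponent_ge hε0 hε1 ha1
  have hninv : 1 / (n : ℝ) ≤ w * ε ^ a := by
    have := rpow_neg_le_rate hn le_rfl ha1
    rwa [Real.rpow_neg_one, ← one_div] at this
  have hεa0 : 0 < ε ^ a := by positivity
  have hnpos : 0 < n := by omega
  have hfather : ∑' k : ℤ, ENNReal.ofReal (C * (min (Φ.coeff f (Sum.inl k) ^ 2)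
      (varBound (Φ.analysis (Sum.inl k)) n f * (γ * Real.log n)) +
      (varBound (Φ.analysis (Sum.inl k)) n f + Φ.coeff f (Sum.inl k) ^ 2) * e))
      ≤ ENNReal.ofReal (C * (D₀ * R' * γ + (D₀ * R' + R ^ 2) * w) * ε ^ a) := by
    have h := tsum_level_risk_le (b := fun k : ℤ => Φ.coeff f (Sum.inl k))
      (v := fun k => varBound (Φ.analysis (Sum.inl k)) n f) (C := C) (t := γ * Real.log n) (X := R)
      (V₁ := D₀ * R' / n * 2 ^ 0) (V₂ := D₀ * R' / n) (e := e) hp₁ hp₂ hC (by positivity) he0 hR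
      (by positivity) (fun k => varBound_nonneg _ _ _)
      (fun k => by
        rw [WaveletSystem.analysis, dilate_inl]
        exact varBound_atomFun_le hΦ.father hR' hf.2 hnpos 0 k)
      (by
        simp_rw [WaveletSystem.analysis, dilate_inl]
        exact tsum_varBound_atomFun_le hΦ.father hf.2 hnpos 0)
      (by positivity) (ellNorm_father_le_of_mem_besovBall hf.1)
    refine h.trans (ENNReal.ofReal_le_ofReal ?_)
    rw [mul_assoc C]
    gcongr
    have h1 : D₀ * R' / n * 2 ^ 0 * (γ * Real.log n) = D₀ * R' * γ * ε := by
      rw [hε]; field_simp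
    have h2 : D₀ * R' / n * 2 ^ 0 ≤ D₀ * R' := by
      rw [pow_zero, mul_one]; exact div_le_self (by positivity) hn1
    calc _ ≤ D₀ * R' * γ * ε + (D₀ * R' + R ^ 2) * e := by
          rw [← h1]
          gcongr
          exact min_le_left _ _
      _ ≤ D₀ * R' * γ * ε ^ a + (D₀ * R' + R ^ 2) * (w * ε ^ a) := by gcongr
      _ = _ := by ring
  have hXsq : ∀ j : ℕ, (R * (2 : ℝ) ^ (-((j : ℝ) * δ))) ^ 2 = R ^ 2 * s ^ j := fun j => by
    rw [mul_pow, hs, ← Real.rpow_natCast, ← Real.rpow_natCast, ← Real.rpow_natCast,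
      ← Real.rpow_mul two_pos.le, ← Real.rpow_mul two_pos.le]
    congr 2
    push_cast; ring
  have hell : ∀ j : ℕ, ellNorm (ENNReal.ofReal p)
      (fun k : ℤ => ENNReal.ofReal |Φ.coeff f (Sum.inr (j, k))|)
      ≤ ENNReal.ofReal (R * (2 : ℝ) ^ (-((j : ℝ) * δ))) := fun j => by
    rw [hδ]; exact ellNorm_level_le_of_mem_besovBall hp₁ hq hf.1 j
  have hlevel : ∀ j : ℕ, ∑' k : ℤ, ENNReal.ofReal (C * (min (Φ.coeff f (Sum.inr (j, k)) ^ 2)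
      (varBound (Φ.analysis (Sum.inr (j, k))) n f * (γ * Real.log n)) +
      (varBound (Φ.analysis (Sum.inr (j, k))) n f + Φ.coeff f (Sum.inr (j, k)) ^ 2) * e))
      ≤ ENNReal.ofReal (C * Q * ε ^ a) * ENNReal.ofReal (min (2 ^ j / ε ^ (-(1 / (2 * α + 1))))
          ((2 ^ j / ε ^ (-(1 / (2 * α + 1)))) ^ (-(p * δ)))) +
        ENNReal.ofReal (C * (D * R') / n * e * 2 ^ j) + ENNReal.ofReal (C * R ^ 2 * e * s ^ j) := by
    intro j
    have h := tsum_level_risk_le (b := fun k : ℤ => Φ.coeff f (Sum.inr (j, k)))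
      (v := fun k => varBound (Φ.analysis (Sum.inr (j, k))) n f) (C := C) (t := γ * Real.log n)
      (X := R * (2 : ℝ) ^ (-((j : ℝ) * δ)))
      (V₁ := D * R' / n * 2 ^ j) (V₂ := D * R' / n) (e := e) hp₁ hp₂ hC (by positivity) he0
      (by positivity) (by positivity) (fun k => varBound_nonneg _ _ _)
      (fun k => varBound_atomFun_le hΦ.psi hR' hf.2 hnpos j k)
      (tsum_varBound_atomFun_le hΦ.psi hf.2 hnpos j) (by positivity) (hell j)
    refine h.trans ?_
    have hmin := min_main_term_le (W := D * R' * γ) (R := R) (ε := ε) (α := α) (p := p)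
      (by positivity) hR hε0 hα (by positivity) j
    rw [← hδ, ← hQ, ← ha] at hmin
    have h1 : D * R' / n * 2 ^ j * (γ * Real.log n) = D * R' * γ * ε * 2 ^ j := by
      rw [hε]; field_simp
    have h2 : D * R' / n * (γ * Real.log n) = D * R' * γ * ε := by
      rw [hε]; field_simp
    rw [h1, h2, hXsq]
    have hm0 : 0 ≤ min (2 ^ j / ε ^ (-(1 / (2 * α + 1))))
          ((2 ^ j / ε ^ (-(1 / (2 * α + 1)))) ^ (-(p * δ))) := le_min (by positivity) (by positivity)
    rw [← ENNReal.ofReal_mul (by positivity), ← ENNReal.ofReal_add (by positivity) (by positivity),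
      ← ENNReal.ofReal_add (by positivity) (by positivity)]
    apply ENNReal.ofReal_le_ofReal
    have := mul_le_mul_of_nonneg_left hmin hC
    have h3 : C * (D * R') / n * e * 2 ^ j = C * (D * R' / n * 2 ^ j * e) := by ring
    rw [h3]
    linarith
  have htail : ∀ j : ℕ, ∑' k : ℤ, ENNReal.ofReal (Φ.coeff f (Sum.inr (j, k)) ^ 2)
      ≤ ENNReal.ofReal (R ^ 2 * s ^ j) := by
    intro j
    have h := tsum_sq_le_of_ellNorm_le hp₁ hp₂ (hell j)
    simp_rw [ofReal_abs_sq] at h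
    rwa [← ENNReal.ofReal_pow (by positivity), hXsq] at h
  rw [tsum_waveletIndex, add_mul, ENNReal.ofReal_add (by positivity) (by positivity)]
  refine add_le_add ?_ ?_
  · refine le_trans (le_of_eq (tsum_congr fun k => ?_)) hfather
    rw [if_pos]
    simp only [WaveletIndex.level]
    omega
  -- The main term and the squared coefficient remainder converge over all j, so their cut-off at J
  -- is dropped. The variance remainder grows like 2^j and needs it.
  · calc _ ≤ ∑' j : ℕ, (ENNReal.ofReal (C * Q * ε ^ a) *
            ENNReal.ofReal (min (2 ^ j / ε ^ (-(1 / (2 * α + 1))))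
              ((2 ^ j / ε ^ (-(1 / (2 * α + 1)))) ^ (-(p * δ)))) +
            (if j ≤ J then ENNReal.ofReal (C * (D * R') / n * e * 2 ^ j) else 0) +
            ENNReal.ofReal (C * R ^ 2 * e * s ^ j) +
            if j ≤ J then 0 else ENNReal.ofReal (R ^ 2 * s ^ j)) := by
          refine ENNReal.tsum_le_tsum fun j => ?_
          have hlev : ∀ k : ℤ, WaveletIndex.level (Sum.inr (j, k)) = (j : ℤ) := fun _ => rfl
          simp_rw [hlev, Nat.cast_le]
          split_ifs with hj
          · rw [add_zero]
            exact hlevel j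
          · exact (htail j).trans le_add_self
      _ ≤ ENNReal.ofReal (C * Q * ε ^ a) * ENNReal.ofReal G +
            ENNReal.ofReal (C * (D * R') / n * e * 2 ^ (J + 1)) +
            ENNReal.ofReal (C * R ^ 2 * e / (1 - s)) +
            ENNReal.ofReal (R ^ 2 * s ^ (J + 1) / (1 - s)) := by
          rw [ENNReal.tsum_add, ENNReal.tsum_add, ENNReal.tsum_add, ENNReal.tsum_mul_left]
          refine add_le_add (add_le_add (add_le_add (mul_le_mul_right (tsum_min_dyadic_le hpδ ?_) _)
            (tsum_ite_le_two_pow (by positivity) J)) (tsum_ofReal_geometric (by positivity) hs0.le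
            hs1).le) (tsum_ite_gt_geometric_le (by positivity) hs0.le hs1 J)
          refine Real.one_le_rpow_of_pos_of_le_one_of_nonpos hε0 hε1 ?_
          have : 0 ≤ 1 / (2 * α + 1) := by positivity
          linarith
      _ ≤ _ := by
          rw [← ENNReal.ofReal_mul (by positivity),
            ← ENNReal.ofReal_add (by positivity) (by positivity),
            ← ENNReal.ofReal_add (by positivity) (by positivity),
            ← ENNReal.ofReal_add (by positivity) (by positivity)]
          apply ENNReal.ofReal_le_ofReal
          have h1 : C * (D * R') / n * e * 2 ^ (J + 1) ≤ C * (D * R') * w * (2 * H) * ε ^ a := by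
            calc _ = C * (D * R') * (1 / n) * (e * 2 ^ (J + 1)) := by ring
              _ ≤ C * (D * R') * (w * ε ^ a) * (2 * H) :=
                  mul_le_mul (by gcongr) (two_pow_mul_rpow_neg_le hn (by linarith) hJ1)
                    (by positivity) (by positivity)
              _ = _ := by ring
          have h2 : C * R ^ 2 * e / (1 - s) ≤ C * R ^ 2 * w / (1 - s) * ε ^ a := by
            calc _ ≤ C * R ^ 2 * (w * ε ^ a) / (1 - s) := by gcongr
              _ = _ := by ring
          have h3 : R ^ 2 * s ^ (J + 1) / (1 - s) ≤ R ^ 2 / (1 - s) * ε ^ a := by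
            calc _ ≤ R ^ 2 * ε ^ a / (1 - s) := by
                  gcongr
                  exact tail_le_rate hn hδ0.le hac hJ2
              _ = _ := by ring
          linarith

end PoissonWavelet

end

/-! ### Conclusion: conditions on the parameters and assembly. -/

theorem theorem3 (r : ℝ) (Φ : PoissonWavelet.WaveletSystem) (hΦ : Φ.IsAdmissible r)
    (R R' : ℝ) (hR : 0 < R) (hR' : 0 < R') (p : ℝ) (hp₁ : 1 ≤ p) (hp₂ : p ≤ 2)
    (α : ℝ) (hα₁ : max 0 (1 / p - 1 / 2) < α) (hα₂ : α < r + 1)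
    (c : ℝ) (hc₁ : 1 ≤ c) (hc₂ : 1 / p - 1 / 2 ≤ α * (1 - 1 / (c * (1 + 2 * α))))
    (γ : ℝ) (hγ : c < γ) :
    ∃ C : ℝ, ∀ (q : ℝ≥0∞), 1 ≤ q → ∀ (n : ℕ), 2 ≤ n →
      ∀ (j₀ : ℤ), (2 : ℝ) ^ j₀ ≤ (n : ℝ) ^ c * Real.log n ^ (-c) →
        (n : ℝ) ^ c * Real.log n ^ (-c) < (2 : ℝ) ^ (j₀ + 1) →
      ∀ f ∈ PoissonWavelet.besovBall Φ α (ENNReal.ofReal p) q R ∩ PoissonWavelet.ballL12Inf R',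
        0 ≤ᵐ[volume] f →
      ∀ {Ω : Type*} [MeasurableSpace Ω] (P : Measure Ω) [IsProbabilityMeasure P]
        (N : Ω → Set ℝ),
        PoissonWavelet.IsPoissonProcess N P
          (volume.withDensity (fun x => ENNReal.ofReal (n * f x))) →
        ∫⁻ ω, eLpNorm (fun x => PoissonWavelet.estimator Φ γ n j₀ (N ω) x - f x) 2 volume ^ 2 ∂P
          ≤ ENNReal.ofReal (C * (Real.log n / n) ^ (2 * α / (2 * α + 1))) := by
  have hα0 : 0 < α := (le_max_left _ _).trans_lt hα₁
  have hδ0 : 0 < α + 1 / 2 - 1 / p := by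
    have := (le_max_right 0 (1 / p - 1 / 2)).trans_lt hα₁
    linarith
  have hc0 : 0 < c := by linarith
  -- The lower bound on c, multiplied out, is α/(c(1 + 2α)) ≤ δ, the condition for the bias beyond
  -- j₀ not to exceed the rate.
  have hac : 2 * α / (2 * α + 1) ≤ 2 * c * (α + 1 / 2 - 1 / p) := by
    have h1 : α / (c * (1 + 2 * α)) ≤ α + 1 / 2 - 1 / p := by
      have : α * (1 - 1 / (c * (1 + 2 * α))) = α - α / (c * (1 + 2 * α)) := by ring
      linarith
    calc 2 * α / (2 * α + 1) = 2 * c * (α / (c * (1 + 2 * α))) := by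
          rw [add_comm 1]; field_simp
      _ ≤ _ := by gcongr
  obtain ⟨A, hA⟩ := hΦ.exists_isRegular
  obtain ⟨K, C, hK0, hC0, hloss⟩ := hA.exists_lintegral_loss_le hc0 hγ
  obtain ⟨C', hC'⟩ := PoissonWavelet.tsum_risk_le hA hC0 hR.le hR'.le hp₁ hp₂ hα0 rfl hδ0 rfl hac
    hc₁ (hc0.trans hγ).le
  refine ⟨K * C', ?_⟩
  intro q hq n hn j₀ hj₁ hj₂ f hf hf0 Ω _ P _ N hN
  obtain ⟨J, rfl⟩ := PoissonWavelet.exists_nat_level hn hc0.le hj₂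
  refine (hloss hf.2 hf0 hn hN).trans ?_
  rw [mul_assoc, ENNReal.ofReal_mul hK0]
  refine mul_le_mul_right (hC' q hq n hn J (by exact_mod_cast hj₁) (by exact_mod_cast hj₂) f hf) _
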